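/- Let $p\ge 1$ and let $(\alpha_n)_{n\ge 0}$ be a sequence in the open unit disk $\mathbb D$ with $\alpha_{n+p}=\alpha_n$ for all $n$, not identically $0$. Put $\rho_n=(1-|\alpha_n|^2)^{1/2}$, and let $\varphi_n$ be the orthonormal polynomials on the unit circle with these Verblunsky coefficients: $\varphi_0=1$, $\varphi_{n+1}(z)=\rho_n^{-1}\bigl(z\varphi_n(z)-\bar\alpha_n\varphi_n^*(z)\bigr)$, where $\varphi_n^*(z)=z^n\,\overline{\varphi_n(1/\bar z)}$. Let $\psi_n$ be the polynomials obtained in the same way from $(-\alpha_n)$. Let $$A_k(z)=\rho_k^{-1}\begin{pmatrix} z&-\bar\alpha_k\\-z\alpha_k&1\end{pmatrix},\qquad T_p(z)=A_{p-1}(z)\cdots A_0(z),\qquad \Delta(e^{i\theta})=e^{-ip\theta/2}\,\mathrm{Tr}\,T_p(e^{i\theta})\in\mathbb R .$$ The bands are the arcs $\{e^{i\theta}: x\le\theta\le y\}$, $x<y$, such that $|\Delta|=2$ at both endpoints and $|\Delta|<2$ for $\theta\in(x,y)$. There are $p$ of them, $B_1,\dots,B_p$; neighbouring bands may share an endpoint.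 For $z$ outside the bands let $P_+(z)$ be the spectral projection of $T_p(z)$ for its eigenvalue of larger modulus, along the other eigenvector, and set $a=\frac12\langle\binom11,P_+\binom11\rangle$, $b=\frac12\langle\binom1{-1},P_+\binom11\rangle$ and $j_k(z)=a(z)\varphi_k(z)+b(z)\psi_k(z)$ for $k=0,\dots,p-1$. A point $z_0$ of a band is called singular if $\lim_{r\uparrow1}j_k(rz_0)=0$ for some $k\in\{0,\dots,p-1\}$. Let $N^{(n,j)}$ be the number of zeros $z_0$ of $\varphi_n$, counted with multiplicity, such that $\arg z_0$ lies in band $j$ (that is, $z_0\neq0$ and $z_0/|z_0|\in B_j$) and $1-|z_0|\le n^{-1/2}$. Then: (a) $\displaystyle\sup_{n,j}\Bigl|N^{(n,j)}-\frac np\Bigr|<\infty$. (b) There are constants $C$ and $n_0$ (depending only on the sequence $(\alpha_n)$ and on $p$) such that for all $n\ge n_0$ and all $j$, every zero $z_0$ counted by $N^{(n,j)}$ satisfies $1-|z_0|\le C\,\dfrac{\log n}{n}$. If there are no singular points, then $C$ and $n_0$ can be chosen so that $1-|z_0|\le \dfrac Cn$ for all these zeros. -/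

import Mathlib

open Polynomial Filter Topology

noncomputable section

namespace PeriodicOPUC

/-- `ρ_k = (1 - |α_k|²)^{1/2}`. -/
def rho (α : ℕ → ℂ) (k : ℕ) : ℝ := Real.sqrt (1 - ‖α k‖ ^ 2)

/-- The reversed polynomial of `f` with respect to degree `n`: `f^*(z) = z^n conj (f (1 / conj z))`,
that is, the coefficients are conjugated and their order is reversed. -/
def starPoly (n : ℕ) (f : ℂ[X]) : ℂ[X] := (f.map (starRingEnd ℂ)).reflect n

/-- The orthonormal polynomials `φ_n` on the unit circle with Verblunsky coefficients `α`:
`φ_0 = 1` and `φ_{n+1}(z) = ρ_n⁻¹ (z φ_n(z) - conj(α_n) φ_n^*(z))`. -/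
def phi (α : ℕ → ℂ) : ℕ → ℂ[X]
  | 0 => 1
  | n + 1 => C ((rho α n : ℂ)⁻¹) *
      (X * phi α n - C (starRingEnd ℂ (α n)) * starPoly n (phi α n))

/-- The second kind polynomials `ψ_n`: Verblunsky coefficients `-α`. -/
def psi (α : ℕ → ℂ) (n : ℕ) : ℂ[X] := phi (fun k => -α k) n

/-- The one-step matrix `A_k(z)`. -/
def stepMatrix (α : ℕ → ℂ) (k : ℕ) (z : ℂ) : Matrix (Fin 2) (Fin 2) ℂ :=
  ((rho α k : ℂ)⁻¹) • !![z, -(starRingEnd ℂ (α k)); -(z * α k), 1]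

/-- The transfer matrix `T_n(z) = A_{n-1}(z) ⋯ A_0(z)`. -/
def transfer (α : ℕ → ℂ) : ℕ → ℂ → Matrix (Fin 2) (Fin 2) ℂ
  | 0, _ => 1
  | n + 1, z => stepMatrix α n z * transfer α n z

/-- The discriminant `Δ = z^{-p/2} Tr T_p(z)` at the point `z = e^{iθ}`, as a function of the
angle `θ ∈ ℝ` (so that `z^{-p/2} = e^{-ipθ/2}` also makes sense for odd `p`). It is real-valued. -/
def discr (α : ℕ → ℂ) (p : ℕ) (θ : ℝ) : ℂ :=
  Complex.exp (-((p : ℂ) * θ / 2) * Complex.I) *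
    (transfer α p (Complex.exp (θ * Complex.I))).trace

/-- `{e^{iθ} | x ≤ θ ≤ y}` is one of the bands: `Δ ∈ (-2, 2)` on `(x, y)`, and the two endpoints
solve `Δ = ±2`. Two bands may have a common endpoint (a closed gap). -/
def IsBand (α : ℕ → ℂ) (p : ℕ) (x y : ℝ) : Prop :=
  x < y ∧ ‖discr α p x‖ = 2 ∧ ‖discr α p y‖ = 2 ∧ ∀ θ ∈ Set.Ioo x y, ‖discr α p θ‖ < 2

/-- `arg z ∈ [x, y]` modulo `2π`. -/
def ArgIn (z : ℂ) (x y : ℝ) : Prop :=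
  z ≠ 0 ∧ ∃ θ ∈ Set.Icc x y, z = ‖z‖ * Complex.exp (θ * Complex.I)

open scoped Classical in
/-- The zeros `z` of `φ_n`, with multiplicity, with `arg z` in the band `[x, y]` and
`1 - |z| ≤ n^{-1/2}`. -/
def bandZeros (α : ℕ → ℂ) (n : ℕ) (x y : ℝ) : Multiset ℂ :=
  (phi α n).roots.filter (fun z => ArgIn z x y ∧ 1 - ‖z‖ ≤ (n : ℝ) ^ (-(1 / 2) : ℝ))

/-- A square root of `(Tr T_p(z) / 2)² - det T_p(z)`. -/
def discrRoot (α : ℕ → ℂ) (p : ℕ) (z : ℂ) : ℂ :=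
  (((transfer α p z).trace / 2) ^ 2 - (transfer α p z).det) ^ (1 / 2 : ℂ)

open scoped Classical in
/-- The eigenvalue `z^{p/2} Γ_+(z)` of `T_p(z)`: of the two eigenvalues, the one of larger
modulus (the moduli differ when `z` is not in the bands). -/
def eigPlus (α : ℕ → ℂ) (p : ℕ) (z : ℂ) : ℂ :=
  if ‖(transfer α p z).trace / 2 - discrRoot α p z‖ ≤
      ‖(transfer α p z).trace / 2 + discrRoot α p z‖
  then (transfer α p z).trace / 2 + discrRoot α p z
  else (transfer α p z).trace / 2 - discrRoot α p z

/-- The other eigenvalue `z^{p/2} Γ_-(z)` of `T_p(z)`. -/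
def eigMinus (α : ℕ → ℂ) (p : ℕ) (z : ℂ) : ℂ := (transfer α p z).trace - eigPlus α p z

/-- The spectral projection
`P_+ = (z^{-p/2} T_p - Γ_-) / (Γ_+ - Γ_-) = (T_p - z^{p/2} Γ_-) / (z^{p/2} Γ_+ - z^{p/2} Γ_-)`. -/
def projPlus (α : ℕ → ℂ) (p : ℕ) (z : ℂ) : Matrix (Fin 2) (Fin 2) ℂ :=
  (eigPlus α p z - eigMinus α p z)⁻¹ •
    (transfer α p z - eigMinus α p z • (1 : Matrix (Fin 2) (Fin 2) ℂ))

/-- `a(z) = ½ ⟨(1,1), P_+(z) (1,1)⟩`. -/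
def coefA (α : ℕ → ℂ) (p : ℕ) (z : ℂ) : ℂ :=
  1 / 2 * (![1, 1] ⬝ᵥ (projPlus α p z).mulVec ![1, 1])

/-- `b(z) = ½ ⟨(1,-1), P_+(z) (1,1)⟩`. -/
def coefB (α : ℕ → ℂ) (p : ℕ) (z : ℂ) : ℂ :=
  1 / 2 * (![1, -1] ⬝ᵥ (projPlus α p z).mulVec ![1, 1])

/-- `j_b(z) = a(z) φ_b(z) + b(z) ψ_b(z)`, for `z` outside the bands. -/
def jost (α : ℕ → ℂ) (p b : ℕ) (z : ℂ) : ℂ :=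
  coefA α p z * (phi α b).eval z + coefB α p z * (psi α b).eval z

/-- `z₀` is a singular point: it lies in a band and `j_b(z₀) = 0` for some `b = 0, …, p - 1`,
where the value of `j_b` at a point of the bands is the radial limit from inside the disk. -/
def IsSingularPoint (α : ℕ → ℂ) (p : ℕ) (z₀ : ℂ) : Prop :=
  (∃ x y θ : ℝ, IsBand α p x y ∧ θ ∈ Set.Icc x y ∧ z₀ = Complex.exp (θ * Complex.I)) ∧
    ∃ b < p, Tendsto (fun r : ℝ => jost α p b (r * z₀)) (𝓝[<] 1) (𝓝 0)

end PeriodicOPUC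

end

/-!
Along an arithmetic progression `n = m p + b` the values `x_m = φ_{mp+b}(z)` satisfy the two-term
recursion `x_{m+2} = Tr T_p(z) x_{m+1} - z^p x_m`. With `λ_±` the eigenvalues of `T_p(z)` this gives
`(λ_+ - λ_-) x_m = λ_+^m J_+ - λ_-^m J_-`, where `J_± = φ_{b+p}(z) - λ_∓ φ_b(z)`, and
`j_b = J_+ / (λ_+ - λ_-)`. So a zero of `φ_n` is a solution of `λ_+^m J_+ = λ_-^m J_-`. Everything
else rests on this equation.

*Distance to the circle.* On the circle `T_p(z)` preserves the form `|u_1|² - |u_2|²`; for `|z| < 1`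
it maps the form below `|z|^p` times itself, with a gain proportional to `1 - |z|`. This gives
`|λ_+|² ≥ |z|^p (1 + (1 - |z|))` and hence `(1 + (1 - |z|))^m |J_+| ≤ |J_-|` at a zero
(`zero_bound`). The product `J_+ J_-` is a polynomial, and it is not zero: otherwise one eigenvalue
would be a polynomial, hence a monomial as a divisor of `z^p`, whereas the constant and the leading
coefficient of `Tr T_p` are equal and greater than one. Therefore `|J_+|` is at least a power of
`1 - |z|`, which gives the bound `O(log n / n)` (`zeros_log_bound`). Near a point that is not singular `j_b` is bounded below inside
the disk (`jost_bounded_below`), and the factor `log n` disappears (`zeros_inv_bound`).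

*Counting.* The trace of `T_p` has exactly `p` zeros, all simple and on the circle, and each band
contains exactly one of them in its interior, so there are `p` bands modulo `2π`. As `φ_n` has at
most `n` zeros, it suffices to find `n / p - O(1)` zeros over each open band: the upper bound for
one band follows from the lower bounds for the `p - 1` others (`card_bandZeros_add_sum_le`).

For the lower bound write `Δ(θ) = 2 cos η` with a complex angle `θ` and quasi-momentum `η`; as `θ`
runs over the band, `η` runs over `[0, π]`. The zero condition becomes `e^{2imη} J_+ = J_-`. Near each
`η₀ ∈ [0, π]` there is an analytic chart `ζ ↦ θ(ζ)` with `Δ(θ(ζ)) = 2 cos(η₀ ± ζ)`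
(`exists_chart`), also at the edges of the band, since there `Δ ∓ 2` vanishes to order at most two.
In this chart the quotient `J_- / J_+` is `ζ^κ e^{g(ζ)}` with `g` analytic, and the zero condition is
a fixed point problem that is a contraction near each point of the lattice `π ℤ / m` at a distance
at least `K / m` from `η₀` (`exists_perturbed_point`). So short intervals of quasi-momenta of length
`ℓ` carry at least `ℓ m / π - O(1)` zeros (`local_count`), and adding them up over `[0, π]` yields
`m - O(1)` zeros for the band (`exists_le_ncard_bandZeroSet`).
-/

noncomputable section

namespace PeriodicOPUC

variable {α : ℕ → ℂ}

/-! ### The recursion and the transfer matrices -/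

lemma rho_pos (hα : ∀ n, ‖α n‖ < 1) (k : ℕ) : 0 < rho α k := by
  have := hα k
  have h0 := norm_nonneg (α k)
  exact Real.sqrt_pos.2 (by nlinarith)

lemma rho_sq (hα : ∀ n, ‖α n‖ < 1) (k : ℕ) : rho α k ^ 2 = 1 - ‖α k‖ ^ 2 := by
  have := hα k
  have h0 := norm_nonneg (α k)
  exact Real.sq_sqrt (by nlinarith)

lemma rho_le_one (k : ℕ) : rho α k ≤ 1 :=
  Real.sqrt_le_one.2 (by have := sq_nonneg ‖α k‖; linarith)

lemma natDegree_starPoly_le {n : ℕ} {f : ℂ[X]} (hf : f.natDegree ≤ n) :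
    (starPoly n f).natDegree ≤ n := by
  rw [natDegree_le_iff_coeff_eq_zero]
  intro N hN
  rw [starPoly, coeff_reflect, revAt_eq_self_of_lt hN, coeff_map,
    coeff_eq_zero_of_natDegree_lt (lt_of_le_of_lt hf hN), map_zero]

lemma starPoly_mul {m n : ℕ} {f g : ℂ[X]} (hf : f.natDegree ≤ m) (hg : g.natDegree ≤ n) :
    starPoly (m + n) (f * g) = starPoly m f * starPoly n g := by
  rw [starPoly, Polynomial.map_mul, reflect_mul _ _ (natDegree_map_le.trans hf)
    (natDegree_map_le.trans hg)]
  rfl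

lemma starPoly_starPoly (n : ℕ) (f : ℂ[X]) : starPoly n (starPoly n f) = f := by
  rw [starPoly, starPoly, ← reflect_map, reflect_reflect, Polynomial.map_map]
  convert Polynomial.map_id
  ext x
  simp

lemma starPoly_X_mul {n : ℕ} {f : ℂ[X]} (hf : f.natDegree ≤ n) :
    starPoly (n + 1) (X * f) = starPoly n f := by
  rw [add_comm, starPoly_mul natDegree_X_le hf]
  simp [starPoly]

lemma starPoly_succ {n : ℕ} {f : ℂ[X]} (hf : f.natDegree ≤ n) :
    starPoly (n + 1) f = X * starPoly n f := by
  have := starPoly_mul (m := 1) (n := n) (f := 1) (g := f) (by simp) hf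
  rw [one_mul, add_comm] at this
  rw [this]
  simp [starPoly]

lemma starPoly_C_mul (n : ℕ) (c : ℂ) (f : ℂ[X]) :
    starPoly n (C c * f) = C (starRingEnd ℂ c) * starPoly n f := by
  simp [starPoly, reflect_C_mul]

lemma starPoly_sub (n : ℕ) (f g : ℂ[X]) :
    starPoly n (f - g) = starPoly n f - starPoly n g := by
  simp [starPoly, reflect_sub]

lemma coeff_starPoly {n k : ℕ} (h : k ≤ n) (f : ℂ[X]) :
    (starPoly n f).coeff k = starRingEnd ℂ (f.coeff (n - k)) := by
  rw [starPoly, coeff_reflect, revAt_le h, coeff_map]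

lemma natDegree_phi_le (α : ℕ → ℂ) (n : ℕ) : (phi α n).natDegree ≤ n := by
  induction n with
  | zero => simp [phi]
  | succ n ih =>
    rw [phi]
    refine (natDegree_C_mul_le _ _).trans ((natDegree_sub_le _ _).trans (max_le ?_ ?_))
    · exact natDegree_mul_le.trans (by rw [natDegree_X]; omega)
    · exact (natDegree_C_mul_le _ _).trans ((natDegree_starPoly_le ih).trans (Nat.le_succ n))

lemma starPoly_phi_succ (α : ℕ → ℂ) (n : ℕ) :
    starPoly (n + 1) (phi α (n + 1)) =
      C ((rho α n : ℂ)⁻¹) * (starPoly n (phi α n) - C (α n) * (X * phi α n)) := by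
  have h := natDegree_phi_le α n
  rw [phi, starPoly_C_mul, starPoly_sub, starPoly_X_mul h, starPoly_C_mul,
    starPoly_succ (natDegree_starPoly_le h), starPoly_starPoly, map_inv₀, Complex.conj_ofReal,
    Complex.conj_conj]

lemma transfer_mulVec_one_one (α : ℕ → ℂ) (n : ℕ) (z : ℂ) :
    (transfer α n z).mulVec ![1, 1] =
      ![(phi α n).eval z, (starPoly n (phi α n)).eval z] := by
  induction n with
  | zero => simp [transfer, phi, starPoly]
  | succ n ih =>
    rw [transfer, ← Matrix.mulVec_mulVec, ih, starPoly_phi_succ, phi]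
    ext i
    fin_cases i <;> simp [stepMatrix, Matrix.mulVec, dotProduct, Fin.sum_univ_two] <;> ring

lemma transfer_mulVec_one_neg_one (α : ℕ → ℂ) (n : ℕ) (z : ℂ) :
    (transfer α n z).mulVec ![1, -1] =
      ![(psi α n).eval z, -(starPoly n (psi α n)).eval z] := by
  induction n with
  | zero => simp [transfer, phi, psi, starPoly]
  | succ n ih =>
    simp only [psi] at ih ⊢
    rw [transfer, ← Matrix.mulVec_mulVec, ih, starPoly_phi_succ, phi]
    ext i
    fin_cases i <;>
      simp [stepMatrix, Matrix.mulVec, dotProduct, Fin.sum_univ_two, rho] <;> ring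

lemma det_stepMatrix (hα : ∀ n, ‖α n‖ < 1) (k : ℕ) (z : ℂ) : (stepMatrix α k z).det = z := by
  have h := (rho_pos hα k).ne'
  have h2 : (rho α k : ℂ) ^ 2 = 1 - α k * starRingEnd ℂ (α k) := by
    rw [Complex.mul_conj, Complex.normSq_eq_norm_sq, ← Complex.ofReal_pow, rho_sq hα]
    push_cast
    ring
  have h3 : (rho α k : ℂ) ≠ 0 := by exact_mod_cast h
  rw [Matrix.det_fin_two]
  simp only [stepMatrix, Matrix.smul_apply, Matrix.of_apply, Matrix.cons_val', Matrix.cons_val_zero,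
    Matrix.cons_val_one, smul_eq_mul, Matrix.cons_val_fin_one]
  field_simp
  rw [h2]
  ring

lemma det_transfer (hα : ∀ n, ‖α n‖ < 1) (n : ℕ) (z : ℂ) : (transfer α n z).det = z ^ n := by
  induction n with
  | zero => simp [transfer]
  | succ n ih => rw [transfer, Matrix.det_mul, ih, det_stepMatrix hα, pow_succ']

lemma transfer_add_period {p : ℕ} (hper : ∀ n, α (n + p) = α n) (n : ℕ) (z : ℂ) :
    transfer α (n + p) z = transfer α n z * transfer α p z := by
  induction n with
  | zero => simp [transfer]
  | succ n ih =>
    rw [show n + 1 + p = n + p + 1 by ring, transfer, transfer, ih, Matrix.mul_assoc]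
    congr 1
    simp [stepMatrix, rho, hper]

lemma transfer_mulVec_add_period {p : ℕ} (hα : ∀ n, ‖α n‖ < 1) (hper : ∀ n, α (n + p) = α n)
    (n : ℕ) (z : ℂ) :
    transfer α (n + p + p) z =
      (transfer α p z).trace • transfer α (n + p) z - z ^ p • transfer α n z := by
  rw [transfer_add_period hper (n + p), transfer_add_period hper n, Matrix.mul_assoc]
  have key : transfer α p z * transfer α p z =
      (transfer α p z).trace • transfer α p z - z ^ p • (1 : Matrix (Fin 2) (Fin 2) ℂ) := by
    rw [← det_transfer hα p z, Matrix.det_fin_two, Matrix.trace_fin_two]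
    ext i j
    fin_cases i <;> fin_cases j <;> simp [Matrix.mul_apply, Fin.sum_univ_two] <;> ring
  rw [key, Matrix.mul_sub]
  simp

/-- The discriminant recursion: along an arithmetic progression of step `p` the orthonormal
polynomials obey a two-term recursion whose coefficients do not depend on the index. -/
lemma eval_phi_add_period {p : ℕ} (hα : ∀ n, ‖α n‖ < 1) (hper : ∀ n, α (n + p) = α n)
    (n : ℕ) (z : ℂ) :
    (phi α (n + p + p)).eval z =
      (transfer α p z).trace * (phi α (n + p)).eval z - z ^ p * (phi α n).eval z := by
  have h := congrArg (fun M : Matrix (Fin 2) (Fin 2) ℂ => M.mulVec ![1, 1] 0)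
    (transfer_mulVec_add_period hα hper n z)
  simp only [Matrix.sub_mulVec, Matrix.smul_mulVec, transfer_mulVec_one_one] at h
  simpa using h

/-- The closed form of the discriminant recursion in terms of the eigenvalues `u`, `v` of the
transfer matrix over one period. -/
lemma eigenvalue_expansion {p : ℕ} (hα : ∀ n, ‖α n‖ < 1) (hper : ∀ n, α (n + p) = α n)
    (b : ℕ) {z u v : ℂ} (hs : u + v = (transfer α p z).trace) (hm : u * v = z ^ p) (m : ℕ) :
    (u - v) * (phi α (m * p + b)).eval z =
      u ^ m * ((phi α (b + p)).eval z - v * (phi α b).eval z) -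
        v ^ m * ((phi α (b + p)).eval z - u * (phi α b).eval z) := by
  induction m using Nat.twoStepInduction with
  | zero => simp; ring
  | one => rw [one_mul, add_comm p b]; ring
  | more m h0 h1 =>
    have h := eval_phi_add_period hα hper (m * p + b) z
    rw [show (m + 2) * p + b = m * p + b + p + p by ring, h, ← hs, ← hm]
    rw [show (m + 1) * p + b = m * p + b + p by ring] at h1
    linear_combination (u + v) * h1 - u * v * h0

/-- The leading coefficient `∏_{k<n} ρ_k⁻¹` of `φ_n`. -/
def leadingConst (α : ℕ → ℂ) (n : ℕ) : ℝ := ∏ k ∈ Finset.range n, (rho α k)⁻¹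

lemma leadingConst_pos (hα : ∀ n, ‖α n‖ < 1) (n : ℕ) : 0 < leadingConst α n :=
  Finset.prod_pos fun k _ => inv_pos.2 (rho_pos hα k)

lemma coeff_phi_self (α : ℕ → ℂ) (n : ℕ) :
    (phi α n).coeff n = (leadingConst α n : ℂ) := by
  induction n with
  | zero => simp [phi, leadingConst]
  | succ n ih =>
    have h := coeff_eq_zero_of_natDegree_lt
      (lt_of_le_of_lt (natDegree_starPoly_le (natDegree_phi_le α n)) (Nat.lt_succ_self n))
    rw [phi, coeff_C_mul, coeff_sub, coeff_X_mul, coeff_C_mul, h, ih, leadingConst, leadingConst,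
      Finset.prod_range_succ]
    push_cast
    ring

lemma coeff_phi_succ_zero (α : ℕ → ℂ) (n : ℕ) :
    (phi α (n + 1)).coeff 0 = -(starRingEnd ℂ (α n)) * (leadingConst α (n + 1) : ℂ) := by
  rw [phi, coeff_C_mul, coeff_sub, coeff_C_mul, mul_coeff_zero, coeff_X_zero,
    coeff_starPoly (Nat.zero_le n), Nat.sub_zero, coeff_phi_self, Complex.conj_ofReal,
    leadingConst, leadingConst, Finset.prod_range_succ]
  push_cast
  ring

lemma phi_ne_zero (hα : ∀ n, ‖α n‖ < 1) (n : ℕ) : phi α n ≠ 0 := by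
  intro h
  have := coeff_phi_self α n
  rw [h, coeff_zero] at this
  exact (leadingConst_pos hα n).ne' (by exact_mod_cast this.symm)

/-- The trace of the transfer matrix, as a polynomial. -/
def tracePoly (α : ℕ → ℂ) (n : ℕ) : ℂ[X] :=
  C (1 / 2) * (phi α n + psi α n + (starPoly n (phi α n) + starPoly n (psi α n)))

lemma eval_tracePoly (α : ℕ → ℂ) (n : ℕ) (z : ℂ) :
    (tracePoly α n).eval z = (transfer α n z).trace := by
  have h1 := transfer_mulVec_one_one α n z
  have h2 := transfer_mulVec_one_neg_one α n z
  have a0 := congrFun h1 0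
  have a1 := congrFun h1 1
  have b0 := congrFun h2 0
  have b1 := congrFun h2 1
  simp [Matrix.mulVec, dotProduct, Fin.sum_univ_two] at a0 a1 b0 b1
  rw [Matrix.trace_fin_two, tracePoly]
  simp only [eval_mul, eval_C, eval_add]
  linear_combination (-1 / 2) * (a0 + a1 + b0 - b1)

lemma leadingConst_neg (α : ℕ → ℂ) (n : ℕ) :
    leadingConst (fun k => -α k) n = leadingConst α n := by
  simp [leadingConst, rho]

lemma natDegree_tracePoly_le (α : ℕ → ℂ) (n : ℕ) : (tracePoly α n).natDegree ≤ n := by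
  have h1 := natDegree_phi_le α n
  have h2 : (psi α n).natDegree ≤ n := natDegree_phi_le _ n
  exact (natDegree_C_mul_le _ _).trans (natDegree_add_le_of_degree_le
    (natDegree_add_le_of_degree_le h1 h2)
    (natDegree_add_le_of_degree_le (natDegree_starPoly_le h1) (natDegree_starPoly_le h2)))

lemma coeff_tracePoly_zero (α : ℕ → ℂ) {n : ℕ} (hn : 0 < n) :
    (tracePoly α n).coeff 0 = (leadingConst α n : ℂ) := by
  obtain ⟨k, rfl⟩ := Nat.exists_eq_succ_of_ne_zero hn.ne'
  simp only [tracePoly, coeff_C_mul, coeff_add, coeff_starPoly (Nat.zero_le _), psi, Nat.sub_zero,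
    coeff_phi_self, Nat.succ_eq_add_one, coeff_phi_succ_zero, leadingConst_neg, Complex.conj_ofReal,
    map_neg]
  ring

lemma coeff_tracePoly_self (α : ℕ → ℂ) {n : ℕ} (hn : 0 < n) :
    (tracePoly α n).coeff n = (leadingConst α n : ℂ) := by
  obtain ⟨k, rfl⟩ := Nat.exists_eq_succ_of_ne_zero hn.ne'
  simp only [tracePoly, coeff_C_mul, coeff_add, coeff_starPoly (le_refl _), psi, Nat.sub_self,
    coeff_phi_self, Nat.succ_eq_add_one, coeff_phi_succ_zero, leadingConst_neg, Complex.conj_ofReal,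
    map_neg, map_mul, Complex.conj_conj]
  ring

lemma natDegree_tracePoly (hα : ∀ n, ‖α n‖ < 1) {n : ℕ} (hn : 0 < n) :
    (tracePoly α n).natDegree = n := by
  refine le_antisymm (natDegree_tracePoly_le α n) (le_natDegree_of_ne_zero ?_)
  rw [coeff_tracePoly_self α hn]
  exact_mod_cast (leadingConst_pos hα n).ne'

/-- If the Verblunsky coefficients do not all vanish, the leading coefficient over a period
exceeds `1`. -/
lemma one_lt_leadingConst {p : ℕ} (hp : 0 < p) (hα : ∀ n, ‖α n‖ < 1)
    (hper : ∀ n, α (n + p) = α n) (hne : ∃ n, α n ≠ 0) : 1 < leadingConst α p := by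
  obtain ⟨n, hn⟩ := hne
  have hmod : α (n % p) = α n := by
    have : Function.Periodic α p := hper
    exact this.map_mod_nat n
  have hlt : rho α (n % p) < 1 := by
    have h0 : 0 < ‖α (n % p)‖ := norm_pos_iff.2 (by rwa [hmod])
    rw [rho, Real.sqrt_lt' one_pos]
    nlinarith
  have h1 : ∀ k, 1 ≤ (rho α k)⁻¹ := fun k => (one_le_inv₀ (rho_pos hα k)).2 (rho_le_one k)
  calc (1 : ℝ) = ∏ k ∈ Finset.range p, 1 := by simp
    _ < leadingConst α p := Finset.prod_lt_prod (fun _ _ => one_pos) (fun k _ => h1 k)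
        ⟨n % p, Finset.mem_range.2 (Nat.mod_lt _ hp),
          (one_lt_inv₀ (rho_pos hα _)).2 hlt⟩

/-! ### The indefinite form and the eigenvalues of the transfer matrix -/

/-- The indefinite Hermitian form of signature `(1, 1)` preserved by the transfer matrices on the
unit circle. -/
def form (u : Fin 2 → ℂ) : ℝ := ‖u 0‖ ^ 2 - ‖u 1‖ ^ 2

lemma norm_sq_sub_norm_sq_mobius (a w v : ℂ) :
    ‖w - starRingEnd ℂ a * v‖ ^ 2 - ‖v - a * w‖ ^ 2 =
      (1 - ‖a‖ ^ 2) * (‖w‖ ^ 2 - ‖v‖ ^ 2) := by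
  simp only [Complex.sq_norm, Complex.normSq_apply, Complex.sub_re, Complex.sub_im, Complex.mul_re,
    Complex.mul_im, Complex.conj_re, Complex.conj_im]
  ring

lemma form_stepMatrix (hα : ∀ n, ‖α n‖ < 1) (k : ℕ) (z : ℂ) (u : Fin 2 → ℂ) :
    form ((stepMatrix α k z).mulVec u) = ‖z‖ ^ 2 * ‖u 0‖ ^ 2 - ‖u 1‖ ^ 2 := by
  have h0 : (stepMatrix α k z).mulVec u 0 =
      (rho α k : ℂ)⁻¹ * (z * u 0 - starRingEnd ℂ (α k) * u 1) := by
    simp [stepMatrix, Matrix.mulVec, dotProduct, Fin.sum_univ_two]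
    ring
  have h1 : (stepMatrix α k z).mulVec u 1 =
      (rho α k : ℂ)⁻¹ * (u 1 - α k * (z * u 0)) := by
    simp [stepMatrix, Matrix.mulVec, dotProduct, Fin.sum_univ_two]
    ring
  have hr := (rho_pos hα k)
  have hr2 := rho_sq hα k
  have key := norm_sq_sub_norm_sq_mobius (α k) (z * u 0) (u 1)
  rw [← hr2, norm_mul] at key
  rw [form, h0, h1, norm_mul, norm_mul, norm_inv, Complex.norm_real, Real.norm_of_nonneg hr.le,
    mul_pow, mul_pow, ← mul_sub, key]
  field_simp

lemma form_transfer_le (hα : ∀ n, ‖α n‖ < 1) {z : ℂ} (hz : ‖z‖ ≤ 1) (n : ℕ) (u : Fin 2 → ℂ) :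
    form ((transfer α (n + 1) z).mulVec u) ≤
      ‖z‖ ^ (n + 1) * (form u - (1 - ‖z‖) * (‖u 0‖ ^ 2 + ‖u 1‖ ^ 2)) := by
  have hz0 := norm_nonneg z
  induction n with
  | zero =>
    rw [transfer, transfer, mul_one, form_stepMatrix hα, form, zero_add, pow_one]
    nlinarith [mul_nonneg (sq_nonneg (1 - ‖z‖)) (sq_nonneg ‖u 1‖), sq_nonneg ‖u 0‖]
  | succ n ih =>
    rw [transfer, ← Matrix.mulVec_mulVec, form_stepMatrix hα]
    set w := (transfer α (n + 1) z).mulVec u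
    have h1 : ‖z‖ ^ 2 * ‖w 0‖ ^ 2 - ‖w 1‖ ^ 2 ≤ ‖z‖ * form w := by
      have : 0 ≤ (1 - ‖z‖) * (‖z‖ * ‖w 0‖ ^ 2 + ‖w 1‖ ^ 2) :=
        mul_nonneg (by linarith) (by positivity)
      rw [form]
      linarith
    have h2 := mul_le_mul_of_nonneg_left ih hz0
    calc _ ≤ _ := h1
      _ ≤ _ := h2
      _ = _ := by ring

lemma le_form_transfer (hα : ∀ n, ‖α n‖ < 1) {z : ℂ} (hz : 1 ≤ ‖z‖) (n : ℕ) (u : Fin 2 → ℂ) :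
    ‖z‖ ^ (n + 1) * form u + (‖z‖ - 1) * (‖u 0‖ ^ 2 + ‖u 1‖ ^ 2) ≤
      form ((transfer α (n + 1) z).mulVec u) := by
  have hz0 : 0 ≤ ‖z‖ - 1 := by linarith
  induction n with
  | zero =>
    rw [transfer, transfer, mul_one, form_stepMatrix hα, form, zero_add, pow_one]
    nlinarith [mul_nonneg (sq_nonneg (‖z‖ - 1)) (sq_nonneg ‖u 0‖)]
  | succ n ih =>
    rw [transfer, ← Matrix.mulVec_mulVec, form_stepMatrix hα]
    set w := (transfer α (n + 1) z).mulVec u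
    have h1 : ‖z‖ * form w ≤ ‖z‖ ^ 2 * ‖w 0‖ ^ 2 - ‖w 1‖ ^ 2 := by
      have : 0 ≤ (‖z‖ - 1) * (‖z‖ * ‖w 0‖ ^ 2 + ‖w 1‖ ^ 2) :=
        mul_nonneg hz0 (by positivity)
      rw [form]
      linarith
    have h2 := mul_le_mul_of_nonneg_left ih (by linarith : 0 ≤ ‖z‖)
    have h3 : 0 ≤ (‖z‖ - 1) * ((‖z‖ - 1) * (‖u 0‖ ^ 2 + ‖u 1‖ ^ 2)) := by positivity
    calc _ ≤ ‖z‖ * (‖z‖ ^ (n + 1) * form u + (‖z‖ - 1) * (‖u 0‖ ^ 2 + ‖u 1‖ ^ 2)) := by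
          rw [pow_succ _ (n + 1)]; linarith
      _ ≤ _ := h2
      _ ≤ _ := h1

/-- The zeros of `φ_n` lie in the open unit disk. -/
lemma eval_phi_ne_zero (hα : ∀ n, ‖α n‖ < 1) {z : ℂ} (hz : 1 ≤ ‖z‖) (n : ℕ) :
    (phi α n).eval z ≠ 0 := by
  rcases n with _ | n
  · simp [phi]
  intro h
  have h1 := le_form_transfer hα hz n ![1, 1]
  have hdet : IsUnit (transfer α (n + 1) z).det := by
    rw [det_transfer hα]
    have hz0 : z ≠ 0 := norm_pos_iff.1 (by linarith)
    exact (pow_ne_zero _ hz0).isUnit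
  have hv := transfer_mulVec_one_one α (n + 1) z
  rw [hv, h] at h1
  simp [form] at h1
  have h2 : (starPoly (n + 1) (phi α (n + 1))).eval z = 0 := by
    rw [← norm_eq_zero]
    nlinarith [norm_nonneg ((starPoly (n + 1) (phi α (n + 1))).eval z)]
  rw [h, h2] at hv
  have h3 := (Matrix.mulVec_injective_iff_isUnit.2
    ((Matrix.isUnit_iff_isUnit_det _).2 hdet)) (a₁ := ![1, 1]) (a₂ := 0)
    (by rw [hv, Matrix.mulVec_zero]; ext i; fin_cases i <;> simp)
  simpa using congrFun h3 0

lemma exists_eigenvector {M : Matrix (Fin 2) (Fin 2) ℂ} {u v : ℂ} (hs : u + v = M.trace)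
    (hm : u * v = M.det) : ∃ x : Fin 2 → ℂ, x ≠ 0 ∧ M.mulVec x = u • x := by
  have h : (M - u • (1 : Matrix (Fin 2) (Fin 2) ℂ)).det = 0 := by
    rw [Matrix.trace_fin_two] at hs
    rw [Matrix.det_fin_two] at hm ⊢
    simp
    linear_combination -hm + u * hs
  obtain ⟨x, hx, h0⟩ := Matrix.exists_mulVec_eq_zero_iff.2 h
  refine ⟨x, hx, ?_⟩
  rw [Matrix.sub_mulVec, Matrix.smul_mulVec, Matrix.one_mulVec, sub_eq_zero] at h0
  exact h0

lemma norm_sq_add_norm_sq_pos {x : Fin 2 → ℂ} (hx : x ≠ 0) : 0 < ‖x 0‖ ^ 2 + ‖x 1‖ ^ 2 := by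
  by_contra! h
  apply hx
  have h0 : ‖x 0‖ = 0 := by nlinarith [sq_nonneg ‖x 0‖, sq_nonneg ‖x 1‖]
  have h1 : ‖x 1‖ = 0 := by nlinarith [sq_nonneg ‖x 0‖, sq_nonneg ‖x 1‖]
  ext i
  fin_cases i
  · simpa using h0
  · simpa using h1

lemma form_smul (c : ℂ) (x : Fin 2 → ℂ) : form (c • x) = ‖c‖ ^ 2 * form x := by
  simp [form, mul_pow, mul_sub]

/-- Inside the disk the eigenvalues of the transfer matrix stay away from the circle
`|λ| = |z|^{p/2}`. -/
lemma eigenvalue_gap_abs {p : ℕ} (hp : 0 < p) (hα : ∀ n, ‖α n‖ < 1) {z u v : ℂ} (hz : ‖z‖ ≤ 1)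
    (hs : u + v = (transfer α p z).trace) (hm : u * v = z ^ p) :
    ‖z‖ ^ p * (1 - ‖z‖) ≤ |‖u‖ ^ 2 - ‖z‖ ^ p| := by
  obtain ⟨x, hx, he⟩ := exists_eigenvector hs (hm.trans (det_transfer hα p z).symm)
  obtain ⟨k, rfl⟩ := Nat.exists_eq_succ_of_ne_zero hp.ne'
  have h := form_transfer_le hα hz k x
  rw [show k + 1 = k.succ from rfl, he, form_smul] at h
  have hN := norm_sq_add_norm_sq_pos hx
  set N := ‖x 0‖ ^ 2 + ‖x 1‖ ^ 2
  have hF : |form x| ≤ N := by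
    rw [abs_le]
    constructor <;> simp only [form, N] <;> nlinarith [sq_nonneg ‖x 0‖, sq_nonneg ‖x 1‖]
  have h2 : (‖z‖ ^ k.succ * (1 - ‖z‖)) * N ≤ |‖u‖ ^ 2 - ‖z‖ ^ k.succ| * N := by
    calc _ ≤ -((‖u‖ ^ 2 - ‖z‖ ^ k.succ) * form x) := by linarith
      _ ≤ |(‖u‖ ^ 2 - ‖z‖ ^ k.succ) * form x| := neg_le_abs _
      _ = |‖u‖ ^ 2 - ‖z‖ ^ k.succ| * |form x| := abs_mul _ _
      _ ≤ _ := by gcongr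
  exact le_of_mul_le_mul_right h2 hN

lemma eigenvalue_norm_ne_of_one_lt {p : ℕ} (hp : 0 < p) (hα : ∀ n, ‖α n‖ < 1) {z u v : ℂ}
    (hz : 1 < ‖z‖) (hs : u + v = (transfer α p z).trace) (hm : u * v = z ^ p) :
    ‖u‖ ^ 2 ≠ ‖z‖ ^ p := by
  intro hu
  obtain ⟨x, hx, he⟩ := exists_eigenvector hs (hm.trans (det_transfer hα p z).symm)
  obtain ⟨k, rfl⟩ := Nat.exists_eq_succ_of_ne_zero hp.ne'
  have h := le_form_transfer hα hz.le k x
  rw [show k + 1 = k.succ from rfl, he, form_smul, hu] at h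
  have := mul_pos (sub_pos.2 hz) (norm_sq_add_norm_sq_pos hx)
  linarith

/-- The larger eigenvalue. -/
lemma le_norm_sq_eigenvalue {p : ℕ} (hp : 0 < p) (hα : ∀ n, ‖α n‖ < 1) {z u v : ℂ} (hz : ‖z‖ ≤ 1)
    (hs : u + v = (transfer α p z).trace) (hm : u * v = z ^ p) (hle : ‖v‖ ≤ ‖u‖) :
    ‖z‖ ^ p * (2 - ‖z‖) ≤ ‖u‖ ^ 2 := by
  have h := eigenvalue_gap_abs hp hα hz hs hm
  have h1 : ‖z‖ ^ p ≤ ‖u‖ ^ 2 := by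
    rw [← norm_pow, ← hm, norm_mul, pow_two]
    gcongr
  rw [abs_of_nonneg (by linarith)] at h
  linarith

/-- The two eigenvalues of the transfer matrix separate at least linearly in the distance to the
unit circle. -/
lemma eigenvalue_ratio {p : ℕ} (hp : 0 < p) (hα : ∀ n, ‖α n‖ < 1) {z u v : ℂ} (hz0 : z ≠ 0)
    (hz : ‖z‖ ≤ 1) (hs : u + v = (transfer α p z).trace) (hm : u * v = z ^ p)
    (hle : ‖v‖ ≤ ‖u‖) : (1 + (1 - ‖z‖)) * ‖v‖ ≤ ‖u‖ := by
  have h := le_norm_sq_eigenvalue hp hα hz hs hm hle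
  have hu : u ≠ 0 := by
    rintro rfl
    rw [zero_mul] at hm
    exact pow_ne_zero _ hz0 hm.symm
  have hu0 := norm_pos_iff.2 hu
  rw [← norm_pow, ← hm, norm_mul] at h
  refine le_of_mul_le_mul_left ?_ hu0
  nlinarith

lemma discrRoot_sq (α : ℕ → ℂ) (p : ℕ) (z : ℂ) :
    discrRoot α p z ^ 2 = ((transfer α p z).trace / 2) ^ 2 - (transfer α p z).det := by
  have := Complex.cpow_nat_inv_pow (((transfer α p z).trace / 2) ^ 2 - (transfer α p z).det)
    (n := 2) two_ne_zero
  rw [discrRoot, one_div]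
  exact_mod_cast this

lemma eigPlus_add_eigMinus (α : ℕ → ℂ) (p : ℕ) (z : ℂ) :
    eigPlus α p z + eigMinus α p z = (transfer α p z).trace := by
  rw [eigMinus]; ring

lemma eigPlus_mul_eigMinus (hα : ∀ n, ‖α n‖ < 1) (p : ℕ) (z : ℂ) :
    eigPlus α p z * eigMinus α p z = z ^ p := by
  have h := discrRoot_sq α p z
  rw [det_transfer hα] at h
  rw [eigMinus, eigPlus]
  split_ifs <;> linear_combination -h

lemma norm_eigMinus_le (α : ℕ → ℂ) (p : ℕ) (z : ℂ) : ‖eigMinus α p z‖ ≤ ‖eigPlus α p z‖ := by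
  rw [eigMinus, eigPlus]
  split_ifs with h
  · rwa [show ∀ t d : ℂ, t - (t / 2 + d) = t / 2 - d by intros; ring]
  · rw [show ∀ t d : ℂ, t - (t / 2 - d) = t / 2 + d by intros; ring]
    exact (not_le.1 h).le

lemma eigPlus_ne_eigMinus {p : ℕ} (hp : 0 < p) (hα : ∀ n, ‖α n‖ < 1) {z : ℂ} (hz0 : z ≠ 0)
    (hz : ‖z‖ < 1) : eigPlus α p z - eigMinus α p z ≠ 0 := by
  intro h
  have h1 := eigenvalue_ratio hp hα hz0 hz.le (eigPlus_add_eigMinus α p z)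
    (eigPlus_mul_eigMinus hα p z) (norm_eigMinus_le α p z)
  rw [sub_eq_zero] at h
  have h2 := eigPlus_mul_eigMinus hα p z
  rw [← h] at h1 h2
  have h3 : eigPlus α p z ≠ 0 := by
    intro h0
    rw [h0, zero_mul] at h2
    exact pow_ne_zero _ hz0 h2.symm
  have := mul_pos (sub_pos.2 hz) (norm_pos_iff.2 h3)
  linarith

/-- The function `j_b` as a combination of two orthonormal polynomials. -/
lemma jost_eq {p : ℕ} (hper : ∀ n, α (n + p) = α n) (b : ℕ) (z : ℂ) :
    jost α p b z = (eigPlus α p z - eigMinus α p z)⁻¹ *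
      ((phi α (b + p)).eval z - eigMinus α p z * (phi α b).eval z) := by
  have hb := transfer_mulVec_one_one α b z
  have hb' := transfer_mulVec_one_neg_one α b z
  have hbp := transfer_mulVec_one_one α (b + p) z
  rw [transfer_add_period hper] at hbp
  have a0 := congrFun hb 0
  have b0 := congrFun hb' 0
  have c0 := congrFun hbp 0
  simp [Matrix.mulVec, dotProduct, Fin.sum_univ_two, Matrix.mul_apply] at a0 b0 c0
  rw [jost, ← a0, ← b0, ← c0, coefA, coefB, projPlus]
  simp [Matrix.mulVec, dotProduct, Fin.sum_univ_two]
  ring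

/-! ### The product of the two Jost functions -/

/-- The product of the numerators of the two Jost functions `φ_{b+p} - λ_∓ φ_b`, where `λ_±` are
the eigenvalues of the transfer matrix. It is a polynomial. -/
def jostPoly (α : ℕ → ℂ) (p b : ℕ) : ℂ[X] :=
  phi α (b + p) ^ 2 - tracePoly α p * phi α (b + p) * phi α b + X ^ p * phi α b ^ 2

/-- The discriminant of the characteristic polynomial of the transfer matrix. -/
def discPoly (α : ℕ → ℂ) (p : ℕ) : ℂ[X] := tracePoly α p ^ 2 - C 4 * X ^ p

lemma eval_jostPoly {p : ℕ} (b : ℕ) {z u v : ℂ}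
    (hs : u + v = (transfer α p z).trace) (hm : u * v = z ^ p) :
    (jostPoly α p b).eval z = ((phi α (b + p)).eval z - v * (phi α b).eval z) *
      ((phi α (b + p)).eval z - u * (phi α b).eval z) := by
  simp only [jostPoly, eval_add, eval_sub, eval_mul, eval_pow, eval_X, eval_tracePoly]
  rw [← hs, ← hm]
  ring

lemma eval_discPoly {p : ℕ} {z u v : ℂ}
    (hs : u + v = (transfer α p z).trace) (hm : u * v = z ^ p) :
    (discPoly α p).eval z = (u - v) ^ 2 := by
  simp only [discPoly, eval_sub, eval_mul, eval_pow, eval_X, eval_tracePoly, eval_C]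
  rw [← hs, ← hm]
  ring

lemma discPoly_ne_zero {p : ℕ} (hp : 0 < p) (hα : ∀ n, ‖α n‖ < 1) : discPoly α p ≠ 0 := by
  intro h
  have h1 := congrArg (fun f : ℂ[X] => f.coeff 0) h
  simp only [discPoly, coeff_sub, coeff_X_pow, hp.ne, if_false, pow_two,
    mul_coeff_zero, coeff_tracePoly_zero α hp, coeff_zero, mul_zero, sub_zero] at h1
  have := (leadingConst_pos hα p).ne'
  simp [this] at h1

/-- A root of the characteristic polynomial that is a polynomial in `z` would divide `z^p`, hence be
a monomial, which contradicts the values of the lowest and highest coefficient of the trace. -/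
lemma no_polynomial_eigenvalue {p : ℕ} (hp : 0 < p) (hα : ∀ n, ‖α n‖ < 1)
    (hper : ∀ n, α (n + p) = α n) (hne : ∃ n, α n ≠ 0) (l : ℂ[X]) :
    l * (tracePoly α p - l) ≠ X ^ p := by
  intro h
  obtain ⟨i, hi, u, hu⟩ := (dvd_prime_pow prime_X p).1 (Dvd.intro _ h)
  obtain ⟨c, hc, hcu⟩ := Polynomial.isUnit_iff.1 u⁻¹.isUnit
  have hl : l = C c * X ^ i := by
    rw [← hu, hcu, mul_comm, mul_assoc, Units.mul_inv, mul_one]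
  have hc0 : c ≠ 0 := hc.ne_zero
  have ht : tracePoly α p - l = C c⁻¹ * X ^ (p - i) := by
    have h0 : l ≠ 0 := by rw [hl]; exact mul_ne_zero (C_ne_zero.2 hc0) (pow_ne_zero _ X_ne_zero)
    apply mul_left_cancel₀ h0
    rw [h, hl]
    calc (X : ℂ[X]) ^ p = C (c * c⁻¹) * (X ^ i * X ^ (p - i)) := by
          rw [mul_inv_cancel₀ hc0, C_1, one_mul, ← pow_add, Nat.add_sub_cancel' hi]
      _ = _ := by rw [C_mul]; ring
  have ht' : tracePoly α p = C c * X ^ i + C c⁻¹ * X ^ (p - i) := by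
    rw [← ht, hl]; ring
  have e0 := coeff_tracePoly_zero α hp
  have e1 := coeff_tracePoly_self α hp
  have hk := one_lt_leadingConst hp hα hper hne
  have hk' : (leadingConst α p : ℂ) ^ 2 ≠ 1 := by
    norm_cast
    nlinarith
  have hk0 : (leadingConst α p : ℂ) ≠ 0 := by
    norm_cast
    linarith
  rw [ht'] at e0 e1
  simp only [coeff_add, coeff_C_mul, coeff_X_pow] at e0 e1
  rcases Nat.eq_zero_or_pos i with rfl | hi0
  · simp [hp.ne, hp.ne'] at e0 e1
    rw [← e0] at e1
    apply hk'
    rw [← e0, pow_two]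
    nth_rewrite 1 [← e1]
    exact inv_mul_cancel₀ hc0
  · rcases hi.eq_or_lt with rfl | hip
    · simp [hp.ne, hp.ne'] at e0 e1
      rw [← e1] at e0
      apply hk'
      rw [← e1, pow_two]
      nth_rewrite 1 [← e0]
      exact inv_mul_cancel₀ hc0
    · have h1 : (0 : ℕ) ≠ i := hi0.ne
      have h2 : (0 : ℕ) ≠ p - i := by omega
      simp [h1, h2] at e0
      exact hk0 (by exact_mod_cast e0.symm)

lemma jostPoly_ne_zero {p : ℕ} (hp : 0 < p) (hα : ∀ n, ‖α n‖ < 1)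
    (hper : ∀ n, α (n + p) = α n) (hne : ∃ n, α n ≠ 0) (b : ℕ) : jostPoly α p b ≠ 0 := by
  intro h
  rw [jostPoly] at h
  have hx0 : phi α b ≠ 0 := phi_ne_zero hα b
  set x0 := phi α b
  set x1 := phi α (b + p)
  have hdvd : x0 ∣ x1 := by
    obtain ⟨y0, hy0⟩ := EuclideanDomain.gcd_dvd_left x0 x1
    obtain ⟨y1, hy1⟩ := EuclideanDomain.gcd_dvd_right x0 x1
    have hg := EuclideanDomain.gcd_eq_gcd_ab x0 x1
    set g := EuclideanDomain.gcd x0 x1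
    set a := EuclideanDomain.gcdA x0 x1
    set c := EuclideanDomain.gcdB x0 x1
    have hg0 : g ≠ 0 := fun h0 => hx0 (by rw [hy0, h0, zero_mul])
    have hcop : IsCoprime y0 y1 := by
      refine ⟨a, c, ?_⟩
      apply mul_left_cancel₀ hg0
      calc g * (a * y0 + c * y1) = (g * y0) * a + (g * y1) * c := by ring
        _ = x0 * a + x1 * c := by rw [← hy0, ← hy1]
        _ = g * 1 := by rw [← hg, mul_one]
    have hd : y0 ∣ y1 ^ 2 := by
      refine ⟨tracePoly α p * y1 - X ^ p * y0, ?_⟩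
      apply mul_left_cancel₀ (pow_ne_zero 2 hg0)
      rw [hy0, hy1] at h
      linear_combination h
    have hu : IsUnit y0 := (hcop.pow_right (n := 2)).isUnit_of_dvd' dvd_rfl hd
    rw [hy0, hy1]
    exact mul_dvd_mul_left g (hu.dvd)
  obtain ⟨l, hl⟩ := hdvd
  apply no_polynomial_eigenvalue hp hα hper hne l
  apply mul_left_cancel₀ (pow_ne_zero 2 hx0)
  rw [hl] at h
  linear_combination -h

/-! ### Distance of the zeros to the unit circle -/

lemma zero_bound {p : ℕ} (hp : 0 < p) (hα : ∀ n, ‖α n‖ < 1) (hper : ∀ n, α (n + p) = α n)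
    {m b : ℕ} {z u v : ℂ} (hz0 : z ≠ 0) (hz : ‖z‖ ≤ 1) (hs : u + v = (transfer α p z).trace)
    (hm : u * v = z ^ p) (hle : ‖v‖ ≤ ‖u‖) (hzero : (phi α (m * p + b)).eval z = 0) :
    (1 + (1 - ‖z‖)) ^ m * ‖(phi α (b + p)).eval z - v * (phi α b).eval z‖ ≤
      ‖(phi α (b + p)).eval z - u * (phi α b).eval z‖ := by
  have h := eigenvalue_expansion hα hper b hs hm m
  rw [hzero, mul_zero, eq_comm, sub_eq_zero] at h
  have h1 := congrArg norm h
  rw [norm_mul, norm_mul, norm_pow, norm_pow] at h1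
  have hr := eigenvalue_ratio hp hα hz0 hz hs hm hle
  have hv : v ≠ 0 := by
    rintro rfl
    rw [mul_zero] at hm
    exact pow_ne_zero _ hz0 hm.symm
  have hv0 : 0 < ‖v‖ ^ m := pow_pos (norm_pos_iff.2 hv) m
  refine le_of_mul_le_mul_left ?_ hv0
  rw [← h1, ← mul_assoc, ← mul_pow]
  have : 0 ≤ ‖v‖ * (1 + (1 - ‖z‖)) := mul_nonneg (norm_nonneg _) (by linarith)
  gcongr
  linarith

lemma exists_bound_eval (f : ℂ[X]) : ∃ C : ℝ, 0 < C ∧ ∀ z : ℂ, ‖z‖ ≤ 1 → ‖f.eval z‖ ≤ C := by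
  obtain ⟨C, hC⟩ := (isCompact_closedBall (0 : ℂ) 1).exists_bound_of_continuousOn
    (f := fun z => f.eval z) f.continuous.continuousOn
  refine ⟨max C 1, by positivity, fun z hz => (hC z ?_).trans (le_max_left _ _)⟩
  simpa using hz

lemma norm_eigenvalue_le {p : ℕ} {z u v : ℂ} (hz : ‖z‖ ≤ 1)
    (hs : u + v = (transfer α p z).trace) (hm : u * v = z ^ p) (hle : ‖v‖ ≤ ‖u‖) :
    ‖u‖ ≤ ‖(tracePoly α p).eval z‖ + 1 := by
  have hv : ‖v‖ ≤ 1 := by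
    have h1 : ‖u‖ * ‖v‖ ≤ 1 := by
      rw [← norm_mul, hm, norm_pow]
      exact pow_le_one₀ (norm_nonneg _) hz
    nlinarith [norm_nonneg u, norm_nonneg v]
  have : u = (tracePoly α p).eval z - v := by rw [eval_tracePoly, ← hs]; ring
  calc ‖u‖ = ‖(tracePoly α p).eval z - v‖ := by rw [← this]
    _ ≤ _ := (norm_sub_le _ _).trans (by linarith)

/-- A nonzero polynomial vanishes at most to finite order at the unit circle. -/
lemma exists_pow_le_norm_eval {f : ℂ[X]} (hf : f ≠ 0) :
    ∃ c : ℝ, 0 < c ∧ ∃ k : ℕ, ∃ δ : ℝ, 0 < δ ∧ ∀ z : ℂ, ‖z‖ < 1 → 1 - ‖z‖ ≤ δ →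
      c * (1 - ‖z‖) ^ k ≤ ‖f.eval z‖ := by
  have key : ∀ s : Multiset ℂ, ∃ δ : ℝ, 0 < δ ∧ ∀ z : ℂ, ‖z‖ < 1 → 1 - ‖z‖ ≤ δ →
      (1 - ‖z‖) ^ (Multiset.card s) ≤ ‖(s.map fun r => z - r).prod‖ := by
    intro s
    induction s using Multiset.induction_on with
    | empty => exact ⟨1, one_pos, by simp⟩
    | cons r s ih =>
      obtain ⟨δ, hδ, h⟩ := ih
      have hstep : ∃ ε : ℝ, 0 < ε ∧ ∀ z : ℂ, ‖z‖ < 1 → 1 - ‖z‖ ≤ ε → 1 - ‖z‖ ≤ ‖z - r‖ := by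
        by_cases hr : ‖r‖ < 1
        · refine ⟨(1 - ‖r‖) / 2, by linarith, fun z _ hz2 => ?_⟩
          have := norm_sub_norm_le z r
          linarith
        · refine ⟨1, one_pos, fun z _ _ => ?_⟩
          have := norm_sub_norm_le r z
          rw [norm_sub_rev] at this
          linarith
      obtain ⟨ε, hε, h'⟩ := hstep
      refine ⟨min δ ε, lt_min hδ hε, fun z hz1 hz2 => ?_⟩
      rw [Multiset.card_cons, Multiset.map_cons, Multiset.prod_cons, norm_mul, pow_succ']
      exact mul_le_mul (h' z hz1 (hz2.trans (min_le_right _ _)))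
        (h z hz1 (hz2.trans (min_le_left _ _))) (pow_nonneg (by linarith) _) (norm_nonneg _)
  obtain ⟨δ, hδ, h⟩ := key f.roots
  refine ⟨‖f.leadingCoeff‖, norm_pos_iff.2 (leadingCoeff_ne_zero.2 hf), Multiset.card f.roots, δ, hδ,
    fun z hz1 hz2 => ?_⟩
  have hfac := (IsAlgClosed.splits f).eval_eq_prod_roots z
  rw [hfac, norm_mul]
  exact mul_le_mul_of_nonneg_left (h z hz1 hz2) (norm_nonneg _)

lemma exists_rpow_neg_half_lt {ε : ℝ} (hε : 0 < ε) :
    ∃ N : ℕ, ∀ n : ℕ, N ≤ n → (n : ℝ) ^ (-(1 / 2) : ℝ) < ε := by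
  have h := (tendsto_rpow_neg_atTop (by norm_num : (0 : ℝ) < 1 / 2)).comp
    tendsto_natCast_atTop_atTop
  exact eventually_atTop.1 (h.eventually_lt_const hε)

lemma exp_half_le_one_add {d : ℝ} (h0 : 0 ≤ d) (h1 : d ≤ 1) : Real.exp (d / 2) ≤ 1 + d := by
  have h := Real.add_one_le_exp (-(d / 2))
  rw [Real.exp_neg] at h
  have hpos : 0 < 1 - d / 2 := by linarith
  calc Real.exp (d / 2) ≤ (1 - d / 2)⁻¹ := by
        rw [le_inv_comm₀ (Real.exp_pos _) hpos]; linarith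
    _ ≤ 1 + d := by
        rw [inv_le_iff_one_le_mul₀ hpos]
        nlinarith

/-- The bound `O(log n / n)` for the indices `n` in one residue class modulo the period. -/
lemma log_bound_of_residue {p : ℕ} (hp : 0 < p) (hα : ∀ n, ‖α n‖ < 1)
    (hper : ∀ n, α (n + p) = α n) (hne : ∃ n, α n ≠ 0) (b : ℕ) (hb : b < p) :
    ∃ K : ℝ, ∃ n₀ : ℕ, ∀ m : ℕ, n₀ ≤ m * p + b → ∀ z : ℂ, (phi α (m * p + b)).eval z = 0 →
      1 - ‖z‖ ≤ ((m * p + b : ℕ) : ℝ) ^ (-(1 / 2) : ℝ) →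
      1 - ‖z‖ ≤ K * (Real.log ((m * p + b : ℕ) : ℝ) / ((m * p + b : ℕ) : ℝ)) := by
  obtain ⟨c, hc, k, δ, hδ, hQ⟩ := exists_pow_le_norm_eval (jostPoly_ne_zero hp hα hper hne b)
  obtain ⟨C₁, hC₁, hx1⟩ := exists_bound_eval (phi α (b + p))
  obtain ⟨C₀, hC₀, hx0⟩ := exists_bound_eval (phi α b)
  obtain ⟨C₂, hC₂, hτ⟩ := exists_bound_eval (tracePoly α p)
  set C := C₁ + (C₂ + 1) * C₀ with hC
  obtain ⟨N₁, hN₁⟩ := exists_rpow_neg_half_lt (lt_min hδ (by norm_num : (0 : ℝ) < 1 / 2))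
  obtain ⟨N₂, hN₂⟩ := exists_nat_gt (C ^ 2 / c)
  refine ⟨4 * p * (k + 1), N₁ + N₂ + 2 * p + 3, fun m hm z hzero hd => ?_⟩
  set n := m * p + b with hn
  have hn3 : (3 : ℝ) ≤ n := by exact_mod_cast (show 3 ≤ n by omega)
  have hn2 : (2 * p : ℝ) ≤ n := by exact_mod_cast (show 2 * p ≤ n by omega)
  have hnC : C ^ 2 / c < n := hN₂.trans (by exact_mod_cast (show N₂ < n by omega))
  have hd' := hd.trans (hN₁ n (by omega)).le
  by_contra! hcon
  have hz1 : ‖z‖ < 1 := by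
    by_contra! h
    exact eval_phi_ne_zero hα h _ hzero
  set d := 1 - ‖z‖ with hdd
  have hd2 : d ≤ 1 / 2 := hd'.trans (min_le_right _ _)
  have hz0 : z ≠ 0 := by
    rintro rfl
    rw [norm_zero] at hdd
    linarith
  have hlog : 1 ≤ Real.log n := by
    rw [Real.le_log_iff_exp_le (by linarith)]
    exact (Real.exp_one_lt_d9.le.trans (by norm_num)).trans hn3
  have hp1 : (1 : ℝ) ≤ p := by exact_mod_cast hp
  have hnpos : (0 : ℝ) < n := by linarith
  have hk0 : (0 : ℝ) ≤ k := Nat.cast_nonneg k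
  have hdn : 1 / (n : ℝ) ≤ d := by
    refine le_trans ?_ hcon.le
    rw [← mul_div_assoc]
    gcongr
    have : 1 ≤ 4 * (p : ℝ) * (k + 1) := by nlinarith
    nlinarith
  have hd0 : 0 < d := lt_of_lt_of_le (by positivity) hdn
  set u := eigPlus α p z
  set v := eigMinus α p z
  have hs := eigPlus_add_eigMinus α p z
  have hmul := eigPlus_mul_eigMinus hα p z
  have hle := norm_eigMinus_le α p z
  have h1 := zero_bound hp hα hper hz0 hz1.le hs hmul hle hzero
  have h2 := hQ z hz1 (hd'.trans (min_le_left _ _))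
  rw [eval_jostPoly b hs hmul, norm_mul] at h2
  have h3 : ‖(phi α (b + p)).eval z - u * (phi α b).eval z‖ ≤ C := by
    refine (norm_sub_le _ _).trans ?_
    rw [norm_mul, hC]
    have h4 := norm_eigenvalue_le hz1.le hs hmul hle
    have h5 := hτ z hz1.le
    have h6 := hx1 z hz1.le
    have h7 := hx0 z hz1.le
    have : ‖u‖ ≤ C₂ + 1 := by linarith
    gcongr
  have hC0 : 0 < C := by positivity
  set A := ‖(phi α (b + p)).eval z - v * (phi α b).eval z‖
  set B := ‖(phi α (b + p)).eval z - u * (phi α b).eval z‖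
  have hB0 : 0 ≤ B := norm_nonneg _
  have h4 : (1 + d) ^ m * (c * d ^ k) ≤ C ^ 2 := by
    calc (1 + d) ^ m * (c * d ^ k) ≤ (1 + d) ^ m * (A * B) := by gcongr
      _ = ((1 + d) ^ m * A) * B := by ring
      _ ≤ B * B := by gcongr
      _ ≤ C * C := by gcongr
      _ = C ^ 2 := by ring
  -- since `m ≥ n / (2p)`, the growth factor is at least `n ^ (k + 1)`
  have hmn : (n : ℝ) / (2 * p) ≤ m := by
    rw [div_le_iff₀ (by positivity)]
    have h5 : (n : ℝ) < m * p + p := by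
      have : n < m * p + p := by omega
      exact_mod_cast this
    linarith
  have h5 : (n : ℝ) ^ (k + 1) ≤ (1 + d) ^ m := by
    calc (n : ℝ) ^ (k + 1) = Real.exp ((k + 1 : ℕ) * Real.log n) := by
          rw [Real.exp_nat_mul, Real.exp_log hnpos]
      _ ≤ Real.exp (m * (d / 2)) := by
          apply Real.exp_le_exp.2
          have h6 : (n : ℝ) / (2 * p) * (4 * p * (k + 1) * (Real.log n / n) / 2) ≤ m * (d / 2) := by
            gcongr
          refine le_trans (le_of_eq ?_) h6
          field_simp
          push_cast
          ring
      _ = Real.exp (d / 2) ^ m := Real.exp_nat_mul _ _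
      _ ≤ (1 + d) ^ m := by
          gcongr
          exact exp_half_le_one_add hd0.le (by linarith)
  have h6 : (n : ℝ) ^ (k + 1) * (c * (1 / n) ^ k) ≤ C ^ 2 := by
    refine le_trans ?_ h4
    gcongr
  have h7 : (n : ℝ) ^ (k + 1) * (c * (1 / n) ^ k) = n * c := by
    rw [pow_succ, one_div, inv_pow]
    field_simp
  rw [h7] at h6
  rw [div_lt_iff₀ hc] at hnC
  linarith

/-- Constants that exist for each of finitely many residues can be chosen uniformly. -/
lemma exists_uniform_of_residue {p : ℕ} (hp : 0 < p) {P : ℕ → ℂ → Prop} {f : ℕ → ℝ}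
    (hf : ∀ n, 0 ≤ f n)
    (h : ∀ b < p, ∃ K : ℝ, ∃ n₀ : ℕ, ∀ m : ℕ, n₀ ≤ m * p + b → ∀ z : ℂ, P (m * p + b) z →
      1 - ‖z‖ ≤ K * f (m * p + b)) :
    ∃ K : ℝ, ∃ n₀ : ℕ, ∀ n : ℕ, n₀ ≤ n → ∀ z : ℂ, P n z → 1 - ‖z‖ ≤ K * f n := by
  choose! K n₀ h using h
  refine ⟨∑ b ∈ Finset.range p, |K b|, ∑ b ∈ Finset.range p, n₀ b, fun n hn z hz => ?_⟩
  have hb := Nat.mod_lt n hp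
  have hmem := Finset.mem_range.2 hb
  have e : n / p * p + n % p = n := Nat.div_add_mod' n p
  have h1 : n₀ (n % p) ≤ n / p * p + n % p := by
    rw [e]
    exact (Finset.single_le_sum (fun _ _ => Nat.zero_le _) hmem).trans hn
  have h2 := h (n % p) hb (n / p) h1 z (by rwa [e])
  rw [e] at h2
  refine h2.trans (mul_le_mul_of_nonneg_right ?_ (hf n))
  exact (le_abs_self _).trans
    (Finset.single_le_sum (f := fun b => |K b|) (fun _ _ => abs_nonneg _) hmem)

lemma zeros_log_bound {p : ℕ} (hp : 0 < p) (hα : ∀ n, ‖α n‖ < 1)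
    (hper : ∀ n, α (n + p) = α n) (hne : ∃ n, α n ≠ 0) :
    ∃ K : ℝ, ∃ n₀ : ℕ, ∀ n : ℕ, n₀ ≤ n → ∀ z : ℂ,
      ((phi α n).eval z = 0 ∧ 1 - ‖z‖ ≤ (n : ℝ) ^ (-(1 / 2) : ℝ)) →
      1 - ‖z‖ ≤ K * (Real.log (n : ℝ) / (n : ℝ)) := by
  refine exists_uniform_of_residue (f := fun n : ℕ => Real.log (n : ℝ) / (n : ℝ)) hp
    (fun n => div_nonneg (Real.log_natCast_nonneg n) (Nat.cast_nonneg n)) fun b hb => ?_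
  obtain ⟨K, n₀, h⟩ := log_bound_of_residue hp hα hper hne b hb
  exact ⟨K, n₀, fun m hm z hz => h m hm z hz.1 hz.2⟩

/-! ### The Jost functions near a point of the circle that is not singular -/

lemma continuousAt_eigPlus {p : ℕ} (hp : 0 < p) (hα : ∀ n, ‖α n‖ < 1) {w : ℂ} (hw0 : w ≠ 0)
    (hw : ‖w‖ < 1) : ContinuousAt (eigPlus α p) w := by
  have hrw : 0 < ‖w‖ ^ p := pow_pos (norm_pos_iff.2 hw0) p
  have hgap : ‖eigMinus α p w‖ < Real.sqrt (‖w‖ ^ p) := by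
    have h1 := le_norm_sq_eigenvalue hp hα hw.le (eigPlus_add_eigMinus α p w)
      (eigPlus_mul_eigMinus hα p w) (norm_eigMinus_le α p w)
    have h2 : ‖w‖ ^ p < ‖eigPlus α p w‖ ^ 2 := by nlinarith
    have h3 := congrArg norm (eigPlus_mul_eigMinus hα p w)
    rw [norm_mul, norm_pow] at h3
    have h4 : 0 < ‖eigPlus α p w‖ := by
      by_contra! h
      nlinarith [norm_nonneg (eigPlus α p w)]
    apply Real.lt_sqrt_of_sq_lt
    have h5 : ‖eigMinus α p w‖ < ‖eigPlus α p w‖ := by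
      refine lt_of_mul_lt_mul_left ?_ h4.le
      rw [h3, ← pow_two]; exact h2
    have h6 : 0 < ‖eigMinus α p w‖ := by
      by_contra! h
      nlinarith [norm_nonneg (eigMinus α p w)]
    calc ‖eigMinus α p w‖ ^ 2 = ‖eigMinus α p w‖ * ‖eigMinus α p w‖ := pow_two _
      _ < ‖eigPlus α p w‖ * ‖eigMinus α p w‖ := mul_lt_mul_of_pos_right h5 h6
      _ = _ := h3
  set δ := (Real.sqrt (‖w‖ ^ p) - ‖eigMinus α p w‖) / 2 with hδ
  have hδ0 : 0 < δ := by rw [hδ]; linarith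
  have hcont : Continuous fun z : ℂ => Real.sqrt (‖z‖ ^ p) := by fun_prop
  have ev1 : ∀ᶠ z in 𝓝 w, Real.sqrt (‖w‖ ^ p) - δ < Real.sqrt (‖z‖ ^ p) :=
    hcont.continuousAt.eventually_const_lt (by linarith)
  have ev2 : ∀ᶠ z : ℂ in 𝓝 w, ‖z‖ < 1 := continuous_norm.continuousAt.eventually_lt_const hw
  set τ := tracePoly α p
  have hlim : Tendsto (fun z : ℂ => (‖τ.eval z - τ.eval w‖ * (‖τ.eval z‖ + 1) +
      ‖z ^ p - w ^ p‖) / δ) (𝓝 w) (𝓝 0) := by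
    have hc : Continuous fun z : ℂ => (‖τ.eval z - τ.eval w‖ * (‖τ.eval z‖ + 1) +
      ‖z ^ p - w ^ p‖) / δ := by
      have := τ.continuous
      fun_prop
    convert hc.tendsto w using 2
    simp
  rw [ContinuousAt, tendsto_iff_norm_sub_tendsto_zero]
  refine squeeze_zero' (Eventually.of_forall fun _ => norm_nonneg _) ?_ hlim
  filter_upwards [ev1, ev2] with z h1 h2
  have hs := eigPlus_add_eigMinus α p z
  have hm := eigPlus_mul_eigMinus hα p z
  have hle := norm_eigMinus_le α p z
  have hs' := eigPlus_add_eigMinus α p w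
  have hm' := eigPlus_mul_eigMinus hα p w
  have hu := norm_eigenvalue_le h2.le hs hm hle
  rw [← eval_tracePoly] at hs hs'
  have hbig : Real.sqrt (‖z‖ ^ p) ≤ ‖eigPlus α p z‖ := by
    rw [Real.sqrt_le_left (norm_nonneg _), ← norm_pow, ← hm, norm_mul, pow_two]
    gcongr
  have hdist : δ ≤ ‖eigPlus α p z - eigMinus α p w‖ := by
    have := norm_sub_norm_le (eigPlus α p z) (eigMinus α p w)
    linarith
  rw [le_div_iff₀ hδ0]
  calc ‖eigPlus α p z - eigPlus α p w‖ * δ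
      ≤ ‖eigPlus α p z - eigPlus α p w‖ * ‖eigPlus α p z - eigMinus α p w‖ := by gcongr
    _ = ‖(τ.eval z - τ.eval w) * eigPlus α p z - (z ^ p - w ^ p)‖ := by
        rw [← norm_mul]
        congr 1
        linear_combination eigPlus α p z * hs - hm - eigPlus α p z * hs' + hm'
    _ ≤ ‖τ.eval z - τ.eval w‖ * ‖eigPlus α p z‖ + ‖z ^ p - w ^ p‖ := by
        rw [← norm_mul]; exact norm_sub_le _ _
    _ ≤ _ := by gcongr

lemma continuousAt_jost {p : ℕ} (hp : 0 < p) (hα : ∀ n, ‖α n‖ < 1) (hper : ∀ n, α (n + p) = α n)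
    (b : ℕ) {w : ℂ} (hw0 : w ≠ 0) (hw : ‖w‖ < 1) : ContinuousAt (jost α p b) w := by
  have h1 := continuousAt_eigPlus hp hα hw0 hw
  have hτ : Continuous fun z => (transfer α p z).trace := by
    simp only [← eval_tracePoly]
    exact (tracePoly α p).continuous
  have h2 : ContinuousAt (eigMinus α p) w := by
    unfold eigMinus
    exact hτ.continuousAt.sub h1
  have : jost α p b = fun z => (eigPlus α p z - eigMinus α p z)⁻¹ *
      ((phi α (b + p)).eval z - eigMinus α p z * (phi α b).eval z) :=
    funext (jost_eq hper b)
  rw [this]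
  exact ((h1.sub h2).inv₀ (eigPlus_ne_eigMinus hp hα hw0 hw)).mul
    ((phi α (b + p)).continuous.continuousAt.sub
      (h2.mul (phi α b).continuous.continuousAt))

lemma polynomial_ratio_dichotomy (f : ℂ[X]) {g : ℂ[X]} (hg : g ≠ 0) (z₀ : ℂ) :
    (∃ c : ℝ, 0 < c ∧ ∀ᶠ z in 𝓝 z₀, c * ‖g.eval z‖ ≤ ‖f.eval z‖) ∨
      ∀ ε : ℝ, 0 < ε → ∀ᶠ z in 𝓝 z₀, ‖f.eval z‖ ≤ ε * ‖g.eval z‖ := by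
  by_cases hf : f = 0
  · right
    intro ε hε
    filter_upwards with z
    rw [hf, eval_zero, norm_zero]
    positivity
  obtain ⟨f₁, hf₁, hf₂⟩ := exists_eq_pow_rootMultiplicity_mul_and_not_dvd f hf z₀
  obtain ⟨g₁, hg₁, hg₂⟩ := exists_eq_pow_rootMultiplicity_mul_and_not_dvd g hg z₀
  set k := rootMultiplicity z₀ f
  set l := rootMultiplicity z₀ g
  rw [dvd_iff_isRoot, IsRoot.def] at hf₂ hg₂
  have hf0 := norm_pos_iff.2 hf₂
  have hg0 := norm_pos_iff.2 hg₂
  have ef : ∀ z, ‖f.eval z‖ = ‖z - z₀‖ ^ k * ‖f₁.eval z‖ := fun z => by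
    rw [hf₁]; simp
  have eg : ∀ z, ‖g.eval z‖ = ‖z - z₀‖ ^ l * ‖g₁.eval z‖ := fun z => by
    rw [hg₁]; simp
  have evf : ∀ᶠ z in 𝓝 z₀, ‖f₁.eval z₀‖ / 2 < ‖f₁.eval z‖ :=
    (f₁.continuous.norm.continuousAt).eventually_const_lt (by linarith)
  have evf' : ∀ᶠ z in 𝓝 z₀, ‖f₁.eval z‖ < ‖f₁.eval z₀‖ * 2 :=
    (f₁.continuous.norm.continuousAt).eventually_lt_const (by linarith)
  have evg : ∀ᶠ z in 𝓝 z₀, ‖g₁.eval z₀‖ / 2 < ‖g₁.eval z‖ :=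
    (g₁.continuous.norm.continuousAt).eventually_const_lt (by linarith)
  have evg' : ∀ᶠ z in 𝓝 z₀, ‖g₁.eval z‖ < ‖g₁.eval z₀‖ * 2 :=
    (g₁.continuous.norm.continuousAt).eventually_lt_const (by linarith)
  have hsub : Continuous fun z : ℂ => ‖z - z₀‖ := by fun_prop
  have ev1 : ∀ ε : ℝ, 0 < ε → ∀ᶠ z in 𝓝 z₀, ‖z - z₀‖ < ε := fun ε hε =>
    hsub.continuousAt.eventually_lt_const (by simpa using hε)
  rcases le_or_gt k l with hkl | hkl
  · left
    refine ⟨‖f₁.eval z₀‖ / 2 / (‖g₁.eval z₀‖ * 2), by positivity, ?_⟩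
    filter_upwards [evf, evg', ev1 1 one_pos] with z h1 h2 h3
    rw [ef, eg]
    have h4 : ‖z - z₀‖ ^ l ≤ ‖z - z₀‖ ^ k :=
      pow_le_pow_of_le_one (norm_nonneg _) h3.le hkl
    calc _ ≤ ‖f₁.eval z₀‖ / 2 / (‖g₁.eval z₀‖ * 2) *
          (‖z - z₀‖ ^ k * (‖g₁.eval z₀‖ * 2)) := by gcongr
      _ = ‖z - z₀‖ ^ k * (‖f₁.eval z₀‖ / 2) := by field_simp
      _ ≤ _ := by gcongr
  · right
    intro ε hε
    filter_upwards [evf', evg, ev1 1 one_pos,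
      ev1 (ε * (‖g₁.eval z₀‖ / 2) / (‖f₁.eval z₀‖ * 2)) (by positivity)] with z h1 h2 h3 h4
    rw [ef, eg]
    have h5 : ‖z - z₀‖ ^ k ≤ ‖z - z₀‖ ^ (l + 1) :=
      pow_le_pow_of_le_one (norm_nonneg _) h3.le hkl
    rw [lt_div_iff₀ (by positivity)] at h4
    calc _ ≤ ‖z - z₀‖ ^ (l + 1) * (‖f₁.eval z₀‖ * 2) := by gcongr
      _ = ‖z - z₀‖ ^ l * (‖z - z₀‖ * (‖f₁.eval z₀‖ * 2)) := by ring
      _ ≤ ‖z - z₀‖ ^ l * (ε * (‖g₁.eval z₀‖ / 2)) := by gcongr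
      _ ≤ ‖z - z₀‖ ^ l * (ε * ‖g₁.eval z‖) := by gcongr
      _ = _ := by ring

lemma jost_mul_conjugate {p : ℕ} (hp : 0 < p) (hα : ∀ n, ‖α n‖ < 1) (hper : ∀ n, α (n + p) = α n)
    (b : ℕ) {z : ℂ} (hz0 : z ≠ 0) (hz : ‖z‖ < 1) :
    jost α p b z * ((phi α b).eval z - jost α p b z) * (discPoly α p).eval z =
      -(jostPoly α p b).eval z := by
  have hs := eigPlus_add_eigMinus α p z
  have hm := eigPlus_mul_eigMinus hα p z
  have hne := eigPlus_ne_eigMinus hp hα hz0 hz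
  rw [eval_jostPoly b hs hm, eval_discPoly hs hm, jost_eq hper]
  field_simp
  ring

/-- Near a point of the circle where `j_b` does not have radial limit `0`, it is bounded away from
zero inside the disk. The two branches of `j_b` have the sum `φ_b` and a product that is a rational
function. If the product has a zero at the point, then one branch is small and the other is not,
and by connectedness it is the same branch throughout. -/
lemma jost_bounded_below {p : ℕ} (hp : 0 < p) (hα : ∀ n, ‖α n‖ < 1)
    (hper : ∀ n, α (n + p) = α n) (b : ℕ) {z₀ : ℂ} (hz₀ : ‖z₀‖ = 1)
    (hns : ¬ Tendsto (fun r : ℝ => jost α p b (r * z₀)) (𝓝[<] 1) (𝓝 0)) :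
    ∃ c : ℝ, 0 < c ∧ ∀ᶠ z in 𝓝 z₀, ‖z‖ < 1 → c ≤ ‖jost α p b z‖ := by
  have hz00 : z₀ ≠ 0 := norm_pos_iff.1 (by rw [hz₀]; exact one_pos)
  have ev0 : ∀ᶠ z in 𝓝 z₀, z ≠ 0 := isOpen_ne.mem_nhds hz00
  have hφ : 0 < ‖(phi α b).eval z₀‖ := norm_pos_iff.2 (eval_phi_ne_zero hα hz₀.ge b)
  set A := ‖(phi α b).eval z₀‖ / 2 with hA
  have hA0 : 0 < A := by positivity
  have evφ : ∀ᶠ z in 𝓝 z₀, A < ‖(phi α b).eval z‖ :=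
    ((phi α b).continuous.norm.continuousAt).eventually_const_lt (by linarith)
  have evφ' : ∀ᶠ z in 𝓝 z₀, ‖(phi α b).eval z‖ < 4 * A :=
    ((phi α b).continuous.norm.continuousAt).eventually_lt_const (by linarith)
  have hmul : ∀ z : ℂ, z ≠ 0 → ‖z‖ < 1 → ‖jost α p b z‖ * ‖(phi α b).eval z - jost α p b z‖ *
      ‖(discPoly α p).eval z‖ = ‖(jostPoly α p b).eval z‖ := fun z h0 h1 => by
    rw [← norm_mul, ← norm_mul, jost_mul_conjugate hp hα hper b h0 h1, norm_neg]
  have hdisc : ∀ z : ℂ, z ≠ 0 → ‖z‖ < 1 → 0 < ‖(discPoly α p).eval z‖ := fun z h0 h1 => by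
    rw [eval_discPoly (eigPlus_add_eigMinus α p z) (eigPlus_mul_eigMinus hα p z), norm_pos_iff]
    exact pow_ne_zero 2 (eigPlus_ne_eigMinus hp hα h0 h1)
  rcases polynomial_ratio_dichotomy (jostPoly α p b) (discPoly_ne_zero hp hα) z₀ with
    ⟨c, hc, hev⟩ | hev
  · refine ⟨min A (c / (5 * A)), by positivity, ?_⟩
    filter_upwards [ev0, evφ', hev] with z h0 h1 h2 hz
    by_contra! h3
    have h4 := h3.trans_le (min_le_left _ _)
    have h5 := h3.trans_le (min_le_right _ _)
    rw [← hmul z h0 hz] at h2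
    have h6 := le_of_mul_le_mul_right h2 (hdisc z h0 hz)
    have h7 : ‖(phi α b).eval z - jost α p b z‖ < 5 * A :=
      (norm_sub_le _ _).trans_lt (by linarith)
    have h8 : ‖jost α p b z‖ * ‖(phi α b).eval z - jost α p b z‖ ≤ ‖jost α p b z‖ * (5 * A) := by
      gcongr
    rw [lt_div_iff₀ (by positivity)] at h5
    linarith
  · -- on a half-disk `U` near `z₀` the value `‖j_b‖ = A / 2` is not attained
    obtain ⟨ε, hε, hball⟩ := Metric.eventually_nhds_iff_ball.1
      ((ev0.and evφ).and (hev (A ^ 2 / 8) (by positivity)))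
    set U := Metric.ball z₀ ε ∩ Metric.ball 0 1 with hU
    have hconn : IsPreconnected U :=
      ((convex_ball z₀ ε).inter (convex_ball 0 1)).isPreconnected
    have hsum : ∀ z ∈ U, A / 2 ≤ ‖jost α p b z‖ →
        A / 2 ≤ ‖(phi α b).eval z - jost α p b z‖ → False := by
      intro z hz h1 h2
      have hz1 : ‖z‖ < 1 := by simpa using hz.2
      obtain ⟨⟨h0, _⟩, h4⟩ := hball z hz.1
      rw [← hmul z h0 hz1] at h4
      have h5 := le_of_mul_le_mul_right h4 (hdisc z h0 hz1)
      have h6 : A / 2 * (A / 2) ≤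
          ‖jost α p b z‖ * ‖(phi α b).eval z - jost α p b z‖ := by gcongr
      nlinarith
    have hne : ∀ z ∈ U, ‖jost α p b z‖ ≠ A / 2 := by
      intro z hz h1
      refine hsum z hz h1.ge ?_
      have h2 := (hball z hz.1).1.2
      have := norm_sub_norm_le ((phi α b).eval z) (jost α p b z)
      linarith
    have hcont : ContinuousOn (fun z => ‖jost α p b z‖) U := by
      intro z hz
      exact (continuousAt_jost hp hα hper b (hball z hz.1).1.1
        (by simpa using hz.2)).norm.continuousWithinAt
    by_cases hall : ∀ z ∈ U, A / 2 ≤ ‖jost α p b z‖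
    · refine ⟨A / 2, by positivity, ?_⟩
      filter_upwards [Metric.ball_mem_nhds z₀ hε] with z hz hz1
      exact hall z ⟨hz, by simpa using hz1⟩
    · exfalso
      push Not at hall
      obtain ⟨z₁, hz₁, hlt⟩ := hall
      have hsmall : ∀ z ∈ U, ‖jost α p b z‖ < A / 2 := by
        intro z hz
        by_contra! h
        obtain ⟨w, hw, hw'⟩ := hconn.intermediate_value hz₁ hz hcont
          (show A / 2 ∈ Set.Icc _ _ from ⟨hlt.le, h⟩)
        exact hne w hw hw'
      apply hns
      have hlim : Tendsto (fun r : ℝ => (r : ℂ) * z₀) (𝓝[<] 1) (𝓝 z₀) := by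
        have hc : Continuous fun r : ℝ => (r : ℂ) * z₀ := by fun_prop
        have := hc.tendsto 1
        rw [Complex.ofReal_one, one_mul] at this
        exact this.mono_left nhdsWithin_le_nhds
      rw [Metric.tendsto_nhds]
      intro η hη
      have hpos : ∀ᶠ r : ℝ in 𝓝[<] 1, 0 < r :=
        nhdsWithin_le_nhds (lt_mem_nhds one_pos)
      filter_upwards [hlim.eventually (hev (η * (A / 4)) (by positivity)),
        hlim.eventually (Metric.ball_mem_nhds z₀ hε), self_mem_nhdsWithin, hpos]
        with r h1 h2 h3 h4
      have hr1 : ‖(r : ℂ) * z₀‖ < 1 := by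
        rw [norm_mul, hz₀, mul_one, Complex.norm_real, Real.norm_of_nonneg h4.le]
        exact h3
      have hrU : (r : ℂ) * z₀ ∈ U := ⟨h2, by simpa using hr1⟩
      set z := (r : ℂ) * z₀
      obtain ⟨⟨h0, h5⟩, _⟩ := hball z h2
      rw [← hmul z h0 hr1] at h1
      have h6 := le_of_mul_le_mul_right h1 (hdisc z h0 hr1)
      have h7 : A / 2 ≤ ‖(phi α b).eval z - jost α p b z‖ := by
        have := norm_sub_norm_le ((phi α b).eval z) (jost α p b z)
        have := hsmall z hrU
        linarith
      rw [dist_zero_right]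
      have h8 : ‖jost α p b z‖ * (A / 2) ≤ η * (A / 4) :=
        (mul_le_mul_of_nonneg_left h7 (norm_nonneg _)).trans h6
      nlinarith

lemma jost_bounded_below_near_compact {p : ℕ} (hp : 0 < p) (hα : ∀ n, ‖α n‖ < 1)
    (hper : ∀ n, α (n + p) = α n) (b : ℕ) {s : Set ℂ} (hs : IsCompact s)
    (hs1 : ∀ z ∈ s, ‖z‖ = 1)
    (hns : ∀ z ∈ s, ¬ Tendsto (fun r : ℝ => jost α p b (r * z)) (𝓝[<] 1) (𝓝 0)) :
    ∃ c : ℝ, 0 < c ∧ ∃ δ : ℝ, 0 < δ ∧ ∀ z : ℂ, ‖z‖ < 1 → (∃ w ∈ s, dist z w < δ) →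
      c ≤ ‖jost α p b z‖ := by
  have key : ∃ c : ℝ, 0 < c ∧ ∃ V : Set ℂ, IsOpen V ∧ s ⊆ V ∧
      ∀ z ∈ V, ‖z‖ < 1 → c ≤ ‖jost α p b z‖ := by
    refine hs.induction_on (p := fun t => ∃ c : ℝ, 0 < c ∧ ∃ V : Set ℂ, IsOpen V ∧ t ⊆ V ∧
      ∀ z ∈ V, ‖z‖ < 1 → c ≤ ‖jost α p b z‖) ?_ ?_ ?_ ?_
    · exact ⟨1, one_pos, ∅, isOpen_empty, subset_rfl, by simp⟩
    · rintro t t' htt ⟨c, hc, V, hV, ht, h⟩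
      exact ⟨c, hc, V, hV, htt.trans ht, h⟩
    · rintro t t' ⟨c, hc, V, hV, ht, h⟩ ⟨c', hc', V', hV', ht', h'⟩
      refine ⟨min c c', lt_min hc hc', V ∪ V', hV.union hV', Set.union_subset_union ht ht', ?_⟩
      rintro z (hz | hz) hz1
      · exact (min_le_left _ _).trans (h z hz hz1)
      · exact (min_le_right _ _).trans (h' z hz hz1)
    · intro z hz
      obtain ⟨c, hc, hev⟩ := jost_bounded_below hp hα hper b (hs1 z hz) (hns z hz)
      obtain ⟨V, hV, hVo, hzV⟩ := eventually_nhds_iff.1 hev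
      exact ⟨V, mem_nhdsWithin_of_mem_nhds (hVo.mem_nhds hzV), c, hc, V, hVo, subset_rfl,
        fun w hw => hV w hw⟩
  obtain ⟨c, hc, V, hV, hsV, h⟩ := key
  obtain ⟨δ, hδ, hsub⟩ := hs.exists_thickening_subset_open hV hsV
  exact ⟨c, hc, δ, hδ, fun z hz hw => h z (hsub (Metric.mem_thickening_iff.2 hw)) hz⟩

/-- If no point of a compact set of the circle is singular, the zeros above this set have distance
`O(1 / n)` to the circle. -/
lemma zeros_inv_bound {p : ℕ} (hp : 0 < p) (hα : ∀ n, ‖α n‖ < 1)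
    (hper : ∀ n, α (n + p) = α n) {s : Set ℂ} (hs : IsCompact s) (hs1 : ∀ z ∈ s, ‖z‖ = 1)
    (hns : ∀ z ∈ s, ∀ b < p,
      ¬ Tendsto (fun r : ℝ => jost α p b (r * z)) (𝓝[<] 1) (𝓝 0)) :
    ∃ K : ℝ, ∃ n₀ : ℕ, ∀ n : ℕ, n₀ ≤ n → ∀ z : ℂ,
      ((phi α n).eval z = 0 ∧ 1 - ‖z‖ ≤ (n : ℝ) ^ (-(1 / 2) : ℝ) ∧
        ∃ w ∈ s, z = (‖z‖ : ℂ) * w) →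
      1 - ‖z‖ ≤ K * (1 / (n : ℝ)) := by
  refine exists_uniform_of_residue (f := fun n : ℕ => 1 / (n : ℝ)) hp
    (fun n => by positivity) fun b hb => ?_
  obtain ⟨c, hc, δ, hδ, hj⟩ := jost_bounded_below_near_compact hp hα hper b hs hs1
    (fun z hz => hns z hz b hb)
  obtain ⟨C₀, hC₀, hx0⟩ := exists_bound_eval (phi α b)
  obtain ⟨N₁, hN₁⟩ := exists_rpow_neg_half_lt (lt_min hδ (by norm_num : (0 : ℝ) < 1 / 2))
  refine ⟨2 * p * (C₀ / c), N₁ + 2 * p, fun m hm z ⟨hzero, hd, w, hw, hzw⟩ => ?_⟩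
  have hd' := hd.trans_lt (hN₁ _ (by omega))
  have hz1 : ‖z‖ < 1 := by
    by_contra! h
    exact eval_phi_ne_zero hα h _ hzero
  set d := 1 - ‖z‖ with hdd
  have hd0 : 0 < d := by rw [hdd]; linarith
  have hd2 : d < 1 / 2 := hd'.trans_le (min_le_right _ _)
  have hz0 : z ≠ 0 := by
    rintro rfl
    rw [norm_zero] at hdd
    linarith
  have hdist : dist z w < δ := by
    rw [dist_eq_norm, hzw, show (‖z‖ : ℂ) * w - w = ((‖z‖ - 1 : ℝ) : ℂ) * w by push_cast; ring,
      norm_mul, hs1 w hw, mul_one, Complex.norm_real, Real.norm_eq_abs, abs_sub_comm, ← hdd,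
      abs_of_pos hd0]
    exact hd'.trans_le (min_le_left _ _)
  have hjz := hj z hz1 ⟨w, hw, hdist⟩
  have hs := eigPlus_add_eigMinus α p z
  have hmul := eigPlus_mul_eigMinus hα p z
  have hle := norm_eigMinus_le α p z
  have h1 := zero_bound hp hα hper hz0 hz1.le hs hmul hle hzero
  have hS := eigPlus_ne_eigMinus hp hα hz0 hz1
  rw [jost_eq hper, norm_mul, norm_inv, inv_mul_eq_div, le_div_iff₀ (norm_pos_iff.2 hS)] at hjz
  set S := ‖eigPlus α p z - eigMinus α p z‖
  set A := ‖(phi α (b + p)).eval z - eigMinus α p z * (phi α b).eval z‖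
  have hSpos : 0 < S := norm_pos_iff.2 hS
  have hApos : 0 < A := lt_of_lt_of_le (by positivity) hjz
  have h2 : ‖(phi α (b + p)).eval z - eigPlus α p z * (phi α b).eval z‖ ≤ A + S * C₀ := by
    rw [show (phi α (b + p)).eval z - eigPlus α p z * (phi α b).eval z =
      ((phi α (b + p)).eval z - eigMinus α p z * (phi α b).eval z) -
        (eigPlus α p z - eigMinus α p z) * (phi α b).eval z by ring]
    refine (norm_sub_le _ _).trans ?_
    rw [norm_mul]
    have := hx0 z hz1.le
    gcongr
  have h3 : 1 + m * d ≤ (1 + d) ^ m := one_add_mul_le_pow (by linarith) m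
  have h4 : m * d * A ≤ S * C₀ := by
    have : (1 + m * d) * A ≤ (1 + d) ^ m * A := by gcongr
    linarith
  have h5 : m * d ≤ C₀ / c := by
    rw [le_div_iff₀ hc]
    refine le_of_mul_le_mul_right ?_ hSpos
    calc m * d * c * S = m * d * (c * S) := by ring
      _ ≤ m * d * A := by gcongr
      _ ≤ _ := h4
      _ = _ := by ring
  have hp1 : (0 : ℝ) < p := by exact_mod_cast hp
  have hn2 : (2 * p : ℝ) ≤ (m * p + b : ℕ) := by exact_mod_cast (show 2 * p ≤ m * p + b by omega)
  have hn3 : ((m * p + b : ℕ) : ℝ) < m * p + p := by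
    exact_mod_cast (show m * p + b < m * p + p by omega)
  set n : ℝ := ((m * p + b : ℕ) : ℝ)
  have hnpos : 0 < n := by linarith
  rw [mul_one_div, le_div_iff₀ hnpos]
  have h6 : n ≤ 2 * p * m := by linarith
  calc d * n ≤ d * (2 * p * m) := by gcongr
    _ = 2 * p * (m * d) := by ring
    _ ≤ _ := by gcongr

/-! ### The discriminant as an entire function of the angle -/

/-- The discriminant as an entire function of a complex angle. -/
def discrC (α : ℕ → ℂ) (p : ℕ) (θ : ℂ) : ℂ :=
  Complex.exp (-((p : ℂ) * θ / 2) * Complex.I) *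
    (tracePoly α p).eval (Complex.exp (θ * Complex.I))

/-- The discriminant as a real function of the angle. -/
def discrR (α : ℕ → ℂ) (p : ℕ) (θ : ℝ) : ℝ := (discr α p θ).re

lemma discrC_ofReal (α : ℕ → ℂ) (p : ℕ) (θ : ℝ) : discrC α p θ = discr α p θ := by
  rw [discrC, discr, eval_tracePoly]

lemma transfer_unit_circle (α : ℕ → ℂ) (n : ℕ) {z : ℂ} (hz : z * starRingEnd ℂ z = 1) :
    transfer α n z 1 1 = z ^ n * starRingEnd ℂ (transfer α n z 0 0) ∧
      transfer α n z 1 0 = z ^ n * starRingEnd ℂ (transfer α n z 0 1) := by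
  induction n with
  | zero => simp [transfer]
  | succ n ih =>
    obtain ⟨h1, h2⟩ := ih
    simp only [transfer, Matrix.mul_apply, Fin.sum_univ_two, h1, h2, stepMatrix, Matrix.smul_apply,
      Matrix.of_apply, Matrix.cons_val', Matrix.cons_val_zero, Matrix.cons_val_one, smul_eq_mul,
      Matrix.cons_val_fin_one, map_add, map_mul, map_inv₀, Complex.conj_ofReal, map_neg,
      Complex.conj_conj, map_pow]
    have hzn : z ^ n * starRingEnd ℂ z ^ n = 1 := by rw [← mul_pow, hz, one_pow]
    constructor
    · linear_combination
        (-(rho α n : ℂ)⁻¹ * z ^ n * starRingEnd ℂ (transfer α n z 0 0)) * hz +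
        (rho α n : ℂ)⁻¹ * z * α n * transfer α n z 0 1 * hzn
    · linear_combination
        (-(rho α n : ℂ)⁻¹ * z ^ n * starRingEnd ℂ (transfer α n z 0 1)) * hz +
        (rho α n : ℂ)⁻¹ * z * α n * transfer α n z 0 0 * hzn

lemma conj_exp_mul_I (θ : ℝ) :
    Complex.exp (θ * Complex.I) * starRingEnd ℂ (Complex.exp (θ * Complex.I)) = 1 := by
  rw [Complex.mul_conj, Complex.normSq_eq_norm_sq, Complex.norm_exp_ofReal_mul_I]
  norm_num

lemma discr_eq_ofReal (α : ℕ → ℂ) (p : ℕ) (θ : ℝ) : discr α p θ = (discrR α p θ : ℂ) := by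
  set z := Complex.exp (θ * Complex.I) with hz
  have h := (transfer_unit_circle α p (conj_exp_mul_I θ)).1
  set w := Complex.exp (-((p : ℂ) * θ / 2) * Complex.I) with hw
  have hwz : w * z ^ p = starRingEnd ℂ w := by
    rw [hw, hz, ← Complex.exp_conj, ← Complex.exp_nat_mul, ← Complex.exp_add]
    congr 1
    simp [Complex.conj_ofNat]
    ring
  have hd : discr α p θ =
      w * transfer α p z 0 0 + starRingEnd ℂ (w * transfer α p z 0 0) := by
    rw [discr, Matrix.trace_fin_two, h, ← hz, map_mul, ← hwz]
    ring
  rw [discrR, eq_comm, ← Complex.conj_eq_iff_re, hd]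
  simp [add_comm]

lemma discrC_ofReal' (α : ℕ → ℂ) (p : ℕ) (θ : ℝ) : discrC α p θ = (discrR α p θ : ℂ) := by
  rw [discrC_ofReal, discr_eq_ofReal]

lemma norm_discr (α : ℕ → ℂ) (p : ℕ) (θ : ℝ) : ‖discr α p θ‖ = |discrR α p θ| := by
  rw [discr_eq_ofReal, Complex.norm_real, Real.norm_eq_abs]

lemma differentiable_discrC (α : ℕ → ℂ) (p : ℕ) : Differentiable ℂ (discrC α p) := by
  unfold discrC
  have := (tracePoly α p).differentiable
  have h2 : Differentiable ℂ fun θ : ℂ => Complex.exp (θ * Complex.I) := by fun_prop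
  exact (by fun_prop : Differentiable ℂ fun θ : ℂ =>
    Complex.exp (-((p : ℂ) * θ / 2) * Complex.I)).mul (this.comp h2)

lemma hasDerivAt_discrR (α : ℕ → ℂ) (p : ℕ) (θ : ℝ) :
    HasDerivAt (discrR α p) (deriv (discrC α p) θ).re θ := by
  have h := ((differentiable_discrC α p) (θ : ℂ)).hasDerivAt.real_of_complex
  refine h.congr_of_eventuallyEq (Eventually.of_forall fun t => ?_)
  simp only [discrC_ofReal', Complex.ofReal_re]

lemma continuous_discrR (α : ℕ → ℂ) (p : ℕ) : Continuous (discrR α p) :=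
  continuous_iff_continuousAt.2 fun θ => (hasDerivAt_discrR α p θ).continuousAt

lemma deriv_discrC_ofReal (α : ℕ → ℂ) (p : ℕ) (θ : ℝ) :
    deriv (discrC α p) θ = ((deriv (discrC α p) θ).re : ℂ) := by
  have h1 := ((differentiable_discrC α p) (θ : ℂ)).hasDerivAt.comp_ofReal
  have h2 := (hasDerivAt_discrR α p θ).ofReal_comp
  refine h1.unique (h2.congr_of_eventuallyEq (Eventually.of_forall fun t => ?_))
  simp only [discrC_ofReal']

lemma discrC_mul (α : ℕ → ℂ) (p : ℕ) (θ : ℂ) :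
    Complex.exp ((p : ℂ) * θ / 2 * Complex.I) * discrC α p θ =
      (transfer α p (Complex.exp (θ * Complex.I))).trace := by
  rw [discrC, ← mul_assoc, ← Complex.exp_add, eval_tracePoly]
  simp

lemma exp_half_sq (p : ℕ) (θ : ℂ) : Complex.exp ((p : ℂ) * θ / 2 * Complex.I) ^ 2 =
    Complex.exp (θ * Complex.I) ^ p := by
  rw [← Complex.exp_nat_mul, ← Complex.exp_nat_mul]
  congr 1
  push_cast
  ring

lemma norm_exp_mul_I (θ : ℂ) : ‖Complex.exp (θ * Complex.I)‖ = Real.exp (-θ.im) := by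
  rw [Complex.norm_exp]; simp

/-- At an angle `θ` with discriminant `2 cos η` the eigenvalues are `e^{i(pθ/2 ± η)}`. -/
lemma eigenvalues_of_discrC {p : ℕ} {θ η : ℂ} (h : discrC α p θ = 2 * Complex.cos η) :
    Complex.exp ((p : ℂ) * θ / 2 * Complex.I) * Complex.exp (η * Complex.I) +
      Complex.exp ((p : ℂ) * θ / 2 * Complex.I) * Complex.exp (-η * Complex.I) =
        (transfer α p (Complex.exp (θ * Complex.I))).trace ∧
    Complex.exp ((p : ℂ) * θ / 2 * Complex.I) * Complex.exp (η * Complex.I) *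
      (Complex.exp ((p : ℂ) * θ / 2 * Complex.I) * Complex.exp (-η * Complex.I)) =
        Complex.exp (θ * Complex.I) ^ p := by
  constructor
  · rw [← discrC_mul, h, Complex.two_cos]; ring
  · have : Complex.exp (η * Complex.I) * Complex.exp (-η * Complex.I) = 1 := by
      rw [← Complex.exp_add]; simp
    rw [← exp_half_sq]
    linear_combination Complex.exp ((p : ℂ) * θ / 2 * Complex.I) ^ 2 * this

/-- The discriminant takes values in `[-2, 2]` only at real angles. -/
lemma im_eq_zero_of_discrC {p : ℕ} (hp : 0 < p) (hα : ∀ n, ‖α n‖ < 1) {θ : ℂ} {η : ℝ}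
    (h : discrC α p θ = 2 * Complex.cos η) : θ.im = 0 := by
  obtain ⟨hs, hm⟩ := eigenvalues_of_discrC h
  have hn : ‖Complex.exp ((p : ℂ) * θ / 2 * Complex.I) * Complex.exp (η * Complex.I)‖ ^ 2 =
      ‖Complex.exp (θ * Complex.I)‖ ^ p := by
    rw [norm_mul, Complex.norm_exp_ofReal_mul_I, mul_one, ← norm_pow, exp_half_sq, norm_pow]
  rcases lt_trichotomy θ.im 0 with h0 | h0 | h0
  · exact absurd hn (eigenvalue_norm_ne_of_one_lt hp hα
      (by rw [norm_exp_mul_I, Real.one_lt_exp_iff]; linarith) hs hm)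
  · exact h0
  · have hz : ‖Complex.exp (θ * Complex.I)‖ < 1 := by
      rw [norm_exp_mul_I, Real.exp_lt_one_iff]; linarith
    have h1 := eigenvalue_gap_abs hp hα hz.le hs hm
    rw [hn, sub_self, abs_zero] at h1
    have h2 : 0 < ‖Complex.exp (θ * Complex.I)‖ ^ p := pow_pos (by simp) p
    nlinarith

/-- Quantitative version: off the real axis the discriminant keeps a distance from a point
`2 cos η` of `[-2, 2]` that is linear in the height for an interior point and quadratic for an
end point. -/
lemma discrC_lower_bound {p : ℕ} (hp : 0 < p) (hα : ∀ n, ‖α n‖ < 1) (η : ℝ) {θ : ℂ}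
    (h0 : 0 < θ.im) (h1 : θ.im ≤ 1) :
    θ.im / 6 * max |Real.sin η| (θ.im / 6) ≤
      ‖discrC α p θ - 2 * Complex.cos η‖ * (‖discrC α p θ‖ + 1) := by
  set z := Complex.exp (θ * Complex.I)
  set w := Complex.exp ((p : ℂ) * θ / 2 * Complex.I)
  have hw0 : w ≠ 0 := Complex.exp_ne_zero _
  have hz : ‖z‖ = Real.exp (-θ.im) := norm_exp_mul_I θ
  have hz0 : 0 < ‖z‖ := by rw [hz]; exact Real.exp_pos _
  have hd : θ.im / 2 ≤ 1 - ‖z‖ := by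
    have h2 := Real.add_one_le_exp θ.im
    rw [hz, Real.exp_neg]
    have : (Real.exp θ.im)⁻¹ ≤ (θ.im + 1)⁻¹ := by gcongr
    have h3 : (θ.im + 1)⁻¹ ≤ 1 - θ.im / 2 := by
      rw [inv_le_iff_one_le_mul₀ (by linarith)]
      nlinarith
    linarith
  have hz1 : ‖z‖ ≤ 1 := by linarith
  set u := eigPlus α p z
  set v := eigMinus α p z
  have hs : u + v = _ := eigPlus_add_eigMinus α p z
  have hm : u * v = z ^ p := eigPlus_mul_eigMinus hα p z
  have hle : ‖v‖ ≤ ‖u‖ := norm_eigMinus_le α p z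
  have hu := le_norm_sq_eigenvalue hp hα hz1 hs hm hle
  rw [← discrC_mul] at hs
  have hw2 : w ^ 2 = z ^ p := exp_half_sq p θ
  have hu0 : u ≠ 0 := by
    intro h
    rw [h, zero_mul, ← hw2] at hm
    exact pow_ne_zero 2 hw0 hm.symm
  set G := u / w with hG
  have hG0 : G ≠ 0 := div_ne_zero hu0 hw0
  have hGinv : v / w = G⁻¹ := by
    rw [hG, inv_div, div_eq_div_iff hw0 hu0]
    linear_combination hm - hw2
  have hsum : G + G⁻¹ = discrC α p θ := by
    rw [← hGinv, hG, ← add_div, hs, mul_div_cancel_left₀ _ hw0]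
  have hGn : 1 + (1 - ‖z‖) ≤ ‖G‖ ^ 2 := by
    rw [hG, norm_div, div_pow, ← norm_pow w, hw2, norm_pow, le_div_iff₀ (by positivity)]
    linarith
  have hG1 : 1 + θ.im / 6 ≤ ‖G‖ := by
    have : (1 + θ.im / 6) ^ 2 ≤ ‖G‖ ^ 2 := by nlinarith
    exact le_of_sq_le_sq this (norm_nonneg _)
  set E := Complex.exp (η * Complex.I)
  set E' := Complex.exp (-η * Complex.I)
  have hE : ‖E‖ = 1 := Complex.norm_exp_ofReal_mul_I η
  have hE' : ‖E'‖ = 1 := by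
    have := Complex.norm_exp_ofReal_mul_I (-η)
    push_cast at this
    exact this
  have hEE : E * E' = 1 := by
    rw [← Complex.exp_add]; simp
  have hcos : 2 * Complex.cos η = E + E' := Complex.two_cos _
  have hprod : (discrC α p θ - 2 * Complex.cos η) * G = (G - E) * (G - E') := by
    rw [hcos, ← hsum]
    have := mul_inv_cancel₀ hG0
    linear_combination this - hEE
  have ha : θ.im / 6 ≤ ‖G - E‖ := by
    have := norm_sub_norm_le G E
    linarith
  have hb : θ.im / 6 ≤ ‖G - E'‖ := by
    have := norm_sub_norm_le G E'
    linarith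
  have hab : 2 * |Real.sin η| ≤ ‖G - E‖ + ‖G - E'‖ := by
    have h3 : ‖E - E'‖ = 2 * |Real.sin η| := by
      have h4 : E - E' = 2 * Complex.I * (Real.sin η : ℂ) := by
        have := Complex.two_sin (η : ℂ)
        rw [Complex.ofReal_sin]
        linear_combination (-Complex.I) * this + (E - E') * Complex.I_sq
      rw [h4, norm_mul, norm_mul, Complex.norm_real]
      simp
    rw [← h3, show E - E' = (G - E') - (G - E) by ring]
    exact (norm_sub_le _ _).trans_eq (add_comm _ _)
  have hmax : θ.im / 6 * max |Real.sin η| (θ.im / 6) ≤ ‖G - E‖ * ‖G - E'‖ := by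
    have hpos : 0 < θ.im / 6 := by positivity
    rcases le_total ‖G - E‖ ‖G - E'‖ with h | h
    · exact mul_le_mul ha (max_le (by linarith) hb) (by positivity) (by positivity)
    · rw [mul_comm ‖G - E‖]
      exact mul_le_mul hb (max_le (by linarith) ha) (by positivity) (by positivity)
  refine hmax.trans ?_
  rw [← norm_mul, ← hprod, norm_mul]
  gcongr
  have h5 : G = discrC α p θ - G⁻¹ := by rw [← hsum]; ring
  calc ‖G‖ = ‖discrC α p θ - G⁻¹‖ := by rw [← h5]
    _ ≤ ‖discrC α p θ‖ + ‖G⁻¹‖ := norm_sub_le _ _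
    _ ≤ ‖discrC α p θ‖ + 1 := by
      gcongr
      rw [norm_inv]
      exact inv_le_one_of_one_le₀ (by linarith)

lemma deriv_discrC_ne_zero {p : ℕ} (hp : 0 < p) (hα : ∀ n, ‖α n‖ < 1) {θ : ℝ}
    (h : |discrR α p θ| < 2) : deriv (discrC α p) θ ≠ 0 := by
  intro hd
  obtain ⟨h1, h2⟩ := abs_lt.1 h
  set η := Real.arccos (discrR α p θ / 2) with hη
  have hcos : 2 * Complex.cos η = discrC α p θ := by
    rw [discrC_ofReal', ← Complex.ofReal_cos, hη, Real.cos_arccos (by linarith) (by linarith)]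
    push_cast
    ring
  have hsin : 0 < Real.sin η :=
    Real.sin_pos_of_pos_of_lt_pi (Real.arccos_pos.2 (by linarith))
      (lt_of_le_of_ne (Real.arccos_le_pi _) fun h => by
        have := Real.cos_arccos (x := discrR α p θ / 2) (by linarith) (by linarith)
        rw [← hη, h, Real.cos_pi] at this
        linarith)
  have hD := ((differentiable_discrC α p) (θ : ℂ)).hasDerivAt
  rw [hd] at hD
  have hlittle := hD.isLittleO
  simp only [smul_zero, sub_zero] at hlittle
  have hc : 0 < Real.sin η / 48 := by positivity
  have ev1 := hlittle.def hc
  have ev2 : ∀ᶠ x in 𝓝 (θ : ℂ), ‖discrC α p x‖ < 3 := by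
    refine ((differentiable_discrC α p).continuous.norm.continuousAt).eventually_lt_const ?_
    simp only [discrC_ofReal', Complex.norm_real, Real.norm_eq_abs]
    linarith
  have hlim : Tendsto (fun t : ℝ => (θ : ℂ) + t * Complex.I) (𝓝[>] 0) (𝓝 (θ : ℂ)) := by
    have hcont : Continuous fun t : ℝ => (θ : ℂ) + t * Complex.I := by fun_prop
    have := hcont.tendsto 0
    simp only [Complex.ofReal_zero, zero_mul, add_zero] at this
    exact this.mono_left nhdsWithin_le_nhds
  have ev3 : ∀ᶠ t : ℝ in 𝓝[>] 0, t < 1 := nhdsWithin_le_nhds (gt_mem_nhds one_pos)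
  obtain ⟨t, ⟨h3, h4⟩, h5, h6⟩ :=
    ((hlim.eventually (ev1.and ev2)).and (ev3.and self_mem_nhdsWithin)).exists
  have him : ((θ : ℂ) + t * Complex.I).im = t := by simp
  have h6' : 0 < t := h6
  have h7 := discrC_lower_bound hp hα η (θ := (θ : ℂ) + t * Complex.I)
    (by rw [him]; exact h6') (by rw [him]; exact h5.le)
  rw [him, hcos] at h7
  have h8 : ‖(θ : ℂ) + t * Complex.I - θ‖ = t := by
    simp [abs_of_pos h6']
  rw [h8] at h3
  have h9 : t / 6 * Real.sin η ≤ t / 6 * max |Real.sin η| (t / 6) := by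
    gcongr
    exact (le_abs_self _).trans (le_max_left _ _)
  have h10 : ‖discrC α p (θ + t * Complex.I) - discrC α p θ‖ *
      (‖discrC α p (θ + t * Complex.I)‖ + 1) ≤ Real.sin η / 48 * t * 4 := by
    gcongr
    linarith
  have : 0 < t * Real.sin η := by positivity
  linarith

/-! ### Bands -/

lemma deriv_discrR_ne_zero {p : ℕ} (hp : 0 < p) (hα : ∀ n, ‖α n‖ < 1) {θ : ℝ}
    (h : |discrR α p θ| < 2) : (deriv (discrC α p) θ).re ≠ 0 := by
  intro h0
  have := deriv_discrC_ofReal α p θ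
  rw [h0, Complex.ofReal_zero] at this
  exact deriv_discrC_ne_zero hp hα h this

lemma discrR_ne_of_lt {p : ℕ} (hp : 0 < p) (hα : ∀ n, ‖α n‖ < 1) {x y : ℝ} (hxy : x < y)
    (h : ∀ θ ∈ Set.Ioo x y, |discrR α p θ| < 2) : discrR α p x ≠ discrR α p y := by
  intro he
  obtain ⟨c, hc, h0⟩ := exists_hasDerivAt_eq_zero hxy (continuous_discrR α p).continuousOn he
    fun θ _ => hasDerivAt_discrR α p θ
  exact deriv_discrR_ne_zero hp hα (h c hc) h0

lemma isBand_iff {p : ℕ} {x y : ℝ} : IsBand α p x y ↔ x < y ∧ |discrR α p x| = 2 ∧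
    |discrR α p y| = 2 ∧ ∀ θ ∈ Set.Ioo x y, |discrR α p θ| < 2 := by
  simp only [IsBand, norm_discr]

lemma abs_discrR_add_two_pi (α : ℕ → ℂ) (p : ℕ) (θ : ℝ) (k : ℤ) :
    |discrR α p (θ + k * (2 * Real.pi))| = |discrR α p θ| := by
  rw [← norm_discr, ← norm_discr, discr, discr, norm_mul, norm_mul]
  congr 1
  · rw [Complex.norm_exp, Complex.norm_exp]
    simp
  · have : Complex.exp ((θ + k * (2 * Real.pi) : ℝ) * Complex.I) = Complex.exp (θ * Complex.I) := by
      rw [Complex.exp_eq_exp_iff_exists_int]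
      exact ⟨k, by push_cast; ring⟩
    rw [this]

lemma IsBand.add_two_pi {p : ℕ} {x y : ℝ} (h : IsBand α p x y) (k : ℤ) :
    IsBand α p (x + k * (2 * Real.pi)) (y + k * (2 * Real.pi)) := by
  rw [isBand_iff] at *
  obtain ⟨h0, h1, h2, h3⟩ := h
  refine ⟨by linarith, by rwa [abs_discrR_add_two_pi], by rwa [abs_discrR_add_two_pi], ?_⟩
  intro θ hθ
  have := h3 (θ - k * (2 * Real.pi)) ⟨by linarith [hθ.1], by linarith [hθ.2]⟩
  rw [← abs_discrR_add_two_pi α p _ k] at this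
  simpa using this

lemma IsBand.eq_of_mem {p : ℕ} {x y x' y' t : ℝ} (h : IsBand α p x y) (h' : IsBand α p x' y')
    (ht : t ∈ Set.Icc x y) (ht' : t ∈ Set.Ioo x' y') : x = x' ∧ y = y' := by
  rw [isBand_iff] at *
  obtain ⟨_, h1, h2, h3⟩ := h
  obtain ⟨_, h1', h2', h3'⟩ := h'
  have h4 := h3' t ht'
  have hx : x < t := lt_of_le_of_ne ht.1 fun e => by rw [← e, h1] at h4; exact lt_irrefl _ h4
  have hy : t < y := lt_of_le_of_ne ht.2 fun e => by rw [e, h2] at h4; exact lt_irrefl _ h4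
  constructor
  · rcases lt_trichotomy x x' with h | h | h
    · exact absurd h1' (h3 x' ⟨h, by linarith [ht'.1]⟩).ne
    · exact h
    · exact absurd h1 (h3' x ⟨h, by linarith [ht'.2]⟩).ne
  · rcases lt_trichotomy y y' with h | h | h
    · exact absurd h2 (h3' y ⟨by linarith [ht'.1], h⟩).ne
    · exact h
    · exact absurd h2' (h3 y' ⟨by linarith [ht'.2], h⟩).ne

lemma IsBand.sub_le {p : ℕ} {x y : ℝ} (h : IsBand α p x y) : y - x ≤ 2 * Real.pi := by
  rw [isBand_iff] at h
  obtain ⟨_, h1, _, h3⟩ := h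
  by_contra! hc
  have h4 := h3 (x + (1 : ℤ) * (2 * Real.pi))
    ⟨by push_cast; linarith [Real.pi_pos], by push_cast; linarith⟩
  rw [abs_discrR_add_two_pi, h1] at h4
  exact lt_irrefl _ h4

lemma IsBand.discrR_eq_neg {p : ℕ} (hp : 0 < p) (hα : ∀ n, ‖α n‖ < 1) {x y : ℝ}
    (h : IsBand α p x y) : discrR α p y = -discrR α p x := by
  rw [isBand_iff] at h
  obtain ⟨h0, h1, h2, h3⟩ := h
  have hne := discrR_ne_of_lt hp hα h0 h3
  rcases abs_eq_abs.1 (h1.trans h2.symm) with h | h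
  · exact absurd h hne
  · rw [h, neg_neg]

/-- Inside a band every value in `[-2, 2]` is taken. -/
lemma IsBand.exists_discrR_eq {p : ℕ} (hp : 0 < p) (hα : ∀ n, ‖α n‖ < 1) {x y : ℝ}
    (h : IsBand α p x y) {c : ℝ} (hc : |c| ≤ 2) : ∃ θ ∈ Set.Icc x y, discrR α p θ = c := by
  have hneg := h.discrR_eq_neg hp hα
  rw [isBand_iff] at h
  obtain ⟨h0, h1, h2, h3⟩ := h
  have hcont : ContinuousOn (discrR α p) (Set.uIcc x y) := (continuous_discrR α p).continuousOn
  have hmem : c ∈ Set.uIcc (discrR α p x) (discrR α p y) := by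
    rw [hneg]
    obtain ⟨h4, h5⟩ := abs_le.1 hc
    rcases abs_eq (by norm_num : (0 : ℝ) ≤ 2) |>.1 h1 with h | h <;> rw [h]
    · rw [Set.uIcc_of_ge (by norm_num)]; exact ⟨h4, h5⟩
    · rw [Set.uIcc_of_le (by norm_num)]; exact ⟨h4, by linarith⟩
  obtain ⟨θ, hθ, he⟩ := intermediate_value_uIcc hcont hmem
  rw [Set.uIcc_of_le h0.le] at hθ
  exact ⟨θ, hθ, he⟩

lemma IsBand.exists_zero {p : ℕ} (hp : 0 < p) (hα : ∀ n, ‖α n‖ < 1) {x y : ℝ}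
    (h : IsBand α p x y) : ∃ θ ∈ Set.Ioo x y, discrR α p θ = 0 := by
  obtain ⟨θ, hθ, he⟩ := h.exists_discrR_eq hp hα (c := 0) (by simp)
  rw [isBand_iff] at h
  refine ⟨θ, ⟨lt_of_le_of_ne hθ.1 fun e => ?_, lt_of_le_of_ne hθ.2 fun e => ?_⟩, he⟩
  · have := h.2.1
    rw [e, he] at this
    norm_num at this
  · have := h.2.2.1
    rw [← e, he] at this
    norm_num at this

lemma IsBand.zero_unique {p : ℕ} (hp : 0 < p) (hα : ∀ n, ‖α n‖ < 1) {x y s t : ℝ}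
    (h : IsBand α p x y) (hs : s ∈ Set.Ioo x y) (ht : t ∈ Set.Ioo x y)
    (hs0 : discrR α p s = 0) (ht0 : discrR α p t = 0) : s = t := by
  rw [isBand_iff] at h
  rcases lt_trichotomy s t with hst | hst | hst
  · exact absurd (hs0.trans ht0.symm) (discrR_ne_of_lt hp hα hst fun θ hθ =>
      h.2.2.2 θ ⟨hs.1.trans hθ.1, hθ.2.trans ht.2⟩)
  · exact hst
  · exact absurd (ht0.trans hs0.symm) (discrR_ne_of_lt hp hα hst fun θ hθ =>
      h.2.2.2 θ ⟨ht.1.trans hθ.1, hθ.2.trans hs.2⟩)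

lemma exists_two_le_abs_discrR {p : ℕ} (hp : 0 < p) (hα : ∀ n, ‖α n‖ < 1) :
    ∃ t : ℝ, 2 ≤ |discrR α p t| := by
  by_contra! h
  refine discrR_ne_of_lt hp hα (x := 0) (y := 4 * Real.pi) (by positivity) (fun θ _ => h θ) ?_
  have e : discrC α p ((4 * Real.pi : ℝ) : ℂ) = discrC α p ((0 : ℝ) : ℂ) := by
    rw [discrC, discrC]
    congr 1
    · rw [Complex.exp_eq_exp_iff_exists_int]
      exact ⟨-p, by push_cast; ring⟩
    · congr 1
      rw [Complex.exp_eq_exp_iff_exists_int]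
      exact ⟨2, by push_cast; ring⟩
  rw [discrC_ofReal', discrC_ofReal'] at e
  exact_mod_cast e.symm

lemma exists_isBand {p : ℕ} (hp : 0 < p) (hα : ∀ n, ‖α n‖ < 1) {θ : ℝ}
    (h : |discrR α p θ| < 2) : ∃ x y : ℝ, IsBand α p x y ∧ θ ∈ Set.Ioo x y := by
  have hcont : Continuous fun t => |discrR α p t| := (continuous_discrR α p).abs
  obtain ⟨t₀, ht₀⟩ := exists_two_le_abs_discrR hp hα
  have hclosed : IsClosed {t | 2 ≤ |discrR α p t|} := isClosed_le continuous_const hcont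
  have hpi := Real.two_pi_pos
  -- the first point to the right and to the left of `θ` where the discriminant leaves `(-2, 2)`
  obtain ⟨y, ⟨hy1, hy2⟩, hy3⟩ : ∃ y, (θ ≤ y ∧ 2 ≤ |discrR α p y|) ∧
      ∀ t, θ ≤ t → 2 ≤ |discrR α p t| → y ≤ t := by
    set S := {t | θ ≤ t ∧ 2 ≤ |discrR α p t|}
    have hne : S.Nonempty := by
      obtain ⟨k, hk⟩ := exists_nat_gt ((θ - t₀) / (2 * Real.pi))
      rw [div_lt_iff₀ hpi] at hk
      refine ⟨t₀ + (k : ℤ) * (2 * Real.pi), ?_, ?_⟩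
      · push_cast; linarith
      · rwa [abs_discrR_add_two_pi]
    have hbdd : BddBelow S := ⟨θ, fun t ht => ht.1⟩
    exact ⟨sInf S, (isClosed_Ici.inter hclosed).csInf_mem hne hbdd,
      fun t h1 h2 => csInf_le hbdd ⟨h1, h2⟩⟩
  obtain ⟨x, ⟨hx1, hx2⟩, hx3⟩ : ∃ x, (x ≤ θ ∧ 2 ≤ |discrR α p x|) ∧
      ∀ t, t ≤ θ → 2 ≤ |discrR α p t| → t ≤ x := by
    set S := {t | t ≤ θ ∧ 2 ≤ |discrR α p t|}
    have hne : S.Nonempty := by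
      obtain ⟨k, hk⟩ := exists_nat_gt ((t₀ - θ) / (2 * Real.pi))
      rw [div_lt_iff₀ hpi] at hk
      refine ⟨t₀ + (-(k : ℤ) : ℤ) * (2 * Real.pi), ?_, ?_⟩
      · push_cast; linarith
      · rwa [abs_discrR_add_two_pi]
    have hbdd : BddAbove S := ⟨θ, fun t ht => ht.1⟩
    exact ⟨sSup S, (isClosed_Iic.inter hclosed).csSup_mem hne hbdd,
      fun t h1 h2 => le_csSup hbdd ⟨h1, h2⟩⟩
  have hxθ : x < θ := lt_of_le_of_ne hx1 fun e => by rw [e] at hx2; linarith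
  have hyθ : θ < y := lt_of_le_of_ne hy1 fun e => by rw [← e] at hy2; linarith
  have hin : ∀ t ∈ Set.Ioo x y, |discrR α p t| < 2 := by
    intro t ht
    by_contra! hc
    rcases le_total t θ with h1 | h1
    · linarith [hx3 t h1 hc, ht.1]
    · linarith [hy3 t h1 hc, ht.2]
  have hcl : ∀ t ∈ Set.Icc x y, |discrR α p t| ≤ 2 := by
    have hsub : closure (Set.Ioo x y) ⊆ {t | |discrR α p t| ≤ 2} :=
      closure_minimal (fun t ht => (hin t ht).le) (isClosed_le hcont continuous_const)
    rw [closure_Ioo (by linarith : x < y).ne] at hsub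
    exact hsub
  refine ⟨x, y, isBand_iff.2 ⟨by linarith, ?_, ?_, hin⟩, hxθ, hyθ⟩
  · exact le_antisymm (hcl x ⟨le_rfl, by linarith⟩) hx2
  · exact le_antisymm (hcl y ⟨by linarith, le_rfl⟩) hy2

lemma discrC_eq_zero_iff {p : ℕ} {θ : ℂ} :
    discrC α p θ = 0 ↔ (tracePoly α p).eval (Complex.exp (θ * Complex.I)) = 0 := by
  simp [discrC]

lemma exists_angle_of_trace_root {p : ℕ} (hp : 0 < p) (hα : ∀ n, ‖α n‖ < 1) {z : ℂ}
    (hz : (tracePoly α p).eval z = 0) :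
    ∃ θ : ℝ, z = Complex.exp (θ * Complex.I) ∧ discrR α p θ = 0 := by
  have hz0 : z ≠ 0 := by
    rintro rfl
    rw [← coeff_zero_eq_eval_zero, coeff_tracePoly_zero α hp] at hz
    exact (leadingConst_pos hα p).ne' (by exact_mod_cast hz)
  set θ := -Complex.I * Complex.log z with hθ
  have he : Complex.exp (θ * Complex.I) = z := by
    rw [hθ, show -Complex.I * Complex.log z * Complex.I = Complex.log z by
      linear_combination (-Complex.log z) * Complex.I_sq, Complex.exp_log hz0]
  have h0 : discrC α p θ = 0 := discrC_eq_zero_iff.2 (by rwa [he])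
  have him := im_eq_zero_of_discrC hp hα (θ := θ) (η := Real.pi / 2) (by
    rw [h0, ← Complex.ofReal_cos, Real.cos_pi_div_two]; simp)
  have hre : θ = (θ.re : ℂ) := Complex.ext (by simp) (by simp [him])
  rw [hre] at he h0
  refine ⟨θ.re, he.symm, ?_⟩
  rw [discrC_ofReal'] at h0
  exact_mod_cast h0

lemma card_trace_roots {p : ℕ} (hp : 0 < p) (hα : ∀ n, ‖α n‖ < 1) :
    (tracePoly α p).roots.toFinset.card = p := by
  have hne : tracePoly α p ≠ 0 := by
    intro h
    have := natDegree_tracePoly hα hp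
    rw [h, natDegree_zero] at this
    omega
  have hnd : (tracePoly α p).roots.Nodup := by
    rw [Multiset.nodup_iff_count_le_one]
    intro z
    by_contra! h
    rw [count_roots, one_lt_rootMultiplicity_iff_isRoot hne] at h
    obtain ⟨h1, h2⟩ := h
    obtain ⟨θ, rfl, h0⟩ := exists_angle_of_trace_root hp hα h1
    refine deriv_discrC_ne_zero hp hα (θ := θ) (by rw [h0]; norm_num) ?_
    have hE : HasDerivAt (fun θ : ℂ => Complex.exp (θ * Complex.I))
        (Complex.exp (θ * Complex.I) * Complex.I) (θ : ℂ) := by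
      simpa using ((hasDerivAt_id (θ : ℂ)).mul_const Complex.I).cexp
    have hτ := ((tracePoly α p).hasDerivAt (Complex.exp (θ * Complex.I))).comp (θ : ℂ) hE
    have hw : DifferentiableAt ℂ
      (fun θ : ℂ => Complex.exp (-((p : ℂ) * θ / 2) * Complex.I)) (θ : ℂ) := by fun_prop
    have := (hw.hasDerivAt.mul hτ).deriv
    rw [show discrC α p = (fun θ : ℂ => Complex.exp (-((p : ℂ) * θ / 2) * Complex.I)) *
      ((fun x => eval x (tracePoly α p)) ∘ fun θ : ℂ => Complex.exp (θ * Complex.I)) from rfl,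
      this]
    rw [IsRoot.def] at h1 h2
    simp [h1, h2]
  rw [Multiset.toFinset_card_of_nodup hnd, ← (IsAlgClosed.splits _).natDegree_eq_card_roots,
    natDegree_tracePoly hα hp]

/-! ### Solving the zero equation by contraction -/

/-- `((A log m + B) / m)² m → 0`, in the form needed below. -/
lemma exists_log_sq_le {A B : ℝ} (hA : 0 ≤ A) (hB : 0 ≤ B) {ε : ℝ} (hε : 0 < ε) :
    ∃ m₀ : ℕ, 3 ≤ m₀ ∧ ∀ m : ℕ, m₀ ≤ m → ((A * Real.log m + B) / m) ^ 2 * m ≤ ε := by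
  have h := (Real.isLittleO_pow_log_id_atTop (n := 2)).def
    (c := ε / (A + B + 1) ^ 2) (by positivity)
  have h' := tendsto_natCast_atTop_atTop.eventually h
  obtain ⟨m₀, hm₀⟩ := eventually_atTop.1 h'
  refine ⟨max m₀ 3, le_max_right _ _, fun m hm => ?_⟩
  have hm3 : (3 : ℝ) ≤ m := by exact_mod_cast (le_max_right m₀ 3).trans hm
  have h1 := hm₀ m ((le_max_left _ _).trans hm)
  have hlog : 1 ≤ Real.log m := by
    rw [Real.le_log_iff_exp_le (by linarith)]
    exact (Real.exp_one_lt_d9.le.trans (by norm_num)).trans hm3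
  rw [Real.norm_of_nonneg (by positivity), id, Real.norm_of_nonneg (by positivity),
    div_mul_eq_mul_div, le_div_iff₀ (by positivity)] at h1
  have h2 : A * Real.log m + B ≤ (A + B + 1) * Real.log m := by nlinarith
  have h3 : (A * Real.log m + B) ^ 2 ≤ ((A + B + 1) * Real.log m) ^ 2 := by
    gcongr
  rw [div_pow, div_mul_eq_mul_div, div_le_iff₀ (by positivity)]
  calc (A * Real.log m + B) ^ 2 * m ≤ ((A + B + 1) * Real.log m) ^ 2 * m := by gcongr
    _ = Real.log m ^ 2 * (A + B + 1) ^ 2 * m := by ring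
    _ ≤ ε * m * m := by gcongr
    _ = ε * m ^ 2 := by ring

/-- Fixed points of `ζ ↦ t + (iκ log ζ + g(ζ)) / m`. For each `t ≥ K / m` the map is a contraction
of a rectangle around `t` with width of order `1 / m` and height of order `log m / m`: its
derivative is controlled by `1 / (m |ζ|)`, hence small for `K` large. -/
lemma exists_perturbed_point (κ : ℝ) {g : ℂ → ℂ} (hg : AnalyticAt ℂ g 0) :
    ∃ δ > 0, ∃ K > 0, ∃ C > 0, 8 * C ≤ K ∧ ∃ m₀ : ℕ, ∀ m : ℕ, m₀ ≤ m → ∀ t : ℝ,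
      K / m ≤ t → t ≤ δ → ∃ ζ : ℂ, m * (ζ - t) = Complex.I * κ * Complex.log ζ + g ζ ∧
        |ζ.re - t| ≤ K / (2 * m) ∧ |ζ.im| ≤ (|κ| * Real.log m + C) / m := by
  obtain ⟨r, hr, C, hC, hr1, hball⟩ : ∃ r > 0, ∃ C > 0, r ≤ 1 ∧ ∀ ζ : ℂ, ‖ζ‖ < r →
      DifferentiableAt ℂ g ζ ∧ ‖g ζ‖ ≤ C ∧ ‖deriv g ζ‖ ≤ C := by
    set C := max ‖g 0‖ ‖deriv g 0‖ + 1 with hC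
    have e1 : ∀ᶠ ζ in 𝓝 (0 : ℂ), ‖g ζ‖ < C :=
      hg.continuousAt.norm.eventually_lt_const
        (lt_of_le_of_lt (le_max_left _ _) (lt_add_one _))
    have e2 : ∀ᶠ ζ in 𝓝 (0 : ℂ), ‖deriv g ζ‖ < C :=
      hg.deriv.continuousAt.norm.eventually_lt_const
        (lt_of_le_of_lt (le_max_right _ _) (lt_add_one _))
    obtain ⟨r, hr, h⟩ := Metric.eventually_nhds_iff.1 ((hg.eventually_analyticAt.and e1).and e2)
    refine ⟨min r 1, by positivity, C, by positivity, min_le_right _ _, fun ζ hζ => ?_⟩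
    obtain ⟨⟨h1, h2⟩, h3⟩ := h (y := ζ) (by simpa using hζ.trans_le (min_le_left _ _))
    exact ⟨h1.differentiableAt, h2.le, h3.le⟩
  set K := 8 * |κ| + 8 * C + 2 with hK
  have hκ := abs_nonneg κ
  have hK0 : 0 < K := by positivity
  obtain ⟨m₁, hm₁3, hm₁⟩ := exists_log_sq_le hκ hC.le (ε := (r / 8) ^ 2) (by positivity)
  obtain ⟨m₂, hm₂⟩ := exists_nat_gt (4 * K / r + 4 * C)
  refine ⟨r / 2, by positivity, K, hK0, C, hC, by rw [hK]; linarith, max m₁ m₂,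
    fun m hm t ht1 ht2 => ?_⟩
  have hmm₁ : m₁ ≤ m := (le_max_left _ _).trans hm
  have hm3 : (3 : ℝ) ≤ m := by exact_mod_cast hm₁3.trans hmm₁
  have hm0 : (0 : ℝ) < m := by linarith
  have hmbig : 4 * K / r + 4 * C < m :=
    hm₂.trans_le (by exact_mod_cast (le_max_right m₁ m₂).trans hm)
  have hKr0 : 0 ≤ 4 * K / r := by positivity
  have hKm : K / m < r / 4 := by
    have h1 : 4 * K / r < m := by linarith
    rw [div_lt_iff₀ hr] at h1
    rw [div_lt_iff₀ hm0]
    linarith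
  set h := (|κ| * Real.log m + C) / m with hh
  have hlog0 : 0 ≤ Real.log m := Real.log_natCast_nonneg m
  have hh0 : 0 < h := by positivity
  have hhr : h ≤ r / 8 := by
    have h1 := hm₁ m hmm₁
    rw [← hh] at h1
    have h2 : h ^ 2 ≤ (r / 8) ^ 2 := by nlinarith [sq_nonneg h]
    exact le_of_sq_le_sq h2 (by positivity)
  have hK2 : K / (2 * m) = K / m / 2 := by field_simp
  set S : Set ℂ := Set.Icc (t - K / (2 * m)) (t + K / (2 * m)) ×ℂ Set.Icc (-h) h with hS
  have hSconv : Convex ℝ S := by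
    have h1 := (convex_Icc (t - K / (2 * m)) (t + K / (2 * m))).is_linear_preimage
      (f := Complex.re) Complex.reLm.isLinear
    have h2 := (convex_Icc (-h) h).is_linear_preimage (f := Complex.im) Complex.imLm.isLinear
    exact h1.inter h2
  have hSclosed : IsClosed S := isClosed_Icc.reProdIm isClosed_Icc
  have hSmem : ∀ ζ ∈ S, K / (2 * m) ≤ ζ.re ∧ |ζ.re - t| ≤ K / (2 * m) ∧ |ζ.im| ≤ h ∧ ‖ζ‖ < r := by
    intro ζ hζ
    obtain ⟨⟨h1, h2⟩, h3, h4⟩ := hζ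
    refine ⟨by rw [hK2] at *; linarith, abs_le.2 ⟨by linarith, by linarith⟩, abs_le.2 ⟨h3, h4⟩, ?_⟩
    have h5 := Complex.norm_le_abs_re_add_abs_im ζ
    have h6 : |ζ.im| ≤ h := abs_le.2 ⟨h3, h4⟩
    have h7 : |ζ.re| ≤ t + K / (2 * m) := abs_le.2 ⟨by rw [hK2] at *; linarith, h2⟩
    rw [hK2] at h7
    linarith
  have hre : ∀ ζ ∈ S, 0 < ζ.re := fun ζ hζ => lt_of_lt_of_le (by positivity) (hSmem ζ hζ).1
  set F : ℂ → ℂ := fun ζ => t + (Complex.I * κ * Complex.log ζ + g ζ) / m with hF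
  have hmaps : Set.MapsTo F S S := by
    intro ζ hζ
    obtain ⟨h1, h2, h3, h4⟩ := hSmem ζ hζ
    have hg1 := (hball ζ h4).2.1
    have hFre : (F ζ).re = t + (-(κ * Complex.arg ζ) + (g ζ).re) / m := by
      simp [hF, Complex.add_re, Complex.mul_re, Complex.mul_im, Complex.log_im, Complex.div_natCast_re]
    have hFim : (F ζ).im = (κ * Real.log ‖ζ‖ + (g ζ).im) / m := by
      simp [hF, Complex.add_im, Complex.mul_re, Complex.mul_im, Complex.log_re, Complex.div_natCast_im]
    have harg : |Complex.arg ζ| ≤ 2 :=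
      (Complex.abs_arg_le_pi_div_two_iff.2 (hre ζ hζ).le).trans (by linarith [Real.pi_le_four])
    have hnorm : 1 / (m : ℝ) ≤ ‖ζ‖ := by
      refine le_trans ?_ (h1.trans (Complex.re_le_norm ζ))
      rw [div_le_div_iff₀ hm0 (by positivity)]
      have : 2 ≤ K := by rw [hK]; linarith
      nlinarith
    have hlog : |Real.log ‖ζ‖| ≤ Real.log m := by
      have h5 : 0 < ‖ζ‖ := lt_of_lt_of_le (by positivity) hnorm
      rw [abs_le]
      constructor
      · rw [← Real.log_inv, ← one_div]
        exact Real.log_le_log (by positivity) hnorm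
      · exact (Real.log_nonpos h5.le (by linarith)).trans hlog0
    have b1 : |-(κ * Complex.arg ζ) + (g ζ).re| ≤ K / 2 := by
      calc _ ≤ |-(κ * Complex.arg ζ)| + |(g ζ).re| := abs_add_le _ _
        _ ≤ |κ| * 2 + C := by
          rw [abs_neg, abs_mul]
          gcongr
          exact (Complex.abs_re_le_norm _).trans hg1
        _ ≤ K / 2 := by rw [hK]; linarith
    have b2 : |κ * Real.log ‖ζ‖ + (g ζ).im| ≤ |κ| * Real.log m + C := by
      calc _ ≤ |κ * Real.log ‖ζ‖| + |(g ζ).im| := abs_add_le _ _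
        _ ≤ _ := by
          rw [abs_mul]
          gcongr
          exact (Complex.abs_im_le_norm _).trans hg1
    have c1 : |(F ζ).re - t| ≤ K / (2 * m) := by
      rw [hFre, add_sub_cancel_left, abs_div, abs_of_pos hm0, hK2, div_right_comm]
      gcongr
    have c2 : |(F ζ).im| ≤ h := by
      rw [hFim, abs_div, abs_of_pos hm0, hh]
      gcongr
    obtain ⟨d1, d2⟩ := abs_le.1 c1
    exact ⟨⟨by linarith, by linarith⟩, abs_le.1 c2⟩
  have hder : ∀ ζ ∈ S, HasDerivWithinAt F
      ((Complex.I * κ * ζ⁻¹ + deriv g ζ) / m) S ζ := by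
    intro ζ hζ
    have h1 := (Complex.hasDerivAt_log (Or.inl (hre ζ hζ))).const_mul (Complex.I * κ)
    exact (((h1.add (hball ζ (hSmem ζ hζ).2.2.2).1.hasDerivAt).div_const _).const_add
      _).hasDerivWithinAt
  have hbound : ∀ ζ ∈ S, ‖(Complex.I * κ * ζ⁻¹ + deriv g ζ) / m‖₊ ≤ (1 / 2 : NNReal) := by
    intro ζ hζ
    obtain ⟨h1, h2, h3, h4⟩ := hSmem ζ hζ
    rw [← NNReal.coe_le_coe, coe_nnnorm, norm_div, Complex.norm_natCast]
    push_cast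
    rw [div_le_iff₀ hm0]
    have h5 : ‖ζ‖⁻¹ ≤ (K / (2 * m))⁻¹ := by
      have := h1.trans (Complex.re_le_norm ζ)
      gcongr
    have h6 : |κ| * (K / (2 * m))⁻¹ ≤ m / 4 := by
      rw [inv_div, mul_div_assoc', div_le_iff₀ hK0, hK]
      nlinarith
    calc ‖Complex.I * κ * ζ⁻¹ + deriv g ζ‖ ≤ ‖Complex.I * κ * ζ⁻¹‖ + ‖deriv g ζ‖ := norm_add_le _ _
      _ ≤ |κ| * (K / (2 * m))⁻¹ + C := by
        rw [norm_mul, norm_mul, Complex.norm_I, one_mul, Complex.norm_real, Real.norm_eq_abs,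
          norm_inv]
        gcongr
        exact (hball ζ h4).2.2
      _ ≤ 1 / 2 * m := by linarith
  have hlip := hSconv.lipschitzOnWith_of_nnnorm_hasDerivWithin_le hder hbound
  have hcontr : ContractingWith (1 / 2) (hmaps.restrict F S S) :=
    ⟨by rw [← NNReal.coe_lt_coe]; norm_num, hlip.mapsToRestrict hmaps⟩
  have ht : (t : ℂ) ∈ S := by
    refine ⟨⟨?_, ?_⟩, ?_, ?_⟩
    · simp; positivity
    · simp; positivity
    · simp; positivity
    · simp; positivity
  obtain ⟨ζ, hζ, hfix, -⟩ := hcontr.exists_fixedPoint' hSclosed.isComplete hmaps ht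
    (edist_ne_top _ _)
  obtain ⟨h1, h2, h3, h4⟩ := hSmem ζ hζ
  refine ⟨ζ, ?_, h2, h3⟩
  have hfix' : t + (Complex.I * κ * Complex.log ζ + g ζ) / m = ζ := hfix
  have hmC : (m : ℂ) ≠ 0 := by exact_mod_cast hm0.ne'
  rw [← eq_sub_iff_add_eq', div_eq_iff hmC] at hfix'
  rw [hfix']; ring

/-! ### Quotients of analytic germs -/

lemma exists_exp_eq {q : ℂ → ℂ} {z₀ : ℂ} (hq : AnalyticAt ℂ q z₀) (h0 : q z₀ ≠ 0) :
    ∃ g : ℂ → ℂ, AnalyticAt ℂ g z₀ ∧ ∀ᶠ z in 𝓝 z₀, q z = Complex.exp (g z) := by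
  refine ⟨fun z => Complex.log (q z / q z₀) + Complex.log (q z₀), ?_, ?_⟩
  · refine ((hq.div_const).clog ?_).add analyticAt_const
    rw [div_self h0]
    exact Complex.one_mem_slitPlane
  · filter_upwards [hq.continuousAt.eventually_ne h0] with z hz
    rw [Complex.exp_add, Complex.exp_log (div_ne_zero hz h0), Complex.exp_log h0,
      div_mul_cancel₀ _ h0]

lemma exists_quotient_eq {f h : ℂ → ℂ} (hf : AnalyticAt ℂ f 0) (hh : AnalyticAt ℂ h 0)
    (hf0 : ¬ ∀ᶠ z in 𝓝 0, f z = 0) (hh0 : ¬ ∀ᶠ z in 𝓝 0, h z = 0) :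
    ∃ κ : ℤ, ∃ g : ℂ → ℂ, AnalyticAt ℂ g 0 ∧
      ∀ᶠ z in 𝓝 0, z ≠ 0 → h z = z ^ κ * Complex.exp (g z) * f z := by
  obtain ⟨a, f₁, hf₁, hf₁0, hfe⟩ := hf.exists_eventuallyEq_pow_smul_nonzero_iff.2 hf0
  obtain ⟨b, h₁, hh₁, hh₁0, hhe⟩ := hh.exists_eventuallyEq_pow_smul_nonzero_iff.2 hh0
  obtain ⟨g, hg, hge⟩ := exists_exp_eq (hh₁.div hf₁ hf₁0) (div_ne_zero hh₁0 hf₁0)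
  refine ⟨(b : ℤ) - a, g, hg, ?_⟩
  filter_upwards [hfe, hhe, hge, hf₁.continuousAt.eventually_ne hf₁0] with z h1 h2 h3 h4 hz
  rw [← h3, h1, h2, zpow_sub₀ hz]
  simp only [sub_zero, zpow_natCast, smul_eq_mul, Pi.div_apply]
  field_simp

lemma exists_quotient_reflect_eq {f h : ℂ → ℂ} (hf : AnalyticAt ℂ f 0)
    (hf0 : ¬ ∀ᶠ z in 𝓝 0, f z = 0) (hfh : ∀ᶠ z in 𝓝 0, h z = f (-z)) :
    ∃ g : ℂ → ℂ, AnalyticAt ℂ g 0 ∧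
      ∀ᶠ z in 𝓝 0, z ≠ 0 → h z = z ^ (0 : ℤ) * Complex.exp (g z) * f z := by
  obtain ⟨a, f₁, hf₁, hf₁0, hfe⟩ := hf.exists_eventuallyEq_pow_smul_nonzero_iff.2 hf0
  have hneg : AnalyticAt ℂ (fun z : ℂ => -z) 0 := analyticAt_id.neg
  have hf₁' : AnalyticAt ℂ (fun z => f₁ (-z)) 0 :=
    AnalyticAt.comp (g := f₁) (f := fun z : ℂ => -z) (by simpa using hf₁) hneg
  obtain ⟨g, hg, hge⟩ := exists_exp_eq
    (((analyticAt_const (v := (-1 : ℂ) ^ a)).mul hf₁').div hf₁ hf₁0)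
    (div_ne_zero (mul_ne_zero (pow_ne_zero _ (by norm_num)) (by simpa using hf₁0)) hf₁0)
  refine ⟨g, hg, ?_⟩
  have hcont : Tendsto (fun z : ℂ => -z) (𝓝 0) (𝓝 0) := by
    simpa using (continuous_neg (G := ℂ)).tendsto 0
  filter_upwards [hfe, hcont.eventually hfe, hfh, hge,
    hf₁.continuousAt.eventually_ne hf₁0] with z h1 h2 h3 h4 h5 hz
  rw [← h4, h3, h2, h1]
  simp only [sub_zero, zpow_zero, smul_eq_mul, Pi.div_apply, Pi.mul_apply, one_mul]
  rw [show (-z) = (-1) * z by ring, mul_pow]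
  field_simp

/-! ### Counting zeros in a piece of a band -/

/-- The zeros `z = e^{iθ}` of `φ_n` within `n^{-1/2}` of the circle for which `Re θ` lies in the
open band `(x, y)` and the quasi-momentum `η`, defined by `Δ(θ) = 2 cos η`, has real part in
`(a, c)`. -/
def bandZeroSet (α : ℕ → ℂ) (p : ℕ) (x y : ℝ) (n : ℕ) (a c : ℝ) : Set ℂ :=
  {z | (phi α n).eval z = 0 ∧ 1 - ‖z‖ ≤ (n : ℝ) ^ (-(1 / 2) : ℝ) ∧
    ∃ θ η : ℂ, z = Complex.exp (θ * Complex.I) ∧ (x < θ.re ∧ θ.re < y) ∧ (a < η.re ∧ η.re < c) ∧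
      discrC α p θ = 2 * Complex.cos η}

lemma finite_bandZeroSet (hα : ∀ n, ‖α n‖ < 1) (p : ℕ) (x y : ℝ) (n : ℕ) (a c : ℝ) :
    (bandZeroSet α p x y n a c).Finite := by
  refine (phi α n).roots.toFinset.finite_toSet.subset fun z hz => ?_
  simp only [Finset.mem_coe, Multiset.mem_toFinset]
  exact (mem_roots (phi_ne_zero hα n)).2 hz.1

lemma angle_unique {x y : ℝ} (hxy : y - x ≤ 2 * Real.pi) {θ θ' : ℂ} (h : x < θ.re ∧ θ.re < y)
    (h' : x < θ'.re ∧ θ'.re < y)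
    (he : Complex.exp (θ * Complex.I) = Complex.exp (θ' * Complex.I)) : θ = θ' := by
  obtain ⟨n, hn⟩ := Complex.exp_eq_exp_iff_exists_int.1 he
  have h1 : θ = θ' + n * (2 * Real.pi) := by
    apply mul_right_cancel₀ Complex.I_ne_zero
    rw [hn]; ring
  have h2 := congrArg Complex.re h1
  simp at h2
  have hpi := Real.two_pi_pos
  have h3 : n = 0 := by
    have h4 : |(n : ℝ) * (2 * Real.pi)| < 1 * (2 * Real.pi) := by
      rw [abs_lt]; constructor <;> linarith
    rw [abs_mul, abs_of_pos hpi] at h4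
    have h5 := lt_of_mul_lt_mul_right h4 hpi.le
    have h6 : |n| < 1 := by exact_mod_cast h5
    exact Int.abs_lt_one_iff.1 h6
  rw [h1, h3]; simp

lemma cos_injective_of_re {η η' : ℂ} (h : 0 < η.re ∧ η.re < Real.pi)
    (h' : 0 < η'.re ∧ η'.re < Real.pi) (he : Complex.cos η = Complex.cos η') : η = η' := by
  obtain ⟨k, hk⟩ := Complex.cos_eq_cos_iff.1 he
  have hpi := Real.pi_pos
  rcases hk with hk | hk
  · have h2 := congrArg Complex.re hk
    simp at h2
    have h3 : k = 0 := by
      have h4 : |(2 * k : ℝ) * Real.pi| < 1 * Real.pi := by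
        rw [abs_lt]; constructor <;> linarith
      rw [abs_mul, abs_of_pos hpi] at h4
      have h5 := lt_of_mul_lt_mul_right h4 hpi.le
      have h6 : |2 * k| < 1 := by exact_mod_cast h5
      rw [abs_lt] at h6
      omega
    rw [hk, h3]; simp
  · exfalso
    have h2 := congrArg Complex.re hk
    simp at h2
    have h4 : 0 < (2 * k : ℝ) * Real.pi := by linarith
    have h5 : (2 * k : ℝ) * Real.pi < 2 * Real.pi := by linarith
    have h6 := lt_of_mul_lt_mul_right h5 hpi.le
    have h7 := pos_of_mul_pos_left h4 hpi.le
    have h8 : 2 * k < 2 := by exact_mod_cast h6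
    have h9 : 0 < 2 * k := by exact_mod_cast h7
    omega

lemma sin_ne_zero_of_re {η : ℂ} (h : 0 < η.re ∧ η.re < Real.pi) : Complex.sin η ≠ 0 := by
  rw [Ne, Complex.sin_eq_zero_iff]
  rintro ⟨k, rfl⟩
  simp at h
  have hpi := Real.pi_pos
  have h4 : (k : ℝ) * Real.pi < 1 * Real.pi := by linarith
  have h6 := lt_of_mul_lt_mul_right h4 hpi.le
  have h7 := pos_of_mul_pos_left h.1 hpi.le
  have h8 : k < 1 := by exact_mod_cast h6
  have h9 : 0 < k := by exact_mod_cast h7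
  omega

/-- A polynomial does not vanish identically along a chart of the discriminant. -/
lemma not_eventually_eval_eq_zero {p : ℕ} {η₀ ε : ℝ} (hε : ε = 1 ∨ ε = -1) {θ : ℂ → ℂ}
    (hθ : AnalyticAt ℂ θ 0)
    (hD : ∀ᶠ ζ in 𝓝 (0 : ℂ), discrC α p (θ ζ) = 2 * Complex.cos (η₀ + ε * ζ))
    {f : ℂ[X]} (hf : f ≠ 0) :
    ¬ ∀ᶠ ζ in 𝓝 (0 : ℂ), f.eval (Complex.exp (θ ζ * Complex.I)) = 0 := by
  intro h
  set E : ℂ → ℂ := fun ζ => Complex.exp (θ ζ * Complex.I) with hE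
  have hEan : AnalyticAt ℂ E 0 := (hθ.mul analyticAt_const).cexp
  have hex : ∃ r : ℂ, ∀ᶠ ζ in 𝓝 (0 : ℂ), E ζ - r = 0 := by
    by_contra! hcon
    have hev : ∀ r ∈ f.roots.toFinset, ∀ᶠ ζ in 𝓝[≠] (0 : ℂ), E ζ - r ≠ 0 := fun r _ =>
      ((hEan.sub analyticAt_const).eventually_eq_zero_or_eventually_ne_zero).resolve_left
        (by simpa using hcon r)
    have hall := (f.roots.toFinset.eventually_all).2 hev
    obtain ⟨ζ, h1, h2⟩ := (hall.and (h.filter_mono nhdsWithin_le_nhds)).exists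
    have hmem : E ζ ∈ f.roots.toFinset := by
      rw [Multiset.mem_toFinset, mem_roots hf]; exact h2
    exact h1 _ hmem (sub_self _)
  obtain ⟨r, hr⟩ := hex
  have hconst : ∀ᶠ ζ in 𝓝 (0 : ℂ), (2 * Complex.cos (η₀ + ε * ζ)) ^ 2 =
      (r ^ p)⁻¹ * (tracePoly α p).eval r ^ 2 := by
    filter_upwards [hD, hr] with ζ h1 h2
    rw [sub_eq_zero] at h2
    rw [← h1, discrC, ← h2, mul_pow, hE]
    congr 1
    rw [← Complex.exp_nat_mul, ← Complex.exp_nat_mul, ← Complex.exp_neg]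
    congr 1
    push_cast
    ring
  have hentire : Differentiable ℂ fun ζ : ℂ => (2 * Complex.cos (η₀ + ε * ζ)) ^ 2 := by fun_prop
  have heq := AnalyticOnNhd.eq_of_eventuallyEq (𝕜 := ℂ)
    (fun ζ _ => hentire.analyticAt ζ) (fun ζ _ => analyticAt_const) hconst
  have hε2 : (ε : ℂ) * ε = 1 := by rcases hε with rfl | rfl <;> simp
  have e1 := congrFun heq (-(ε * η₀))
  have e2 := congrFun heq (ε * (Real.pi / 2 - η₀))
  beta_reduce at e1 e2
  rw [show (η₀ : ℂ) + ε * -(ε * η₀) = 0 by linear_combination (-(η₀ : ℂ)) * hε2,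
    Complex.cos_zero] at e1
  rw [show (η₀ : ℂ) + ε * (ε * (Real.pi / 2 - η₀)) = Real.pi / 2 by
    linear_combination (Real.pi / 2 - (η₀ : ℂ)) * hε2, Complex.cos_pi_div_two] at e2
  rw [← e1] at e2
  norm_num at e2

/-- The zero condition in terms of the quasi-momentum. -/
lemma eval_phi_eq_zero_of_quotient {p : ℕ} (hα : ∀ n, ‖α n‖ < 1) (hper : ∀ n, α (n + p) = α n)
    {θ η : ℂ} (hD : discrC α p θ = 2 * Complex.cos η) (hη : Complex.sin η ≠ 0) (m b : ℕ)
    (h : (phi α (b + p)).eval (Complex.exp (θ * Complex.I)) -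
        Complex.exp ((p : ℂ) * θ / 2 * Complex.I) * Complex.exp (η * Complex.I) *
          (phi α b).eval (Complex.exp (θ * Complex.I)) =
      Complex.exp (2 * m * η * Complex.I) *
        ((phi α (b + p)).eval (Complex.exp (θ * Complex.I)) -
          Complex.exp ((p : ℂ) * θ / 2 * Complex.I) * Complex.exp (-η * Complex.I) *
            (phi α b).eval (Complex.exp (θ * Complex.I)))) :
    (phi α (m * p + b)).eval (Complex.exp (θ * Complex.I)) = 0 := by
  obtain ⟨hs, hm⟩ := eigenvalues_of_discrC hD
  have hex := eigenvalue_expansion hα hper b hs hm m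
  rw [h] at hex
  set w := Complex.exp ((p : ℂ) * θ / 2 * Complex.I)
  have hw : w ≠ 0 := Complex.exp_ne_zero _
  have hpow : (w * Complex.exp (η * Complex.I)) ^ m =
      (w * Complex.exp (-η * Complex.I)) ^ m * Complex.exp (2 * m * η * Complex.I) := by
    rw [mul_pow, mul_pow, mul_assoc, ← Complex.exp_nat_mul (η * Complex.I),
      ← Complex.exp_nat_mul (-η * Complex.I), ← Complex.exp_add]
    congr 2
    ring
  rw [hpow, mul_assoc, sub_self] at hex
  refine (mul_eq_zero.1 hex).resolve_left ?_
  rw [← mul_sub]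
  refine mul_ne_zero hw fun h0 => hη ?_
  have := Complex.two_sin η
  have h2 : 2 * Complex.sin η = 0 := by
    rw [this, ← neg_sub, h0]; simp
  simpa using h2

/-- The fixed point equation for the chart variable, rewritten as the equation
`e^{2imη} = ζ^κ e^{g(ζ)}` at the quasi-momentum `η = η₀ + εζ`. -/
lemma exp_eq_of_fixed_point {η₀ ε t : ℝ} (hε : ε = 1 ∨ ε = -1) {m : ℕ} {k κ : ℤ}
    (ht : (m : ℝ) * t = Real.pi * k - m * ε * η₀) {ζ G : ℂ} (hζ0 : ζ ≠ 0)
    (hζ : m * (ζ - t) = Complex.I * (-ε * κ / 2 : ℝ) * Complex.log ζ + -(Complex.I * ε / 2) * G) :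
    ζ ^ κ * Complex.exp G = Complex.exp (2 * m * (η₀ + ε * ζ) * Complex.I) := by
  have hε2' : (ε : ℂ) * ε = 1 := by rcases hε with rfl | rfl <;> norm_num
  have hcast : (ζ ^ κ : ℂ) = Complex.exp (κ * Complex.log ζ) := by
    rw [Complex.exp_int_mul, Complex.exp_log hζ0]
  rw [hcast, ← Complex.exp_add, Complex.exp_eq_exp_iff_exists_int]
  obtain ⟨j, hj⟩ : ∃ j : ℤ, (j : ℂ) = -ε * k := by
    rcases hε with rfl | rfl
    · exact ⟨-k, by push_cast; ring⟩
    · exact ⟨k, by push_cast; ring⟩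
  refine ⟨j, ?_⟩
  have hmt : (m : ℂ) * t = Real.pi * k - m * ε * η₀ := by exact_mod_cast ht
  push_cast at hζ
  rw [hj]
  linear_combination (-2 * Complex.I * ε) * hζ + (-2 * Complex.I * ε) * hmt
    + (κ * Complex.log ζ + G) * Complex.I_sq
    + (Complex.I ^ 2 * (κ * Complex.log ζ + G) + 2 * Complex.I * m * η₀) * hε2'

lemma mul_le_rpow_neg_half {L h p m n : ℝ} (hL : 0 ≤ L) (hh : 0 ≤ h) (hp : 0 < p)
    (hn : 0 < n) (hn2 : n ≤ 2 * p * m) (h1 : h ^ 2 * m ≤ 1 / (2 * p * (L + 1) ^ 2)) :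
    L * h ≤ n ^ (-(1 / 2) : ℝ) := by
  rw [le_div_iff₀ (by positivity)] at h1
  rw [Real.rpow_neg hn.le, ← Real.sqrt_eq_rpow, ← Real.sqrt_inv]
  apply Real.le_sqrt_of_sq_le
  rw [← one_div, le_div_iff₀ hn]
  calc (L * h) ^ 2 * n ≤ ((L + 1) * h) ^ 2 * (2 * p * m) := by gcongr; linarith
    _ = h ^ 2 * m * (2 * p * (L + 1) ^ 2) := by ring
    _ ≤ 1 := h1

/-- A point with real part at least of order `1 / m` and small imaginary part lies in the region
`M |ζ|² < Re ζ`. -/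
lemma mul_norm_sq_lt_re {M K h m : ℝ} {ζ : ℂ} (hM : 0 < M) (hm : 0 < m)
    (h1 : h ^ 2 * m ≤ K / (8 * M)) (him : |ζ.im| ≤ h) (hre : K / m / 2 ≤ ζ.re) (hre0 : 0 < ζ.re)
    (hℓ : ζ.re ≤ 1 / (4 * M)) : M * ‖ζ‖ ^ 2 < ζ.re := by
  rw [le_div_iff₀ (by positivity)] at h1
  have h2 : M * h ^ 2 ≤ K / m / 8 := by
    rw [div_div, le_div_iff₀ (by positivity)]
    linarith
  have h3 : ‖ζ‖ ^ 2 = ζ.re ^ 2 + ζ.im ^ 2 := by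
    rw [Complex.sq_norm, Complex.normSq_apply]; ring
  have h4 : M * ζ.im ^ 2 ≤ M * h ^ 2 := by
    rw [← sq_abs]
    gcongr
  rw [le_div_iff₀ (by positivity)] at hℓ
  have h5 : M * ζ.re ^ 2 ≤ ζ.re / 4 := by
    have : ζ.re * (M * ζ.re) ≤ ζ.re * (1 / 4) := by
      gcongr; linarith
    linarith
  rw [h3, mul_add]
  linarith

/-- The number of points of the lattice `π ℤ / m` in an interval. -/
lemma exists_lattice_points {K ℓ s m : ℝ} (hm : 0 < m) :
    ∃ S : Finset ℤ, (∀ k ∈ S, K / m ≤ Real.pi * k / m - s ∧ Real.pi * k / m - s ≤ ℓ - K / m) ∧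
      ℓ / Real.pi * m - 2 * K / Real.pi - 1 ≤ S.card := by
  have hpi := Real.pi_pos
  set A := (s + K / m) * m / Real.pi with hA
  set B := (s + ℓ - K / m) * m / Real.pi with hB
  refine ⟨Finset.Icc ⌈A⌉ ⌊B⌋, fun k hk => ?_, ?_⟩
  · rw [Finset.mem_Icc] at hk
    have h1 := Int.ceil_le.1 hk.1
    have h2 := Int.le_floor.1 hk.2
    rw [hA, div_le_iff₀ hpi] at h1
    rw [hB, le_div_iff₀ hpi] at h2
    constructor
    · have : s + K / m ≤ Real.pi * k / m := by
        rw [le_div_iff₀ hm]; linarith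
      linarith
    · have : Real.pi * k / m ≤ s + ℓ - K / m := by
        rw [div_le_iff₀ hm]; linarith
      linarith
  · rw [Int.card_Icc]
    have h1 : ((⌊B⌋ + 1 - ⌈A⌉ : ℤ) : ℝ) ≤ ((⌊B⌋ + 1 - ⌈A⌉).toNat : ℝ) := by
      exact_mod_cast Int.self_le_toNat _
    have h2 : B - A - 1 ≤ ((⌊B⌋ + 1 - ⌈A⌉ : ℤ) : ℝ) := by
      push_cast
      have := Int.lt_floor_add_one B
      have := Int.ceil_lt_add_one A
      linarith
    have h3 : B - A = ℓ / Real.pi * m - 2 * K / Real.pi := by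
      rw [hA, hB]
      field_simp
      ring
    linarith

/-- The placement condition on a chart `θ` at the quasi-momentum `η₀`: the angles of points with
positive real part lie in the band. Either the chart preserves the band up to a quadratic error, or
it is even and the band is preserved in a sector. -/
def ChartPlaced (x y η₀ : ℝ) (θ : ℂ → ℂ) : Prop :=
  (∃ M > 0, ∀ᶠ ζ in 𝓝 (0 : ℂ), M * ‖ζ‖ ^ 2 < ζ.re → x < (θ ζ).re ∧ (θ ζ).re < y) ∨
    (Real.sin η₀ = 0 ∧ (∀ᶠ ζ in 𝓝 (0 : ℂ), θ (-ζ) = θ ζ) ∧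
      ∀ᶠ ζ in 𝓝 (0 : ℂ), 0 < ζ.re → 4 * |ζ.im| ≤ ζ.re → x < (θ ζ).re ∧ (θ ζ).re < y)

/-- Along a chart the quotient of the numerators of the two Jost functions is `ζ^κ e^{g(ζ)}`. For an
even chart the two numerators are reflections of each other, so that `κ = 0`; in this case the zeros
are so close to the real axis that the sector in the placement condition suffices. -/
lemma exists_jost_quotient {p : ℕ} (hp : 0 < p) (hα : ∀ n, ‖α n‖ < 1)
    (hper : ∀ n, α (n + p) = α n) (hne : ∃ n, α n ≠ 0) {x y : ℝ} {η₀ ε : ℝ} (hε : ε = 1 ∨ ε = -1)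
    {θ : ℂ → ℂ} (hθ : AnalyticAt ℂ θ 0)
    (hD : ∀ᶠ ζ in 𝓝 (0 : ℂ), discrC α p (θ ζ) = 2 * Complex.cos (η₀ + ε * ζ))
    (hplace : ChartPlaced x y η₀ θ) (b : ℕ) :
    ∃ κ : ℤ, ∃ g : ℂ → ℂ, AnalyticAt ℂ g 0 ∧
      (∀ᶠ ζ in 𝓝 (0 : ℂ), ζ ≠ 0 →
        (phi α (b + p)).eval (Complex.exp (θ ζ * Complex.I)) -
            Complex.exp ((p : ℂ) * θ ζ / 2 * Complex.I) *
              Complex.exp ((η₀ + ε * ζ) * Complex.I) *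
              (phi α b).eval (Complex.exp (θ ζ * Complex.I)) =
          ζ ^ κ * Complex.exp (g ζ) *
            ((phi α (b + p)).eval (Complex.exp (θ ζ * Complex.I)) -
              Complex.exp ((p : ℂ) * θ ζ / 2 * Complex.I) *
                Complex.exp (-(η₀ + ε * ζ) * Complex.I) *
                (phi α b).eval (Complex.exp (θ ζ * Complex.I)))) ∧
      ∃ M > 0, ∀ᶠ ζ in 𝓝 (0 : ℂ), M * ‖ζ‖ ^ 2 < ζ.re → (κ = 0 → 4 * |ζ.im| ≤ ζ.re) →
        x < (θ ζ).re ∧ (θ ζ).re < y := by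
  set J₁ : ℂ → ℂ := fun ζ => (phi α (b + p)).eval (Complex.exp (θ ζ * Complex.I)) -
    Complex.exp ((p : ℂ) * θ ζ / 2 * Complex.I) * Complex.exp (-(η₀ + ε * ζ) * Complex.I) *
      (phi α b).eval (Complex.exp (θ ζ * Complex.I)) with hJ₁
  set J₂ : ℂ → ℂ := fun ζ => (phi α (b + p)).eval (Complex.exp (θ ζ * Complex.I)) -
    Complex.exp ((p : ℂ) * θ ζ / 2 * Complex.I) * Complex.exp ((η₀ + ε * ζ) * Complex.I) *
      (phi α b).eval (Complex.exp (θ ζ * Complex.I)) with hJ₂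
  have hEan : AnalyticAt ℂ (fun ζ => Complex.exp (θ ζ * Complex.I)) 0 :=
    (hθ.mul analyticAt_const).cexp
  have hpoly : ∀ f : ℂ[X], AnalyticAt ℂ (fun ζ => f.eval (Complex.exp (θ ζ * Complex.I))) 0 :=
    fun f => (f.differentiable.analyticAt _).comp hEan
  have hw : AnalyticAt ℂ (fun ζ => Complex.exp ((p : ℂ) * θ ζ / 2 * Complex.I)) 0 :=
    (((analyticAt_const.mul hθ).div_const).mul analyticAt_const).cexp
  have hη₁ : AnalyticAt ℂ (fun ζ : ℂ => Complex.exp (-(η₀ + ε * ζ) * Complex.I)) 0 :=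
    (by fun_prop : Differentiable ℂ fun ζ : ℂ =>
      Complex.exp (-(η₀ + ε * ζ) * Complex.I)).analyticAt 0
  have hη₂ : AnalyticAt ℂ (fun ζ : ℂ => Complex.exp ((η₀ + ε * ζ) * Complex.I)) 0 :=
    (by fun_prop : Differentiable ℂ fun ζ : ℂ =>
      Complex.exp ((η₀ + ε * ζ) * Complex.I)).analyticAt 0
  have hJ₁an : AnalyticAt ℂ J₁ 0 := (hpoly _).sub ((hw.mul hη₁).mul (hpoly _))
  have hJ₂an : AnalyticAt ℂ J₂ 0 := (hpoly _).sub ((hw.mul hη₂).mul (hpoly _))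
  have hJJ : ∀ᶠ ζ in 𝓝 (0 : ℂ),
      (jostPoly α p b).eval (Complex.exp (θ ζ * Complex.I)) = J₁ ζ * J₂ ζ := by
    filter_upwards [hD] with ζ h
    obtain ⟨hs, hm⟩ := eigenvalues_of_discrC h
    exact eval_jostPoly b hs hm
  have hQ := not_eventually_eval_eq_zero hε hθ hD (jostPoly_ne_zero hp hα hper hne b)
  have hJ₁0 : ¬ ∀ᶠ ζ in 𝓝 (0 : ℂ), J₁ ζ = 0 := fun h => hQ <| by
    filter_upwards [h, hJJ] with ζ h1 h2
    rw [h2, h1, zero_mul]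
  have hJ₂0 : ¬ ∀ᶠ ζ in 𝓝 (0 : ℂ), J₂ ζ = 0 := fun h => hQ <| by
    filter_upwards [h, hJJ] with ζ h1 h2
    rw [h2, h1, mul_zero]
  rcases hplace with ⟨M, hM, h⟩ | ⟨h1, h2, h3⟩
  · obtain ⟨κ, g, hg, hq⟩ := exists_quotient_eq hJ₁an hJ₂an hJ₁0 hJ₂0
    exact ⟨κ, g, hg, hq, M, hM, h.mono fun ζ h h' _ => h h'⟩
  · have hrefl : ∀ᶠ ζ in 𝓝 (0 : ℂ), J₂ ζ = J₁ (-ζ) := by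
      filter_upwards [h2] with ζ h
      have he : Complex.exp ((η₀ + ε * ζ) * Complex.I) =
          Complex.exp (-(η₀ + ε * -ζ) * Complex.I) := by
        have h4 : Complex.exp (η₀ * Complex.I) = Complex.exp (-η₀ * Complex.I) := by
          rw [Complex.exp_mul_I, Complex.exp_mul_I, Complex.cos_neg, Complex.sin_neg,
            ← Complex.ofReal_sin, h1]
          simp
        rw [add_mul, Complex.exp_add, h4, ← Complex.exp_add]
        congr 1
        ring
      simp only [hJ₁, hJ₂, h, he]
    obtain ⟨g, hg, hq⟩ := exists_quotient_reflect_eq hJ₁an hJ₁0 hrefl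
    refine ⟨0, g, hg, hq, 1, one_pos, h3.mono fun ζ h h' h'' => h ?_ (h'' rfl)⟩
    have := sq_nonneg ‖ζ‖
    linarith

/-- The zeros produced by a one-sided chart `ζ ↦ θ(ζ)` of the discriminant at the quasi-momentum
`η₀`, on a short interval of quasi-momenta: there is one for each point of the lattice
`π ℤ / m` in this interval, up to a bounded number. -/
lemma local_count {p : ℕ} (hp : 0 < p) (hα : ∀ n, ‖α n‖ < 1) (hper : ∀ n, α (n + p) = α n)
    (hne : ∃ n, α n ≠ 0) {x y : ℝ} (hxy : y - x ≤ 2 * Real.pi) {η₀ ε : ℝ} (hε : ε = 1 ∨ ε = -1)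
    {θ : ℂ → ℂ} (hθ : AnalyticAt ℂ θ 0)
    (hD : ∀ᶠ ζ in 𝓝 (0 : ℂ), discrC α p (θ ζ) = 2 * Complex.cos (η₀ + ε * ζ))
    (hplace : ChartPlaced x y η₀ θ) {b : ℕ} (hb : b < p) :
    ∃ δ > 0, ∀ a c ℓ : ℝ, 0 < ℓ → ℓ ≤ δ → 0 ≤ a → c ≤ Real.pi →
      (∀ s : ℝ, 0 < s → s < ℓ → a < η₀ + ε * s ∧ η₀ + ε * s < c) →
      ∃ K : ℝ, ∀ m : ℕ, ℓ / Real.pi * m - K ≤ (bandZeroSet α p x y (m * p + b) a c).ncard := by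
  have hpi := Real.pi_pos
  obtain ⟨κ, g, hg, hq, M, hM, hpl⟩ := exists_jost_quotient hp hα hper hne hε hθ hD hplace b
  obtain ⟨δ₁, hδ₁, K, hK, C, hC, hCK, m₀, hfix⟩ := exists_perturbed_point (-ε * κ / 2)
    (g := fun ζ => -(Complex.I * ε / 2) * g ζ) (analyticAt_const.mul hg)
  obtain ⟨L, s, hs, hlip⟩ := (hθ.contDiffAt (n := 1)).exists_lipschitzOnWith
  obtain ⟨r, hr, hball⟩ := Metric.eventually_nhds_iff.1
    (((hD.and hq).and hpl).and (show ∀ᶠ ζ in 𝓝 (0 : ℂ), ζ ∈ s from hs))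
  have hL0 : (0 : ℝ) ≤ L := L.2
  have hp0 : (0 : ℝ) < p := by exact_mod_cast hp
  obtain ⟨m₁, hm₁3, hm₁⟩ := exists_log_sq_le (A := |-ε * κ / 2|) (B := C) (abs_nonneg _) hC.le
    (ε := min ((r / 4) ^ 2) (min (K / (8 * M)) (1 / (2 * p * (L + 1) ^ 2)))) (by positivity)
  refine ⟨min δ₁ (min (r / 4) (1 / (4 * M))), by positivity, fun a c ℓ hℓ0 hℓ ha hc hac => ?_⟩
  have hℓ1 : ℓ ≤ δ₁ := hℓ.trans (min_le_left _ _)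
  have hℓ2 : ℓ ≤ r / 4 := hℓ.trans ((min_le_right _ _).trans (min_le_left _ _))
  have hℓ3 : ℓ ≤ 1 / (4 * M) := hℓ.trans ((min_le_right _ _).trans (min_le_right _ _))
  -- existence of the zero attached to a lattice point
  have key : ∀ m : ℕ, max m₀ m₁ ≤ m → ∀ k : ℤ, K / m ≤ Real.pi * k / m - ε * η₀ →
      Real.pi * k / m - ε * η₀ ≤ ℓ - K / m → ∃ ζ : ℂ,
        m * (ζ - (Real.pi * k / m - ε * η₀ : ℝ)) =
          Complex.I * (-ε * κ / 2 : ℝ) * Complex.log ζ + -(Complex.I * ε / 2) * g ζ ∧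
        (phi α (m * p + b)).eval (Complex.exp (θ ζ * Complex.I)) = 0 ∧
        1 - ‖Complex.exp (θ ζ * Complex.I)‖ ≤ ((m * p + b : ℕ) : ℝ) ^ (-(1 / 2) : ℝ) ∧
        (x < (θ ζ).re ∧ (θ ζ).re < y) ∧
        (a < (η₀ + ε * ζ).re ∧ (η₀ + ε * ζ).re < c) ∧
        discrC α p (θ ζ) = 2 * Complex.cos (η₀ + ε * ζ) := by
    intro m hm k hk1 hk2
    have hmm₁ := (le_max_right m₀ m₁).trans hm
    have hm3 : (3 : ℝ) ≤ m := by exact_mod_cast hm₁3.trans hmm₁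
    have hm0 : (0 : ℝ) < m := by linarith
    have hKm0 : 0 < K / m := by positivity
    set t := Real.pi * k / m - ε * η₀ with ht
    obtain ⟨ζ, hζ, hre, him⟩ := hfix m ((le_max_left _ _).trans hm) t hk1 (by linarith)
    set h := (|-ε * κ / 2| * Real.log m + C) / m with hh
    have hsq := hm₁ m hmm₁
    rw [← hh] at hsq
    have hh0 : 0 ≤ h := (abs_nonneg _).trans him
    have hK2 : K / (2 * m) = K / m / 2 := by field_simp
    rw [hK2] at hre
    obtain ⟨hre1, hre2⟩ := abs_le.1 hre
    have hre3 : K / m / 2 ≤ ζ.re := by linarith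
    have hre4 : ζ.re < ℓ := by linarith
    have hre0 : 0 < ζ.re := by linarith
    have hhr : h ≤ r / 4 := by
      have h1 : h ^ 2 * m ≤ (r / 4) ^ 2 := hsq.trans (min_le_left _ _)
      have h2 : h ^ 2 ≤ (r / 4) ^ 2 := by nlinarith [sq_nonneg h]
      exact le_of_sq_le_sq h2 (by positivity)
    have hnorm : ‖ζ‖ < r := by
      have h1 := Complex.norm_le_abs_re_add_abs_im ζ
      rw [abs_of_pos hre0] at h1
      linarith
    have hnorm' : ‖(ζ.re : ℂ)‖ < r := by
      rw [Complex.norm_real, Real.norm_of_nonneg hre0.le]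
      linarith
    obtain ⟨⟨⟨hDζ, hqζ⟩, hplζ⟩, hsζ⟩ := hball (y := ζ) (by simpa using hnorm)
    obtain ⟨⟨⟨hDζ', -⟩, -⟩, hsζ'⟩ := hball (y := (ζ.re : ℂ)) (by simpa using hnorm')
    have hζ0 : ζ ≠ 0 := by
      rintro rfl
      simp at hre0
    have hηre : (η₀ + ε * ζ).re = η₀ + ε * ζ.re := by simp
    have hin := hac ζ.re hre0 hre4
    rw [← hηre] at hin
    refine ⟨ζ, hζ, ?_, ?_, ?_, hin, hDζ⟩
    · refine eval_phi_eq_zero_of_quotient hα hper hDζ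
        (sin_ne_zero_of_re ⟨by linarith [hin.1], by linarith [hin.2]⟩) m b ?_
      refine (hqζ hζ0).trans ?_
      congr 1
      refine exp_eq_of_fixed_point (k := k) hε ?_ hζ0 hζ
      rw [ht]
      field_simp
    · rw [norm_exp_mul_I]
      have h1 : (θ (ζ.re : ℂ)).im = 0 :=
        im_eq_zero_of_discrC hp hα (η := η₀ + ε * ζ.re) (by push_cast; exact hDζ')
      have h2 : (θ ζ).im ≤ L * h := by
        have h3 := hlip.norm_sub_le hsζ hsζ'
        have h4 : ‖ζ - (ζ.re : ℂ)‖ = |ζ.im| := by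
          have : ζ - (ζ.re : ℂ) = ζ.im * Complex.I := by
            apply Complex.ext <;> simp
          rw [this]
          simp
        rw [h4] at h3
        calc (θ ζ).im = (θ ζ - θ (ζ.re : ℂ)).im := by rw [Complex.sub_im, h1, sub_zero]
          _ ≤ ‖θ ζ - θ (ζ.re : ℂ)‖ := Complex.im_le_norm _
          _ ≤ L * |ζ.im| := h3
          _ ≤ _ := by gcongr
      have h5 : 1 - Real.exp (-(θ ζ).im) ≤ L * h := by
        have := Real.add_one_le_exp (-(θ ζ).im)
        linarith
      refine h5.trans ?_
      have hnpos : (0 : ℝ) < (m * p + b : ℕ) := by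
        push_cast
        positivity
      have hn2 : ((m * p + b : ℕ) : ℝ) ≤ 2 * p * m := by
        push_cast
        have hb' : (b : ℝ) ≤ p := by exact_mod_cast hb.le
        nlinarith
      exact mul_le_rpow_neg_half hL0 hh0 hp0 hnpos hn2
        (hsq.trans ((min_le_right _ _).trans (min_le_right _ _)))
    · apply hplζ
      · exact mul_norm_sq_lt_re hM hm0 (hsq.trans ((min_le_right _ _).trans (min_le_left _ _)))
          him hre3 hre0 (by linarith)
      · rintro rfl
        have h1 : h = C / m := by rw [hh]; simp
        rw [h1] at him
        have h2 : 8 * (C / m) ≤ K / m := by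
          rw [← mul_div_assoc]
          gcongr
        linarith
  -- counting the lattice points
  set m₂ := max m₀ m₁
  refine ⟨ℓ / Real.pi * m₂ + 2 * K / Real.pi + 1, fun m => ?_⟩
  have hKpos : 0 ≤ 2 * K / Real.pi := by positivity
  rcases lt_or_ge m m₂ with hm | hm
  · have h1 : ℓ / Real.pi * m ≤ ℓ / Real.pi * m₂ := by gcongr
    have h2 : (0 : ℝ) ≤ (bandZeroSet α p x y (m * p + b) a c).ncard := Nat.cast_nonneg _
    linarith
  have hm3 : (3 : ℝ) ≤ m := by exact_mod_cast hm₁3.trans ((le_max_right m₀ m₁).trans hm)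
  have hm0 : (0 : ℝ) < m := by linarith
  obtain ⟨S, hlab, hS⟩ := exists_lattice_points (K := K) (ℓ := ℓ) (s := ε * η₀) hm0
  have key' : ∀ k : ℤ, ∃ ζ : ℂ, k ∈ S → _ := fun k => by
    by_cases hk : k ∈ S
    · obtain ⟨ζ, h⟩ := key m hm k (hlab k hk).1 (hlab k hk).2
      exact ⟨ζ, fun _ => h⟩
    · exact ⟨0, fun h => absurd h hk⟩
  choose ζ hζ using key'
  set z : ℤ → ℂ := fun k => Complex.exp (θ (ζ k) * Complex.I) with hz
  have hinj : Set.InjOn z S := by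
    intro k hk l hl he
    obtain ⟨h1, -, -, h2, h3, h4⟩ := hζ k hk
    obtain ⟨h1', -, -, h2', h3', h4'⟩ := hζ l hl
    have e1 := angle_unique hxy h2 h2' he
    have e2 : Complex.cos (η₀ + ε * ζ k) = Complex.cos (η₀ + ε * ζ l) := by
      rw [e1, h4'] at h4
      exact (mul_left_cancel₀ two_ne_zero h4).symm
    have e3 := cos_injective_of_re ⟨by linarith [h3.1], by linarith [h3.2]⟩
      ⟨by linarith [h3'.1], by linarith [h3'.2]⟩ e2
    have e4 : ζ k = ζ l := by
      have hε0 : (ε : ℂ) ≠ 0 := by rcases hε with rfl | rfl <;> norm_num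
      exact mul_left_cancel₀ hε0 (add_left_cancel e3)
    rw [e4] at h1
    have e5 := h1.trans h1'.symm
    have hmC : (m : ℂ) ≠ 0 := by exact_mod_cast hm0.ne'
    have e6 : Real.pi * k / m - ε * η₀ = Real.pi * l / m - ε * η₀ := by
      have := mul_left_cancel₀ hmC e5
      exact_mod_cast (sub_right_injective this)
    have e7 : Real.pi * k / m = Real.pi * l / m := by linarith
    rw [div_left_inj' hm0.ne'] at e7
    exact_mod_cast mul_left_cancel₀ hpi.ne' e7
  have hsub : ((Finset.image z S : Finset ℂ) : Set ℂ) ⊆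
      bandZeroSet α p x y (m * p + b) a c := by
    intro w hw
    rw [Finset.mem_coe, Finset.mem_image] at hw
    obtain ⟨k, hk, rfl⟩ := hw
    obtain ⟨-, h1, h2, h3, h4, h5⟩ := hζ k hk
    exact ⟨h1, h2, _, _, rfl, h3, h4, h5⟩
  have hcard := Set.ncard_le_ncard hsub (finite_bandZeroSet hα p x y _ a c)
  rw [Set.ncard_coe_finset, Finset.card_image_of_injOn hinj] at hcard
  have h4 : (S.card : ℝ) ≤ (bandZeroSet α p x y (m * p + b) a c).ncard := by exact_mod_cast hcard
  have h5 : 0 ≤ ℓ / Real.pi * m₂ := by positivity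
  linarith

/-! ### Charts of the discriminant -/

lemma hasStrictDerivAt_localInverse_image {f : ℂ → ℂ} {f' a : ℂ} (hf : HasStrictDerivAt f f' a)
    (hf' : f' ≠ 0) : hf.localInverse f f' a hf' (f a) = a :=
  HasStrictFDerivAt.localInverse_apply_image ..

lemma im_eq_zero_and_re_nonpos_of_tendsto {F : ℂ → ℂ} (hF : ContinuousAt F 0) {w : ℝ} (hw : 0 < w)
    (h : ∀ t : ℝ, 0 < t → t < w → (F t).im = 0 ∧ (F t).re ≤ 0) :
    (F 0).im = 0 ∧ (F 0).re ≤ 0 := by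
  have hlim : Tendsto (fun t : ℝ => (t : ℂ)) (𝓝[>] 0) (𝓝 0) := by
    have := Complex.continuous_ofReal.tendsto 0
    rw [Complex.ofReal_zero] at this
    exact this.mono_left nhdsWithin_le_nhds
  have hclosed : IsClosed {z : ℂ | z.im = 0 ∧ z.re ≤ 0} :=
    (isClosed_eq Complex.continuous_im continuous_const).inter
      (isClosed_le Complex.continuous_re continuous_const)
  refine hclosed.mem_of_tendsto (hF.tendsto.comp hlim) ?_
  have h1 : ∀ᶠ t : ℝ in 𝓝[>] 0, t < w := nhdsWithin_le_nhds (gt_mem_nhds hw)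
  filter_upwards [h1, self_mem_nhdsWithin] with t h2 h3
  exact h t h3 h2

lemma differentiable_dslope {f : ℂ → ℂ} (hf : Differentiable ℂ f) (a : ℂ) :
    Differentiable ℂ (dslope f a) := by
  rw [← differentiableOn_univ, Complex.differentiableOn_dslope univ_mem, differentiableOn_univ]
  exact hf

/-- An even chart at an edge where the derivative of the discriminant does not vanish (an edge
of an open gap). -/
lemma exists_open_edge_chart {f : ℂ → ℂ} (hf : Differentiable ℂ f) (h0 : f 0 = 2) {a : ℝ}
    (ha : a < 0) (hda : deriv f 0 = a) {w : ℝ} (hw : 0 < w) :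
    ∃ s : ℂ → ℂ, AnalyticAt ℂ s 0 ∧ (∀ᶠ ζ in 𝓝 (0 : ℂ), f (s ζ) = 2 * Complex.cos ζ) ∧
      (∀ᶠ ζ in 𝓝 (0 : ℂ), s (-ζ) = s ζ) ∧
      ∀ᶠ ζ in 𝓝 (0 : ℂ), 0 < ζ.re → 4 * |ζ.im| ≤ ζ.re → 0 < (s ζ).re ∧ (s ζ).re < w := by
  have han : AnalyticAt ℂ f 0 := hf.analyticAt 0
  have hd : deriv f 0 ≠ 0 := by rw [hda]; exact_mod_cast ha.ne
  set h := han.hasStrictDerivAt.localInverse _ _ _ hd with hh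
  have hhan : AnalyticAt ℂ h 2 := by
    have := han.analyticAt_localInverse hd
    rwa [h0] at this
  have hh2 : h 2 = 0 := by
    have := hasStrictDerivAt_localInverse_image han.hasStrictDerivAt hd
    rwa [h0] at this
  have hhd : deriv h 2 = (a : ℂ)⁻¹ := by
    have := (han.hasStrictDerivAt.to_localInverse hd).hasDerivAt.deriv
    rw [h0] at this
    exact this.trans (by rw [hda])
  have hright : ∀ᶠ u in 𝓝 (2 : ℂ), f (h u) = u := by
    have := han.hasStrictDerivAt.eventually_right_inverse hd
    rwa [h0] at this
  have hcos : Tendsto (fun ζ : ℂ => 2 * Complex.cos ζ) (𝓝 0) (𝓝 2) := by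
    have : Continuous fun ζ : ℂ => 2 * Complex.cos ζ := by fun_prop
    simpa using this.tendsto 0
  have hcosan : AnalyticAt ℂ (fun ζ : ℂ => 2 * Complex.cos ζ) 0 :=
    (by fun_prop : Differentiable ℂ fun ζ : ℂ => 2 * Complex.cos ζ).analyticAt 0
  have hsan : AnalyticAt ℂ (fun ζ => h (2 * Complex.cos ζ)) 0 :=
    AnalyticAt.comp (g := h) (by simpa using hhan) hcosan
  refine ⟨fun ζ => h (2 * Complex.cos ζ), hsan, hcos.eventually hright,
    Eventually.of_forall fun ζ => by simp, ?_⟩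
  -- `s = ζ² Q(ζ)` with `Q(0) = -1 / a > 0`
  set r : ℂ → ℂ := dslope (fun ζ : ℂ => 2 * Complex.sin (ζ / 2)) 0 with hr
  have hrdiff : Differentiable ℂ r := differentiable_dslope (by fun_prop) 0
  have hr0 : r 0 = 1 := by
    rw [hr, dslope_same]
    have h1 : HasDerivAt (fun ζ : ℂ => 2 * Complex.sin (ζ / 2))
        (2 * (Complex.cos (0 / 2) * (1 / 2))) 0 :=
      (((hasDerivAt_id (0 : ℂ)).div_const 2).csin).const_mul 2
    rw [h1.deriv]
    simp
  have hrmul : ∀ ζ : ℂ, 2 * Complex.sin (ζ / 2) = ζ * r ζ := fun ζ => by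
    have := sub_smul_dslope (fun ζ : ℂ => 2 * Complex.sin (ζ / 2)) 0 ζ
    simp at this
    rw [← this]
  set Q : ℂ → ℂ := fun ζ => -(r ζ ^ 2 * dslope h 2 (2 * Complex.cos ζ)) with hQ
  have hQmul : ∀ ζ : ℂ, h (2 * Complex.cos ζ) = ζ ^ 2 * Q ζ := fun ζ => by
    have h1 := sub_smul_dslope h 2 (2 * Complex.cos ζ)
    rw [hh2, sub_zero, smul_eq_mul] at h1
    have h2 : 2 * Complex.cos ζ - 2 = -(2 * Complex.sin (ζ / 2)) ^ 2 := by
      have h3 := Complex.cos_two_mul (ζ / 2)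
      have h4 := Complex.sin_sq_add_cos_sq (ζ / 2)
      rw [show 2 * (ζ / 2) = ζ by ring] at h3
      linear_combination 2 * h3 + 4 * h4
    rw [← h1, h2, hrmul, hQ]
    ring
  have hQcont : ContinuousAt Q 0 := by
    have h1 : ContinuousAt (dslope h 2) (2 * Complex.cos 0) := by
      rw [Complex.cos_zero, mul_one, continuousAt_dslope_same]
      exact hhan.differentiableAt
    have h2 : ContinuousAt (fun ζ : ℂ => dslope h 2 (2 * Complex.cos ζ)) 0 :=
      ContinuousAt.comp (f := fun ζ : ℂ => 2 * Complex.cos ζ) h1 hcosan.continuousAt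
    exact ((hrdiff.continuous.continuousAt.pow 2).mul h2).neg
  set q : ℝ := -a⁻¹ with hq
  have hq0 : 0 < q := by rw [hq, neg_pos]; exact inv_lt_zero.2 ha
  have hQ0 : Q 0 = q := by
    simp only [hQ, hr0, Complex.cos_zero, mul_one, dslope_same, hhd, hq]
    push_cast
    ring
  have ev1 : ∀ᶠ ζ in 𝓝 (0 : ℂ), ‖Q ζ - q‖ < q / 2 := by
    have h1 : ContinuousAt (fun ζ => ‖Q ζ - q‖) 0 := (hQcont.sub continuousAt_const).norm
    exact h1.eventually_lt_const (by simp [hQ0]; exact hq0)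
  have ev2 : ∀ᶠ ζ in 𝓝 (0 : ℂ), (h (2 * Complex.cos ζ)).re < w := by
    have h1 : ContinuousAt (fun ζ => (h (2 * Complex.cos ζ)).re) 0 :=
      Complex.continuous_re.continuousAt.comp hsan.continuousAt
    exact h1.eventually_lt_const (by simpa [hh2] using hw)
  filter_upwards [ev1, ev2] with ζ h1 h2 h3 h4
  refine ⟨?_, h2⟩
  rw [hQmul]
  have e1 : (ζ ^ 2 * Q ζ).re = q * (ζ ^ 2).re + (ζ ^ 2 * (Q ζ - q)).re := by
    rw [mul_sub, Complex.sub_re, Complex.mul_re (ζ ^ 2) (q : ℂ)]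
    simp
    ring
  have e2 : -(‖ζ ^ 2‖ * (q / 2)) ≤ (ζ ^ 2 * (Q ζ - q)).re := by
    have h5 := Complex.abs_re_le_norm (ζ ^ 2 * (Q ζ - q))
    rw [norm_mul] at h5
    have h6 : ‖ζ ^ 2‖ * ‖Q ζ - q‖ ≤ ‖ζ ^ 2‖ * (q / 2) := by gcongr
    linarith [(abs_le.1 h5).1]
  have e3 : (ζ ^ 2).re = ζ.re ^ 2 - ζ.im ^ 2 := by
    rw [pow_two, Complex.mul_re]; ring
  have e4 : ‖ζ ^ 2‖ = ζ.re ^ 2 + ζ.im ^ 2 := by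
    rw [norm_pow, Complex.sq_norm, Complex.normSq_apply]; ring
  have e5 : 16 * ζ.im ^ 2 ≤ ζ.re ^ 2 := by
    rw [← sq_abs ζ.im]
    nlinarith [abs_nonneg ζ.im]
  rw [e1, e3]
  rw [e4] at e2
  have e6 : 0 < ζ.re ^ 2 := by positivity
  have e7 : 0 < q * ((ζ.re ^ 2 - ζ.im ^ 2) - (ζ.re ^ 2 + ζ.im ^ 2) / 2) :=
    mul_pos hq0 (by linarith)
  linarith

/-- A chart at an edge where the discriminant has a critical point of order two (a closed gap). -/
lemma exists_closed_edge_chart {f d : ℂ → ℂ} (hd : Differentiable ℂ d)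
    (hfd : ∀ s, f s = 2 + s ^ 2 * d s) {q : ℝ} (hq : 0 < q) (hd0 : d 0 = -q) {w : ℝ}
    (hw : 0 < w) :
    ∃ s : ℂ → ℂ, AnalyticAt ℂ s 0 ∧ (∀ᶠ ζ in 𝓝 (0 : ℂ), f (s ζ) = 2 * Complex.cos ζ) ∧
      ∃ M > 0, ∀ᶠ ζ in 𝓝 (0 : ℂ), M * ‖ζ‖ ^ 2 < ζ.re → 0 < (s ζ).re ∧ (s ζ).re < w := by
  -- `S` is a square root of `2 - f`
  set E : ℂ → ℂ := fun s => Complex.exp (Complex.log (-d s) / 2) with hE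
  set S : ℂ → ℂ := fun s => s * E s with hS
  have hdan : AnalyticAt ℂ d 0 := hd.analyticAt 0
  have hEan : AnalyticAt ℂ E 0 := by
    refine ((hdan.neg.clog ?_).div_const).cexp
    simp only [Pi.neg_apply, hd0, neg_neg]
    exact Complex.ofReal_mem_slitPlane.2 hq
  have hSan : AnalyticAt ℂ S 0 := analyticAt_id.mul hEan
  set ρ : ℝ := Real.exp (Real.log q / 2) with hρ
  have hρ0 : 0 < ρ := Real.exp_pos _
  have hE0 : E 0 = ρ := by
    simp only [hE, hd0, neg_neg, hρ]
    rw [← Complex.ofReal_log hq.le]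
    push_cast
    rfl
  have hSd : deriv S 0 = ρ := by
    have h1 := ((hasDerivAt_id (0 : ℂ)).mul hEan.differentiableAt.hasDerivAt).deriv
    rw [show S = id * E from rfl, h1, hE0]
    simp
  have hS0 : S 0 = 0 := by simp [hS]
  have hSd0 : deriv S 0 ≠ 0 := by rw [hSd]; exact_mod_cast hρ0.ne'
  set h := hSan.hasStrictDerivAt.localInverse _ _ _ hSd0 with hh
  have hhan : AnalyticAt ℂ h 0 := by
    have := hSan.analyticAt_localInverse hSd0
    rwa [hS0] at this
  have hh0 : h 0 = 0 := by
    have := hasStrictDerivAt_localInverse_image hSan.hasStrictDerivAt hSd0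
    rwa [hS0] at this
  have hhd : HasDerivAt h (ρ : ℂ)⁻¹ 0 := by
    have := (hSan.hasStrictDerivAt.to_localInverse hSd0).hasDerivAt
    rw [hS0] at this
    have e : (ρ : ℂ)⁻¹ = (deriv S 0)⁻¹ := by rw [hSd]
    rw [e]
    exact this
  have hright : ∀ᶠ u in 𝓝 (0 : ℂ), S (h u) = u := by
    have := hSan.hasStrictDerivAt.eventually_right_inverse hSd0
    rwa [hS0] at this
  set σ : ℂ → ℂ := fun ζ => 2 * Complex.sin (ζ / 2) with hσ
  have hσ0 : σ 0 = 0 := by simp [hσ]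
  have hσan : AnalyticAt ℂ σ 0 :=
    (by fun_prop : Differentiable ℂ σ).analyticAt 0
  have hσd : HasDerivAt σ 1 0 := by
    have h1 : HasDerivAt (fun ζ : ℂ => 2 * Complex.sin (ζ / 2))
        (2 * (Complex.cos (0 / 2) * (1 / 2))) 0 :=
      (((hasDerivAt_id (0 : ℂ)).div_const 2).csin).const_mul 2
    simpa using h1
  have hsan : AnalyticAt ℂ (fun ζ => h (σ ζ)) 0 :=
    AnalyticAt.comp (g := h) (by rwa [hσ0]) hσan
  have hσt : Tendsto σ (𝓝 0) (𝓝 0) := by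
    simpa [hσ0] using hσan.continuousAt.tendsto
  have hst : Tendsto (fun ζ => h (σ ζ)) (𝓝 0) (𝓝 0) := by
    simpa [hσ0, hh0] using hsan.continuousAt.tendsto
  refine ⟨fun ζ => h (σ ζ), hsan, ?_, ?_⟩
  · have hdne : ∀ᶠ s in 𝓝 (0 : ℂ), -d s ≠ 0 := by
      refine hdan.neg.continuousAt.eventually_ne ?_
      simp only [Pi.neg_apply, hd0, neg_neg]
      exact_mod_cast hq.ne'
    filter_upwards [hσt.eventually hright, hst.eventually hdne] with ζ h1 h2
    have h3 : S (h (σ ζ)) ^ 2 = -(h (σ ζ) ^ 2 * d (h (σ ζ))) := by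
      have : E (h (σ ζ)) ^ 2 = -d (h (σ ζ)) := by
        simp only [hE]
        rw [← Complex.exp_nat_mul]
        push_cast
        rw [mul_div_cancel₀ _ (two_ne_zero), Complex.exp_log h2]
      simp only [hS, mul_pow, this]
      ring
    rw [h1] at h3
    have h4 := Complex.cos_two_mul (ζ / 2)
    have h5 := Complex.sin_sq_add_cos_sq (ζ / 2)
    rw [show 2 * (ζ / 2) = ζ by ring] at h4
    simp only [hσ] at h3
    rw [hfd]
    simp only [hσ]
    linear_combination h3 - 2 * h4 - 4 * h5
  · -- the chart is `ζ / ρ` up to a quadratic error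
    have hsd : HasDerivAt (fun ζ => h (σ ζ)) (ρ : ℂ)⁻¹ 0 := by
      have h1 : HasDerivAt h (ρ : ℂ)⁻¹ (σ 0) := by rwa [hσ0]
      have h2 := HasDerivAt.comp (0 : ℂ) h1 hσd
      rw [mul_one] at h2
      exact h2
    set s : ℂ → ℂ := fun ζ => h (σ ζ) with hs
    have hs0 : s 0 = 0 := by simp [hs, hσ0, hh0]
    obtain ⟨u, hu, hu'⟩ := eventually_nhds_iff.1 hsan.eventually_analyticAt
    have hdiff : DifferentiableOn ℂ (dslope s 0) u :=
      (Complex.differentiableOn_dslope (hu'.1.mem_nhds hu'.2)).2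
        fun z hz => (hu z hz).differentiableAt.differentiableWithinAt
    have hDat : DifferentiableAt ℂ (dslope s 0) 0 :=
      hdiff.differentiableAt (hu'.1.mem_nhds hu'.2)
    have hbig := hDat.isBigO_sub
    obtain ⟨C, hC, hbound⟩ := hbig.exists_pos
    have hb := hbound.bound
    refine ⟨ρ * C, by positivity, ?_⟩
    have ev2 : ∀ᶠ ζ in 𝓝 (0 : ℂ), (s ζ).re < w := by
      have h1 : ContinuousAt (fun ζ => (s ζ).re) 0 :=
        Complex.continuous_re.continuousAt.comp hsan.continuousAt
      exact h1.eventually_lt_const (by simpa [hs0] using hw)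
    filter_upwards [hb, ev2] with ζ h1 h2 h3
    refine ⟨?_, h2⟩
    rw [dslope_same, hsd.deriv, sub_zero] at h1
    have h4 := sub_smul_dslope s 0 ζ
    rw [hs0, sub_zero, sub_zero, smul_eq_mul] at h4
    have h5 : s ζ = ζ * (ρ : ℂ)⁻¹ + ζ * (dslope s 0 ζ - (ρ : ℂ)⁻¹) := by rw [← h4]; ring
    have h6 : (ζ * (ρ : ℂ)⁻¹).re = ζ.re / ρ := by
      rw [← Complex.ofReal_inv, Complex.re_mul_ofReal, div_eq_mul_inv]
    have h7 : -(‖ζ‖ * (C * ‖ζ‖)) ≤ (ζ * (dslope s 0 ζ - (ρ : ℂ)⁻¹)).re := by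
      have h8 := Complex.abs_re_le_norm (ζ * (dslope s 0 ζ - (ρ : ℂ)⁻¹))
      rw [norm_mul] at h8
      have h9 : ‖ζ‖ * ‖dslope s 0 ζ - (ρ : ℂ)⁻¹‖ ≤ ‖ζ‖ * (C * ‖ζ‖) := by gcongr
      linarith [(abs_le.1 h8).1]
    have h10 : C * ‖ζ‖ ^ 2 < ζ.re / ρ := by
      rw [lt_div_iff₀ hρ0]
      linarith
    rw [h5, Complex.add_re, h6]
    linarith

/-- A chart at an edge of a band, in normalized position: the edge is at `0`, the band to the right,
and the discriminant equals `2` at the edge. -/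
lemma exists_edge_chart {f : ℂ → ℂ} (hf : Differentiable ℂ f) (h0 : f 0 = 2) {g : ℝ → ℝ}
    (hreal : ∀ t : ℝ, f t = (g t : ℂ)) {w : ℝ} (hw : 0 < w)
    (hlt : ∀ t : ℝ, 0 < t → t < w → |g t| < 2)
    (horder : ¬ (fun s => f s - 2) =o[𝓝 0] fun s => s ^ 2) :
    ∃ s : ℂ → ℂ, AnalyticAt ℂ s 0 ∧ (∀ᶠ ζ in 𝓝 (0 : ℂ), f (s ζ) = 2 * Complex.cos ζ) ∧
      ((∃ M > 0, ∀ᶠ ζ in 𝓝 (0 : ℂ), M * ‖ζ‖ ^ 2 < ζ.re → 0 < (s ζ).re ∧ (s ζ).re < w) ∨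
        (∀ᶠ ζ in 𝓝 (0 : ℂ), s (-ζ) = s ζ) ∧
          ∀ᶠ ζ in 𝓝 (0 : ℂ), 0 < ζ.re → 4 * |ζ.im| ≤ ζ.re → 0 < (s ζ).re ∧ (s ζ).re < w) := by
  set d₁ := dslope f 0 with hd₁
  have hd₁diff : Differentiable ℂ d₁ := differentiable_dslope hf 0
  have hmul₁ : ∀ s, f s = 2 + s * d₁ s := fun s => by
    have := sub_smul_dslope f 0 s
    rw [h0, sub_zero, smul_eq_mul] at this
    rw [hd₁, this]; ring
  have hval₁ : ∀ t : ℝ, 0 < t → t < w → (d₁ t).im = 0 ∧ (d₁ t).re ≤ 0 := by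
    intro t ht htw
    have h1 : d₁ t = ((g t - 2) / t : ℝ) := by
      have h2 := hmul₁ t
      rw [hreal] at h2
      have h3 : (t : ℂ) ≠ 0 := by exact_mod_cast ht.ne'
      push_cast
      rw [h2]
      field_simp
      ring
    rw [h1]
    refine ⟨Complex.ofReal_im _, ?_⟩
    rw [Complex.ofReal_re]
    exact div_nonpos_of_nonpos_of_nonneg (by linarith [(abs_lt.1 (hlt t ht htw)).2]) ht.le
  obtain ⟨him₁, hre₁⟩ := im_eq_zero_and_re_nonpos_of_tendsto
    hd₁diff.continuous.continuousAt hw hval₁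
  have hd₁0 : d₁ 0 = deriv f 0 := dslope_same f 0
  rcases hre₁.lt_or_eq with hneg | hzero
  · obtain ⟨s, h1, h2, h3, h4⟩ := exists_open_edge_chart hf h0 hneg
      (by rw [← hd₁0]; exact Complex.ext (by simp) (by simp [him₁])) hw
    exact ⟨s, h1, h2, Or.inr ⟨h3, h4⟩⟩
  · have hd₁z : d₁ 0 = 0 := Complex.ext hzero him₁
    set d₂ := dslope d₁ 0 with hd₂
    have hd₂diff : Differentiable ℂ d₂ := differentiable_dslope hd₁diff 0
    have hmul₂ : ∀ s, f s = 2 + s ^ 2 * d₂ s := fun s => by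
      have := sub_smul_dslope d₁ 0 s
      rw [hd₁z, sub_zero, sub_zero, smul_eq_mul] at this
      rw [hmul₁, ← this, hd₂]; ring
    have hval₂ : ∀ t : ℝ, 0 < t → t < w → (d₂ t).im = 0 ∧ (d₂ t).re ≤ 0 := by
      intro t ht htw
      have h1 : d₂ t = ((g t - 2) / t ^ 2 : ℝ) := by
        have h2 := hmul₂ t
        rw [hreal] at h2
        have h3 : (t : ℂ) ≠ 0 := by exact_mod_cast ht.ne'
        push_cast
        rw [h2]
        field_simp
        ring
      rw [h1]
      refine ⟨Complex.ofReal_im _, ?_⟩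
      rw [Complex.ofReal_re]
      exact div_nonpos_of_nonpos_of_nonneg (by linarith [(abs_lt.1 (hlt t ht htw)).2])
        (by positivity)
    obtain ⟨him₂, hre₂⟩ := im_eq_zero_and_re_nonpos_of_tendsto
      hd₂diff.continuous.continuousAt hw hval₂
    have hne : (d₂ 0).re ≠ 0 := by
      intro h
      apply horder
      have h1 : d₂ 0 = 0 := Complex.ext h him₂
      have h2 : Tendsto d₂ (𝓝 0) (𝓝 0) := by
        have := hd₂diff.continuous.tendsto 0
        rwa [h1] at this
      have h3 := (Asymptotics.isBigO_refl (fun s : ℂ => s ^ 2) (𝓝 0)).mul_isLittleO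
        ((Asymptotics.isLittleO_one_iff ℂ).2 h2)
      refine h3.congr (fun s => ?_) fun s => ?_
      · rw [hmul₂]; ring
      · simp
    have hneg : (d₂ 0).re < 0 := lt_of_le_of_ne hre₂ hne
    obtain ⟨s, h1, h2, h3⟩ := exists_closed_edge_chart hd₂diff hmul₂ (q := -(d₂ 0).re)
      (by linarith) (Complex.ext (by simp) (by simp [him₂])) hw
    exact ⟨s, h1, h2, Or.inl h3⟩

/-- A chart at an interior point of a band. -/
lemma exists_interior_chart {p : ℕ} (hp : 0 < p) (hα : ∀ n, ‖α n‖ < 1) {x y θ₀ η₀ : ℝ} (ε : ℝ)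
    (hθ₀ : θ₀ ∈ Set.Ioo x y) (hlt : |discrR α p θ₀| < 2)
    (he : discrR α p θ₀ = 2 * Real.cos η₀) :
    ∃ θ : ℂ → ℂ, AnalyticAt ℂ θ 0 ∧
      (∀ᶠ ζ in 𝓝 (0 : ℂ), discrC α p (θ ζ) = 2 * Complex.cos (η₀ + ε * ζ)) ∧
      ChartPlaced x y η₀ θ := by
  have han : AnalyticAt ℂ (discrC α p) θ₀ := (differentiable_discrC α p).analyticAt _
  have hd := deriv_discrC_ne_zero hp hα hlt
  have hval : discrC α p θ₀ = 2 * Complex.cos (η₀ + ε * 0) := by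
    rw [discrC_ofReal', he]
    push_cast
    simp
  set h := han.hasStrictDerivAt.localInverse _ _ _ hd with hh
  have hcosan : AnalyticAt ℂ (fun ζ : ℂ => 2 * Complex.cos (η₀ + ε * ζ)) 0 :=
    (by fun_prop : Differentiable ℂ fun ζ : ℂ => 2 * Complex.cos (η₀ + ε * ζ)).analyticAt 0
  have hsan : AnalyticAt ℂ (fun ζ : ℂ => h (2 * Complex.cos (η₀ + ε * ζ))) 0 := by
    refine AnalyticAt.comp (g := h) ?_ hcosan
    rw [← hval]
    exact han.analyticAt_localInverse hd
  have himg : h (2 * Complex.cos (η₀ + ε * 0)) = θ₀ := by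
    rw [← hval]
    exact hasStrictDerivAt_localInverse_image han.hasStrictDerivAt hd
  refine ⟨_, hsan, ?_, Or.inl ⟨1, one_pos, ?_⟩⟩
  · have h1 := han.hasStrictDerivAt.eventually_right_inverse hd
    rw [hval] at h1
    exact hcosan.continuousAt.eventually h1
  · have h1 : ContinuousAt (fun ζ : ℂ => (h (2 * Complex.cos (η₀ + ε * ζ))).re) 0 :=
      Complex.continuous_re.continuousAt.comp hsan.continuousAt
    have ev1 := h1.eventually_const_lt (u := x) (by simp only [himg]; simpa using hθ₀.1)
    have ev2 := h1.eventually_lt_const (u := y) (by simp only [himg]; simpa using hθ₀.2)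
    filter_upwards [ev1, ev2] with ζ h1 h2 _
    exact ⟨h1, h2⟩

/-- The discriminant takes the values `±2` to order at most two. -/
lemma not_isLittleO_discrC {p : ℕ} (hp : 0 < p) (hα : ∀ n, ‖α n‖ < 1) {θ₀ η₀ σ e : ℝ}
    (hσ : σ = 1 ∨ σ = -1) (he : e = 1 ∨ e = -1) (hcos : Real.cos η₀ = σ)
    (hval : discrR α p θ₀ = 2 * σ) :
    ¬ (fun s : ℂ => σ * discrC α p (θ₀ + e * s) - 2) =o[𝓝 0] fun s : ℂ => s ^ 2 := by
  intro ho
  have hσ2 : (σ : ℂ) * σ = 1 := by rcases hσ with rfl | rfl <;> norm_num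
  have he2 : (e : ℂ) * e = 1 := by rcases he with rfl | rfl <;> norm_num
  have hσn : ‖(σ : ℂ)‖ = 1 := by rcases hσ with rfl | rfl <;> norm_num
  have hen : ‖(e : ℂ)‖ = 1 := by rcases he with rfl | rfl <;> norm_num
  have ev1 := ho.def (c := 1 / 288) (by norm_num)
  have ev2 : ∀ᶠ s in 𝓝 (0 : ℂ), ‖discrC α p (θ₀ + e * s)‖ < 3 := by
    have hc : Continuous fun s : ℂ => ‖discrC α p (θ₀ + e * s)‖ := by
      have := (differentiable_discrC α p).continuous
      fun_prop
    refine hc.continuousAt.eventually_lt_const ?_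
    simp only [mul_zero, add_zero, discrC_ofReal', hval]
    push_cast
    rw [norm_mul, hσn]
    norm_num
  have hlim : Tendsto (fun t : ℝ => (e : ℂ) * (t * Complex.I)) (𝓝[>] 0) (𝓝 0) := by
    have hcont : Continuous fun t : ℝ => (e : ℂ) * (t * Complex.I) := by fun_prop
    have := hcont.tendsto 0
    simp only [Complex.ofReal_zero, zero_mul, mul_zero] at this
    exact this.mono_left nhdsWithin_le_nhds
  have ev3 : ∀ᶠ t : ℝ in 𝓝[>] 0, t < 1 := nhdsWithin_le_nhds (gt_mem_nhds one_pos)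
  obtain ⟨t, ⟨h3, h4⟩, h5, h6⟩ :=
    ((hlim.eventually (ev1.and ev2)).and (ev3.and self_mem_nhdsWithin)).exists
  have h6' : 0 < t := h6
  have hpt : (θ₀ : ℂ) + e * (e * (t * Complex.I)) = θ₀ + t * Complex.I := by
    linear_combination (t * Complex.I : ℂ) * he2
  rw [hpt] at h3 h4
  have him : ((θ₀ : ℂ) + t * Complex.I).im = t := by simp
  have h7 := discrC_lower_bound hp hα η₀ (θ := (θ₀ : ℂ) + t * Complex.I)
    (by rw [him]; exact h6') (by rw [him]; exact h5.le)
  rw [him, ← Complex.ofReal_cos, hcos] at h7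
  have h8 : ‖(σ : ℂ) * discrC α p (θ₀ + t * Complex.I) - 2‖ =
      ‖discrC α p (θ₀ + t * Complex.I) - 2 * σ‖ := by
    rw [show (σ : ℂ) * discrC α p (θ₀ + t * Complex.I) - 2 =
      σ * (discrC α p (θ₀ + t * Complex.I) - 2 * σ) by linear_combination (2 : ℂ) * hσ2,
      norm_mul, hσn, one_mul]
  have h9 : ‖((e : ℂ) * (t * Complex.I)) ^ 2‖ = t ^ 2 := by
    rw [norm_pow, norm_mul, hen]
    simp
  rw [h8, h9] at h3
  have h10 : t / 6 * (t / 6) ≤ t / 6 * max |Real.sin η₀| (t / 6) := by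
    gcongr
    exact le_max_right _ _
  have h11 : ‖discrC α p (θ₀ + t * Complex.I) - 2 * σ‖ *
      (‖discrC α p (θ₀ + t * Complex.I)‖ + 1) ≤ 1 / 288 * t ^ 2 * 4 := by
    gcongr
    linarith
  have : 0 < t ^ 2 := by positivity
  linarith

/-- Charts exist at every quasi-momentum `η₀ ∈ [0, π]` of a band, in every direction `ε` that
points into `[0, π]`. -/
lemma exists_chart {p : ℕ} (hp : 0 < p) (hα : ∀ n, ‖α n‖ < 1) {x y : ℝ} (hband : IsBand α p x y)
    {η₀ ε : ℝ} (h : η₀ ∈ Set.Ioo 0 Real.pi ∨ (η₀ = 0 ∧ ε = 1) ∨ (η₀ = Real.pi ∧ ε = -1)) :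
    ∃ θ : ℂ → ℂ, AnalyticAt ℂ θ 0 ∧
      (∀ᶠ ζ in 𝓝 (0 : ℂ), discrC α p (θ ζ) = 2 * Complex.cos (η₀ + ε * ζ)) ∧
      ChartPlaced x y η₀ θ := by
  obtain ⟨θ₀, hθ₀, hval⟩ := hband.exists_discrR_eq hp hα (c := 2 * Real.cos η₀) (by
    rw [abs_mul, abs_two]
    linarith [Real.abs_cos_le_one η₀])
  rw [isBand_iff] at hband
  obtain ⟨hxy, hx, hy, hin⟩ := hband
  rcases h with hη | hη
  · have hlt : |discrR α p θ₀| < 2 := by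
      have hs := Real.sin_pos_of_pos_of_lt_pi hη.1 hη.2
      have hsc := Real.sin_sq_add_cos_sq η₀
      rw [hval, abs_mul, abs_two]
      have : |Real.cos η₀| < 1 := by
        rw [← sq_lt_one_iff_abs_lt_one]
        nlinarith
      linarith
    refine exists_interior_chart hp hα ε ⟨lt_of_le_of_ne hθ₀.1 fun e => ?_,
      lt_of_le_of_ne hθ₀.2 fun e => ?_⟩ hlt hval
    · rw [← e, hx] at hlt; exact lt_irrefl _ hlt
    · rw [e, hy] at hlt; exact lt_irrefl _ hlt
  · set σ := Real.cos η₀ with hσdef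
    have hsin : Real.sin η₀ = 0 := by rcases hη with ⟨rfl, -⟩ | ⟨rfl, -⟩ <;> simp
    have hσ : σ = 1 ∨ σ = -1 := by
      rcases hη with ⟨rfl, -⟩ | ⟨rfl, -⟩
      · left; simp [hσdef]
      · right; simp [hσdef]
    have hσ2 : (σ : ℂ) * σ = 1 := by rcases hσ with h | h <;> rw [h] <;> norm_num
    have hcosσ : ∀ ζ : ℂ, 2 * Complex.cos (η₀ + ε * ζ) = σ * (2 * Complex.cos ζ) := by
      intro ζ
      rcases hη with ⟨h1, h2⟩ | ⟨h1, h2⟩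
      · rw [hσdef, h1, h2]; simp
      · rw [hσdef, h1, h2]
        push_cast
        rw [show (Real.pi : ℂ) + -1 * ζ = Real.pi - ζ by ring, Complex.cos_pi_sub]
        simp
    -- the edge, and the direction in which the band extends from it
    obtain ⟨e, he, hedge⟩ : ∃ e : ℝ, (e = 1 ∨ e = -1) ∧
        ∀ t : ℝ, x < θ₀ + e * t ∧ θ₀ + e * t < y ↔ 0 < t ∧ t < y - x := by
      have habs : |discrR α p θ₀| = 2 := by
        rw [hval]
        rcases hσ with h | h <;> rw [h] <;> norm_num
      rcases eq_or_lt_of_le hθ₀.1 with h1 | h1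
      · exact ⟨1, Or.inl rfl, fun t => by
          constructor <;> rintro ⟨_, _⟩ <;> constructor <;> linarith⟩
      · rcases eq_or_lt_of_le hθ₀.2 with h2 | h2
        · exact ⟨-1, Or.inr rfl, fun t => by
            constructor <;> rintro ⟨_, _⟩ <;> constructor <;> linarith⟩
        · exact absurd habs (hin θ₀ ⟨h1, h2⟩).ne
    set f : ℂ → ℂ := fun s => σ * discrC α p (θ₀ + e * s) with hf
    have hfdiff : Differentiable ℂ f := by
      have := differentiable_discrC α p
      have h1 : Differentiable ℂ fun s : ℂ => (θ₀ : ℂ) + e * s := by fun_prop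
      exact (this.comp h1).const_mul _
    have hf0 : f 0 = 2 := by
      simp only [hf, mul_zero, add_zero, discrC_ofReal', hval]
      push_cast
      linear_combination (2 : ℂ) * hσ2
    have hσabs : |σ| = 1 := by rcases hσ with h | h <;> rw [h] <;> norm_num
    obtain ⟨s, hs, hfs, hplace⟩ := exists_edge_chart hfdiff hf0
      (g := fun t => σ * discrR α p (θ₀ + e * t)) (fun t => by
        simp only [hf]
        push_cast
        rw [← discrC_ofReal']
        push_cast
        rfl) (w := y - x) (by linarith) (fun t h1 h2 => by
        rw [abs_mul, hσabs, one_mul]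
        exact hin _ ((hedge t).2 ⟨h1, h2⟩))
      (not_isLittleO_discrC hp hα hσ he hσdef.symm hval)
    have hpt : ∀ ζ : ℂ, 0 < (s ζ).re ∧ (s ζ).re < y - x →
        x < ((θ₀ : ℂ) + e * s ζ).re ∧ ((θ₀ : ℂ) + e * s ζ).re < y := fun ζ h => by
      have : ((θ₀ : ℂ) + e * s ζ).re = θ₀ + e * (s ζ).re := by simp
      rw [this]
      exact (hedge _).2 h
    refine ⟨fun ζ => θ₀ + e * s ζ, analyticAt_const.add (analyticAt_const.mul hs), ?_, ?_⟩
    · filter_upwards [hfs] with ζ h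
      rw [hcosσ, ← h, hf]
      linear_combination (-discrC α p (θ₀ + e * s ζ)) * hσ2
    · rcases hplace with ⟨M, hM, h⟩ | ⟨h1, h2⟩
      · exact Or.inl ⟨M, hM, h.mono fun ζ h h' => hpt ζ (h h')⟩
      · refine Or.inr ⟨hsin, h1.mono fun ζ h => by simp only [h], ?_⟩
        exact h2.mono fun ζ h h' h'' => hpt ζ (h h' h'')

/-! ### Counting zeros in a whole band -/

/-- A relation between the endpoints of intervals that is additive, and holds for short intervals
to the right and to the left of each point, holds for the whole interval. -/
lemma additive_on_Icc {P : ℝ → ℝ → Prop} {u v : ℝ} (huv : u ≤ v) (hrefl : P u u)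
    (hadd : ∀ a c d, u ≤ a → a ≤ c → c ≤ d → d ≤ v → P a c → P c d → P a d)
    (hright : ∀ t ∈ Set.Ico u v, ∃ δ > 0, ∀ ℓ > 0, ℓ ≤ δ → t + ℓ ≤ v → P t (t + ℓ))
    (hleft : ∀ t ∈ Set.Ioc u v, ∃ δ > 0, ∀ ℓ > 0, ℓ ≤ δ → u ≤ t - ℓ → P (t - ℓ) t) :
    P u v := by
  set S : Set ℝ := {t | t ∈ Set.Icc u v ∧ P u t} with hS
  have huS : u ∈ S := ⟨⟨le_rfl, huv⟩, hrefl⟩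
  have hbdd : BddAbove S := ⟨v, fun t ht => ht.1.2⟩
  have hus : u ≤ sSup S := le_csSup hbdd huS
  have hsv : sSup S ≤ v := csSup_le ⟨u, huS⟩ fun t ht => ht.1.2
  have hmem : P u (sSup S) := by
    rcases hus.eq_or_lt with h | h
    · rw [← h]; exact hrefl
    · obtain ⟨δ, hδ, hP⟩ := hleft _ ⟨h, hsv⟩
      obtain ⟨t, ht, hlt⟩ := exists_lt_of_lt_csSup ⟨u, huS⟩ (sub_lt_self (sSup S) hδ)
      have hts := le_csSup hbdd ht
      rcases hts.eq_or_lt with h' | h'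
      · rw [← h']; exact ht.2
      · have h1 := hP (sSup S - t) (by linarith) (by linarith) (by linarith [ht.1.1])
        rw [sub_sub_cancel] at h1
        exact hadd u t _ le_rfl ht.1.1 hts hsv ht.2 h1
  rcases hsv.eq_or_lt with h | h
  · rwa [h] at hmem
  · exfalso
    obtain ⟨δ, hδ, hP⟩ := hright _ ⟨hus, h⟩
    have hℓ : 0 < min δ (v - sSup S) := lt_min hδ (by linarith)
    have hle : sSup S + min δ (v - sSup S) ≤ v := by
      linarith [min_le_right δ (v - sSup S)]
    have h1 := hP _ hℓ (min_le_left _ _) hle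
    have h2 : sSup S + min δ (v - sSup S) ∈ S :=
      ⟨⟨by linarith, hle⟩, hadd u _ _ le_rfl hus (by linarith) hle hmem h1⟩
    linarith [le_csSup hbdd h2]

lemma ncard_bandZeroSet_add {p : ℕ} (hα : ∀ n, ‖α n‖ < 1) {x y : ℝ} (hxy : y - x ≤ 2 * Real.pi)
    (n : ℕ) {a c d : ℝ} (ha : 0 ≤ a) (hac : a ≤ c) (hcd : c ≤ d) (hd : d ≤ Real.pi) :
    (bandZeroSet α p x y n a c).ncard + (bandZeroSet α p x y n c d).ncard ≤
      (bandZeroSet α p x y n a d).ncard := by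
  have hdisj : Disjoint (bandZeroSet α p x y n a c) (bandZeroSet α p x y n c d) := by
    rw [Set.disjoint_left]
    rintro z ⟨-, -, θ, η, hz, hθ, hη, hD⟩ ⟨-, -, θ', η', hz', hθ', hη', hD'⟩
    have h1 := angle_unique hxy hθ hθ' (hz.symm.trans hz')
    rw [h1, hD'] at hD
    have h2 := cos_injective_of_re ⟨by linarith, by linarith⟩ ⟨by linarith, by linarith⟩
      (mul_left_cancel₀ two_ne_zero hD)
    rw [h2] at hη'
    linarith [hη.2, hη'.1]
  rw [← Set.ncard_union_eq hdisj (finite_bandZeroSet hα p x y n a c)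
    (finite_bandZeroSet hα p x y n c d)]
  refine Set.ncard_le_ncard ?_ (finite_bandZeroSet hα p x y n a d)
  rintro z (⟨h1, h2, θ, η, hz, hθ, hη, hD⟩ | ⟨h1, h2, θ, η, hz, hθ, hη, hD⟩)
  · exact ⟨h1, h2, θ, η, hz, hθ, ⟨hη.1, by linarith⟩, hD⟩
  · exact ⟨h1, h2, θ, η, hz, hθ, ⟨by linarith, hη.2⟩, hD⟩

lemma exists_le_ncard_bandZeroSet_residue {p : ℕ} (hp : 0 < p) (hα : ∀ n, ‖α n‖ < 1)
    (hper : ∀ n, α (n + p) = α n) (hne : ∃ n, α n ≠ 0) {x y : ℝ} (h : IsBand α p x y)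
    {b : ℕ} (hb : b < p) :
    ∃ K : ℝ, ∀ m : ℕ, (m : ℝ) - K ≤ (bandZeroSet α p x y (m * p + b) 0 Real.pi).ncard := by
  have hpi := Real.pi_pos
  have key : ∃ K : ℝ, ∀ m : ℕ, (Real.pi - 0) / Real.pi * m - K ≤
      (bandZeroSet α p x y (m * p + b) 0 Real.pi).ncard := by
    refine additive_on_Icc (P := fun a c => ∃ K : ℝ, ∀ m : ℕ, (c - a) / Real.pi * m - K ≤
      (bandZeroSet α p x y (m * p + b) a c).ncard) hpi.le ?_ ?_ ?_ ?_
    · exact ⟨0, fun m => by simp⟩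
    · rintro a c d ha hac hcd hd ⟨K, hK⟩ ⟨K', hK'⟩
      refine ⟨K + K', fun m => ?_⟩
      have h1 : ((bandZeroSet α p x y (m * p + b) a c).ncard : ℝ) +
          (bandZeroSet α p x y (m * p + b) c d).ncard ≤
          (bandZeroSet α p x y (m * p + b) a d).ncard := by
        exact_mod_cast ncard_bandZeroSet_add (p := p) hα h.sub_le (m * p + b) ha hac hcd hd
      have h2 : (d - a) / Real.pi * m = (c - a) / Real.pi * m + (d - c) / Real.pi * m := by ring
      linarith [hK m, hK' m]
    · intro t ht
      obtain ⟨θ, h1, h2, h3⟩ := exists_chart (ε := 1) (η₀ := t) hp hα h (by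
        rcases ht.1.eq_or_lt with h0 | h0
        · exact Or.inr (Or.inl ⟨h0.symm, rfl⟩)
        · exact Or.inl ⟨h0, ht.2⟩)
      obtain ⟨δ, hδ, hδ'⟩ := local_count hp hα hper hne h.sub_le (Or.inl rfl) h1 h2 h3 hb
      refine ⟨δ, hδ, fun ℓ hℓ hle hv => ?_⟩
      rw [add_sub_cancel_left]
      exact hδ' t (t + ℓ) ℓ hℓ hle ht.1 hv fun s hs hs' => ⟨by linarith, by linarith⟩
    · intro t ht
      obtain ⟨θ, h1, h2, h3⟩ := exists_chart (ε := -1) (η₀ := t) hp hα h (by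
        rcases ht.2.eq_or_lt with h0 | h0
        · exact Or.inr (Or.inr ⟨h0, rfl⟩)
        · exact Or.inl ⟨ht.1, h0⟩)
      obtain ⟨δ, hδ, hδ'⟩ := local_count hp hα hper hne h.sub_le (Or.inr rfl) h1 h2 h3 hb
      refine ⟨δ, hδ, fun ℓ hℓ hle hv => ?_⟩
      rw [sub_sub_cancel]
      exact hδ' (t - ℓ) t ℓ hℓ hle hv ht.2 fun s hs hs' => ⟨by linarith, by linarith⟩
  obtain ⟨K, hK⟩ := key
  refine ⟨K, fun m => ?_⟩
  have := hK m
  rwa [sub_zero, div_self hpi.ne', one_mul] at this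

/-- Every open band carries at least `n / p - O(1)` zeros of `φ_n` close to the circle. -/
lemma exists_le_ncard_bandZeroSet {p : ℕ} (hp : 0 < p) (hα : ∀ n, ‖α n‖ < 1)
    (hper : ∀ n, α (n + p) = α n) (hne : ∃ n, α n ≠ 0) {x y : ℝ} (h : IsBand α p x y) :
    ∃ K : ℝ, ∀ n : ℕ, (n : ℝ) / p - K ≤ (bandZeroSet α p x y n 0 Real.pi).ncard := by
  choose! K hK using fun b (hb : b < p) =>
    exists_le_ncard_bandZeroSet_residue hp hα hper hne h hb
  refine ⟨(∑ b ∈ Finset.range p, |K b|) + 1, fun n => ?_⟩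
  have hb := Nat.mod_lt n hp
  have h1 := hK _ hb (n / p)
  rw [Nat.div_add_mod'] at h1
  have h2 : |K (n % p)| ≤ ∑ b ∈ Finset.range p, |K b| :=
    Finset.single_le_sum (f := fun b => |K b|) (fun b _ => abs_nonneg _) (Finset.mem_range.2 hb)
  have h3 : (n : ℝ) / p ≤ (n / p : ℕ) + 1 := by
    rw [div_le_iff₀ (by exact_mod_cast hp)]
    have h4 := (Nat.lt_div_mul_add hp (a := n)).le
    have h5 : n ≤ (n / p + 1) * p := by rw [add_mul, one_mul]; exact h4
    exact_mod_cast h5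
  linarith [le_abs_self (K (n % p))]

/-! ### The bands and the zeros of the discriminant -/

lemma exp_mul_I_eq_iff {s t : ℝ} :
    Complex.exp (s * Complex.I) = Complex.exp (t * Complex.I) ↔
      ∃ k : ℤ, s = t + k * (2 * Real.pi) := by
  rw [Complex.exp_eq_exp_iff_exists_int]
  refine exists_congr fun k => ?_
  have h : (t * Complex.I + k * (2 * Real.pi * Complex.I) : ℂ) =
      (t + k * (2 * Real.pi) : ℝ) * Complex.I := by
    push_cast; ring
  rw [h, mul_left_inj' Complex.I_ne_zero, Complex.ofReal_inj]

/-- Representatives of the bands modulo `2π`, indexed by the zeros of the trace. Distinct ones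
have at most endpoints in common modulo `2π`. -/
lemma exists_band_representatives {p : ℕ} (hp : 0 < p) (hα : ∀ n, ‖α n‖ < 1) :
    ∃ X Y : ℂ → ℝ, (∀ w ∈ (tracePoly α p).roots.toFinset, IsBand α p (X w) (Y w)) ∧
      (∀ w ∈ (tracePoly α p).roots.toFinset, ∀ w' ∈ (tracePoly α p).roots.toFinset,
        ∀ k : ℤ, ∀ t ∈ Set.Icc (X w) (Y w),
          t ∈ Set.Ioo (X w' + k * (2 * Real.pi)) (Y w' + k * (2 * Real.pi)) → w = w') ∧
      ∀ x y, IsBand α p x y → ∃ w ∈ (tracePoly α p).roots.toFinset, ∃ k : ℤ,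
        x = X w + k * (2 * Real.pi) ∧ y = Y w + k * (2 * Real.pi) := by
  have hne : tracePoly α p ≠ 0 := by
    intro h
    have := card_trace_roots hp hα
    rw [h] at this
    simp at this
    omega
  have hex : ∀ w ∈ (tracePoly α p).roots.toFinset, ∃ x y t : ℝ, IsBand α p x y ∧
      t ∈ Set.Ioo x y ∧ discrR α p t = 0 ∧ w = Complex.exp (t * Complex.I) := by
    intro w hw
    rw [Multiset.mem_toFinset, mem_roots hne] at hw
    obtain ⟨t, h1, h2⟩ := exists_angle_of_trace_root hp hα hw
    obtain ⟨x, y, h3, h4⟩ := exists_isBand (θ := t) hp hα (by rw [h2]; norm_num)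
    exact ⟨x, y, t, h3, h4, h2, h1⟩
  choose! X Y t hband hmem hzero hw using hex
  have hshift0 : ∀ (s : ℝ) (k : ℤ), discrR α p s = 0 →
      discrR α p (s + k * (2 * Real.pi)) = 0 := by
    intro s k hs
    rw [← abs_eq_zero, abs_discrR_add_two_pi, hs, abs_zero]
  refine ⟨X, Y, hband, ?_, ?_⟩
  · intro w hwr w' hwr' k s hs hs'
    obtain ⟨e1, e2⟩ := (hband w hwr).eq_of_mem ((hband w' hwr').add_two_pi k) hs hs'
    have h1 := hmem w' hwr'
    have h2 : t w = t w' + k * (2 * Real.pi) :=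
      (hband w hwr).zero_unique hp hα (hmem w hwr)
        ⟨by rw [e1]; linarith [h1.1], by rw [e2]; linarith [h1.2]⟩ (hzero w hwr)
        (hshift0 _ _ (hzero w' hwr'))
    rw [hw w hwr, hw w' hwr', h2]
    exact exp_mul_I_eq_iff.2 ⟨k, rfl⟩
  · intro x y h
    obtain ⟨s, hs, hs0⟩ := h.exists_zero hp hα
    have hr : Complex.exp (s * Complex.I) ∈ (tracePoly α p).roots.toFinset := by
      rw [Multiset.mem_toFinset, mem_roots hne]
      refine discrC_eq_zero_iff.1 ?_
      rw [discrC_ofReal', hs0, Complex.ofReal_zero]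
    refine ⟨_, hr, ?_⟩
    have h1 := hw _ hr
    set w := Complex.exp (s * Complex.I)
    obtain ⟨k, h2⟩ := exp_mul_I_eq_iff.1 h1
    have h3 := hmem w hr
    refine ⟨k, h.eq_of_mem ((hband w hr).add_two_pi k) ⟨hs.1.le, hs.2.le⟩ ?_⟩
    rw [h2]
    exact ⟨by linarith [h3.1], by linarith [h3.2]⟩

lemma argIn_add_two_pi (z : ℂ) (x y : ℝ) (k : ℤ) :
    ArgIn z (x + k * (2 * Real.pi)) (y + k * (2 * Real.pi)) ↔ ArgIn z x y := by
  refine and_congr_right fun hz => ⟨?_, ?_⟩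
  · rintro ⟨θ, ⟨h1, h2⟩, h3⟩
    refine ⟨θ - k * (2 * Real.pi), ⟨by linarith, by linarith⟩, ?_⟩
    rwa [exp_mul_I_eq_iff.2 ⟨k, (sub_add_cancel θ (k * (2 * Real.pi))).symm⟩] at h3
  · rintro ⟨θ, ⟨h1, h2⟩, h3⟩
    refine ⟨θ + k * (2 * Real.pi), ⟨by linarith, by linarith⟩, ?_⟩
    rwa [exp_mul_I_eq_iff.2 ⟨k, rfl⟩]

lemma bandZeros_add_two_pi (α : ℕ → ℂ) (n : ℕ) (x y : ℝ) (k : ℤ) :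
    bandZeros α n (x + k * (2 * Real.pi)) (y + k * (2 * Real.pi)) = bandZeros α n x y := by
  classical
  unfold bandZeros
  exact Multiset.filter_congr fun z _ => by rw [argIn_add_two_pi]

lemma mem_bandZeros {n : ℕ} (hα : ∀ n, ‖α n‖ < 1) {x y : ℝ} {z : ℂ} :
    z ∈ bandZeros α n x y ↔ (phi α n).eval z = 0 ∧ ArgIn z x y ∧
      1 - ‖z‖ ≤ (n : ℝ) ^ (-(1 / 2) : ℝ) := by
  classical
  unfold bandZeros
  rw [Multiset.mem_filter, mem_roots (phi_ne_zero hα n)]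
  rfl

/-- A zero counted in an open band, in polar form. -/
lemma polar_of_mem_bandZeroSet {p n : ℕ} {x y a c : ℝ} {z : ℂ}
    (hz : z ∈ bandZeroSet α p x y n a c) :
    z ≠ 0 ∧ ∃ t ∈ Set.Ioo x y, z = ‖z‖ * Complex.exp (t * Complex.I) := by
  obtain ⟨-, -, θ, η, rfl, hθ, -, -⟩ := hz
  refine ⟨Complex.exp_ne_zero _, θ.re, hθ, ?_⟩
  rw [norm_exp_mul_I, Complex.ofReal_exp, ← Complex.exp_add]
  congr 1
  conv_lhs => rw [← Complex.re_add_im θ]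
  push_cast
  linear_combination (θ.im : ℂ) * Complex.I_mul_I

lemma ncard_bandZeroSet_le_card_bandZeros {p n : ℕ} (hα : ∀ n, ‖α n‖ < 1) (x y a c : ℝ) :
    (bandZeroSet α p x y n a c).ncard ≤ (bandZeros α n x y).card := by
  have h1 : bandZeroSet α p x y n a c ⊆ ↑(bandZeros α n x y).toFinset := by
    intro z hz
    obtain ⟨h0, t, ht, hzt⟩ := polar_of_mem_bandZeroSet hz
    rw [Finset.mem_coe, Multiset.mem_toFinset, mem_bandZeros hα]
    exact ⟨hz.1, ⟨h0, t, ⟨ht.1.le, ht.2.le⟩, hzt⟩, hz.2.1⟩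
  calc _ ≤ (↑(bandZeros α n x y).toFinset : Set ℂ).ncard :=
        Set.ncard_le_ncard h1 (Finset.finite_toSet _)
    _ = (bandZeros α n x y).toFinset.card := Set.ncard_coe_finset _
    _ ≤ _ := Multiset.toFinset_card_le _

/-- The zeros with argument in one closed band, together with those in the other open bands, are at
most as many as the degree allows. -/
lemma card_bandZeros_add_sum_le {p n : ℕ} (hα : ∀ n, ‖α n‖ < 1) {ι : Type*} [DecidableEq ι]
    {s : Finset ι} {X Y : ι → ℝ} {i : ι} (hi : i ∈ s)
    (hdisj : ∀ j ∈ s, ∀ j' ∈ s, ∀ k : ℤ, ∀ t ∈ Set.Icc (X j) (Y j),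
      t ∈ Set.Ioo (X j' + k * (2 * Real.pi)) (Y j' + k * (2 * Real.pi)) → j = j') :
    (bandZeros α n (X i) (Y i)).card +
      ∑ j ∈ s.erase i, (bandZeroSet α p (X j) (Y j) n 0 Real.pi).ncard ≤ n := by
  classical
  have hpolar : ∀ j ∈ s, ∀ j' ∈ s, ∀ z : ℂ, z ≠ 0 →
      (∃ t ∈ Set.Icc (X j) (Y j), z = ‖z‖ * Complex.exp (t * Complex.I)) →
      (∃ t ∈ Set.Ioo (X j') (Y j'), z = ‖z‖ * Complex.exp (t * Complex.I)) → j = j' := by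
    rintro j hj j' hj' z hz ⟨t, ht, h1⟩ ⟨t', ht', h2⟩
    have hn : (‖z‖ : ℂ) ≠ 0 := by exact_mod_cast norm_ne_zero_iff.2 hz
    have h3 : Complex.exp (t * Complex.I) = Complex.exp (t' * Complex.I) :=
      mul_left_cancel₀ hn (h1.symm.trans h2)
    obtain ⟨k, h5⟩ := exp_mul_I_eq_iff.1 h3
    refine hdisj j hj j' hj' k t ht ?_
    rw [h5]
    exact ⟨by linarith [ht'.1], by linarith [ht'.2]⟩
  set F : ι → Finset ℂ := fun j =>
    (finite_bandZeroSet hα p (X j) (Y j) n 0 Real.pi).toFinset with hF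
  have hFcard : ∀ j, (F j).card = (bandZeroSet α p (X j) (Y j) n 0 Real.pi).ncard := fun j =>
    (Set.ncard_eq_toFinset_card _ _).symm
  have hpair : (↑(s.erase i) : Set ι).PairwiseDisjoint F := by
    intro j hj j' hj' hjj'
    rw [Function.onFun, Finset.disjoint_left]
    intro z h1 h2
    rw [Set.Finite.mem_toFinset] at h1 h2
    obtain ⟨h0, t, ht, hzt⟩ := polar_of_mem_bandZeroSet h1
    exact hjj' (hpolar j (Finset.mem_of_mem_erase hj) j' (Finset.mem_of_mem_erase hj') z h0
      ⟨t, ⟨ht.1.le, ht.2.le⟩, hzt⟩ (polar_of_mem_bandZeroSet h2).2)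
  set U := (s.erase i).biUnion F with hU
  have hUcard : U.card = ∑ j ∈ s.erase i, (bandZeroSet α p (X j) (Y j) n 0 Real.pi).ncard := by
    rw [hU, Finset.card_biUnion hpair]
    exact Finset.sum_congr rfl fun j _ => hFcard j
  have hle : bandZeros α n (X i) (Y i) + U.val ≤ (phi α n).roots := by
    have hd : Disjoint (bandZeros α n (X i) (Y i)) U.val := by
      rw [Multiset.disjoint_left]
      intro z h1 h2
      rw [Finset.mem_val, hU, Finset.mem_biUnion] at h2
      obtain ⟨j, hj, hz⟩ := h2
      rw [Set.Finite.mem_toFinset] at hz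
      obtain ⟨h0, h3⟩ := polar_of_mem_bandZeroSet hz
      have h4 := ((mem_bandZeros hα).1 h1).2.1.2
      exact (Finset.ne_of_mem_erase hj)
        (hpolar i hi j (Finset.mem_of_mem_erase hj) z h0 h4 h3).symm
    rw [Multiset.add_eq_union_iff_disjoint.2 hd]
    refine Multiset.union_le (Multiset.filter_le _ _) ?_
    rw [Finset.val_le_iff_val_subset]
    intro z hz
    rw [Finset.mem_val, hU, Finset.mem_biUnion] at hz
    obtain ⟨j, hj, hz⟩ := hz
    rw [Set.Finite.mem_toFinset] at hz
    exact (mem_roots (phi_ne_zero hα n)).2 hz.1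
  have := Multiset.card_le_card hle
  rw [Multiset.card_add, Finset.card_val, hUcard] at this
  exact this.trans ((card_roots' _).trans (natDegree_phi_le α n))

lemma exists_abs_card_bandZeros_sub_le {p : ℕ} (hp : 0 < p) (hα : ∀ n, ‖α n‖ < 1)
    (hper : ∀ n, α (n + p) = α n) (hne : ∃ n, α n ≠ 0) :
    ∃ K : ℝ, ∀ n : ℕ, ∀ x y : ℝ, IsBand α p x y →
      |((bandZeros α n x y).card : ℝ) - (n : ℝ) / (p : ℝ)| ≤ K := by
  obtain ⟨X, Y, hband, hdisj, hrep⟩ := exists_band_representatives hp hα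
  set s := (tracePoly α p).roots.toFinset with hs
  choose! K hK using fun w (hw : w ∈ s) =>
    exists_le_ncard_bandZeroSet hp hα hper hne (hband w hw)
  have hKle : ∀ w ∈ s, |K w| ≤ ∑ w ∈ s, |K w| := fun w hw =>
    Finset.single_le_sum (f := fun w => |K w|) (fun b _ => abs_nonneg _) hw
  refine ⟨∑ w ∈ s, |K w|, fun n x y h => ?_⟩
  obtain ⟨w, hw, k, rfl, rfl⟩ := hrep x y h
  rw [bandZeros_add_two_pi, abs_le]
  constructor
  · have h1 : ((bandZeroSet α p (X w) (Y w) n 0 Real.pi).ncard : ℝ) ≤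
        (bandZeros α n (X w) (Y w)).card := by
      exact_mod_cast ncard_bandZeroSet_le_card_bandZeros hα _ _ _ _
    linarith [hK w hw n, hKle w hw, le_abs_self (K w)]
  · have h1 : ((bandZeros α n (X w) (Y w)).card : ℝ) +
        ∑ j ∈ s.erase w, ((bandZeroSet α p (X j) (Y j) n 0 Real.pi).ncard : ℝ) ≤ n := by
      exact_mod_cast card_bandZeros_add_sum_le hα hw hdisj
    have h2 : ∑ j ∈ s.erase w, ((n : ℝ) / p - |K j|) ≤
        ∑ j ∈ s.erase w, ((bandZeroSet α p (X j) (Y j) n 0 Real.pi).ncard : ℝ) :=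
      Finset.sum_le_sum fun j hj => by
        have := hK j (Finset.mem_of_mem_erase hj) n
        linarith [le_abs_self (K j)]
    have h3 : ∑ j ∈ s.erase w, |K j| ≤ ∑ j ∈ s, |K j| :=
      Finset.sum_le_sum_of_subset_of_nonneg (Finset.erase_subset _ _) fun _ _ _ => abs_nonneg _
    have h4 : ((s.erase w).card : ℝ) = p - 1 := by
      rw [Finset.card_erase_of_mem hw, hs, card_trace_roots hp hα, Nat.cast_sub hp, Nat.cast_one]
    rw [Finset.sum_sub_distrib, Finset.sum_const, nsmul_eq_mul, h4] at h2
    have hp' : (p : ℝ) ≠ 0 := by exact_mod_cast hp.ne'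
    have h5 : ((p : ℝ) - 1) * (n / p) = n - n / p := by field_simp
    linarith

/-- The union of the bands is compact, because modulo `2π` there are finitely many. -/
lemma exists_isCompact_bands {p : ℕ} (hp : 0 < p) (hα : ∀ n, ‖α n‖ < 1) :
    ∃ s : Set ℂ, IsCompact s ∧
      ∀ z, z ∈ s ↔ ∃ x y θ : ℝ, IsBand α p x y ∧ θ ∈ Set.Icc x y ∧
        z = Complex.exp (θ * Complex.I) := by
  obtain ⟨X, Y, hband, -, hrep⟩ := exists_band_representatives hp hα
  refine ⟨⋃ w ∈ (tracePoly α p).roots.toFinset,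
    (fun θ : ℝ => Complex.exp (θ * Complex.I)) '' Set.Icc (X w) (Y w), ?_, fun z => ?_⟩
  · exact Finset.isCompact_biUnion _ fun w _ => isCompact_Icc.image (by fun_prop)
  · simp only [Set.mem_iUnion, Set.mem_image]
    constructor
    · rintro ⟨w, hw, θ, hθ, rfl⟩
      exact ⟨_, _, θ, hband w hw, hθ, rfl⟩
    · rintro ⟨x, y, θ, h, hθ, rfl⟩
      obtain ⟨w, hw, k, rfl, rfl⟩ := hrep x y h
      refine ⟨w, hw, θ - k * (2 * Real.pi), ⟨by linarith [hθ.1], by linarith [hθ.2]⟩, ?_⟩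
      exact exp_mul_I_eq_iff.2 ⟨-k, by push_cast; ring⟩

end PeriodicOPUC

end

theorem theorem3p5 (α : ℕ → ℂ) (p : ℕ) (hp : 0 < p) (hα : ∀ n, ‖α n‖ < 1)
    (hper : ∀ n, α (n + p) = α n) (hne : ∃ n, α n ≠ 0) :
    (∃ K : ℝ, ∀ n : ℕ, ∀ x y : ℝ, PeriodicOPUC.IsBand α p x y →
      |((PeriodicOPUC.bandZeros α n x y).card : ℝ) - (n : ℝ) / (p : ℝ)| ≤ K) ∧
    (∃ K : ℝ, ∃ n₀ : ℕ, ∀ n : ℕ, n₀ ≤ n → ∀ x y : ℝ, PeriodicOPUC.IsBand α p x y →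
      ∀ z ∈ PeriodicOPUC.bandZeros α n x y, 1 - ‖z‖ ≤ K * (Real.log (n : ℝ) / (n : ℝ))) ∧
    ((∀ z₀ : ℂ, ¬ PeriodicOPUC.IsSingularPoint α p z₀) →
      ∃ K : ℝ, ∃ n₀ : ℕ, ∀ n : ℕ, n₀ ≤ n → ∀ x y : ℝ, PeriodicOPUC.IsBand α p x y →
        ∀ z ∈ PeriodicOPUC.bandZeros α n x y, 1 - ‖z‖ ≤ K * (1 / (n : ℝ))) := by
  refine ⟨PeriodicOPUC.exists_abs_card_bandZeros_sub_le hp hα hper hne, ?_, fun hns => ?_⟩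
  · obtain ⟨K, n₀, h⟩ := PeriodicOPUC.zeros_log_bound hp hα hper hne
    refine ⟨K, n₀, fun n hn x y _ z hz => ?_⟩
    obtain ⟨h1, -, h2⟩ := (PeriodicOPUC.mem_bandZeros hα).1 hz
    exact h n hn z ⟨h1, h2⟩
  · obtain ⟨s, hs, hmem⟩ := PeriodicOPUC.exists_isCompact_bands (α := α) hp hα
    obtain ⟨K, n₀, h⟩ := PeriodicOPUC.zeros_inv_bound hp hα hper hs
      (fun z hz => by
        obtain ⟨x, y, θ, -, -, rfl⟩ := (hmem z).1 hz
        exact Complex.norm_exp_ofReal_mul_I θ)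
      (fun z hz b hb ht => hns z ⟨(hmem z).1 hz, b, hb, ht⟩)
    refine ⟨K, n₀, fun n hn x y hxy z hz => ?_⟩
    obtain ⟨h1, ⟨-, θ, hθ, hzθ⟩, h2⟩ := (PeriodicOPUC.mem_bandZeros hα).1 hz
    exact h n hn z ⟨h1, h2, _, (hmem _).2 ⟨x, y, θ, hxy, hθ, rfl⟩, hzθ⟩
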